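/- Let $0<\mu<1$, let $\Omega\subset\mathbb{R}^2$ be a bounded domain and let $D$ be a domain with $\overline D\subset\Omega$, both of class $\mathcal C^{1,\mu}$. Write $\Gamma_i=\partial D$, $\Gamma_e=\partial\Omega$, with arc length $\sigma$ and outward unit normals $\nu_i$, $\nu_e$ (to $D$ and to $\Omega$, respectively). Let $G(x)=\frac1{2\pi}\ln|x|$, and for $\Gamma\in\{\Gamma_i,\Gamma_e\}$, with outward unit normal $\nu$, and $\varphi\in L^2(\Gamma)$ (complex valued) put $$\mathcal S_\Gamma[\varphi](x)=\int_\Gamma G(x-y)\varphi(y)\,d\sigma(y)\quad(x\in\mathbb{R}^2),\qquad \mathcal K_\Gamma^*[\varphi](x)=\frac1{2\pi}\int_\Gamma\frac{\langle x-y,\nu(x)\rangle}{|x-y|^2}\varphi(y)\,d\sigma(y)\quad(x\in\Gamma).$$ Then the Neumann–Poincaré-type operator $$\mathbb K^*=\begin{bmatrix}-\mathcal K_{\Gamma_i}^* & -\frac{\partial}{\partial\nu_i}\mathcal S_{\Gamma_e}\\[2pt] \frac{\partial}{\partial\nu_e}\mathcal S_{\Gamma_i} & \mathcal K_{\Gamma_e}^*\end{bmatrix}$$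 is a well-defined bounded linear operator on the complex Hilbert space $L^2(\Gamma_i)\times L^2(\Gamma_e)$ (the integrals defining $\mathcal K_{\Gamma_i}^*[\varphi]$ and $\mathcal K_{\Gamma_e}^*[\varphi]$ converge absolutely almost everywhere, and $\mathcal S_{\Gamma_e}[\varphi]$ and $\mathcal S_{\Gamma_i}[\varphi]$ are differentiable at the points of $\Gamma_i$ and $\Gamma_e$, respectively), and its spectrum lies in the real interval $[-\frac12,\frac12]$. -/

import Mathlib

open MeasureTheory Filter Topology
open scoped NNReal ENNReal

noncomputable section

namespace NeumannPoincare

/-- The Euclidean plane `ℝ²`. -/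
abbrev Plane : Type := EuclideanSpace ℝ (Fin 2)

/-- `E` is of class `C^{1,α}`: near each boundary point `p` and in suitable orthonormal coordinates
centred at `p`, the set `E` is the region strictly above the graph of a `C¹` function whose
derivative is Hölder continuous with exponent `α`. (A function with these properties on an interval
around `0` extends to one on `ℝ` after shrinking the interval, so taking `f` on all of `ℝ` is no
restriction.) -/
def IsOfClassC1Holder (α : ℝ≥0) (E : Set Plane) : Prop :=
  ∀ p ∈ frontier E, ∃ (e : Plane ≃ₗᵢ[ℝ] Plane) (f : ℝ → ℝ) (C : ℝ≥0) (r : ℝ),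
    0 < r ∧ ContDiff ℝ 1 f ∧ HolderWith C α (deriv f) ∧
      ∀ x ∈ Metric.ball p r, x ∈ E ↔ f (e (x - p) 0) < e (x - p) 1

/-- A domain: a non-empty, open and connected set. -/
def IsDomainSet (E : Set Plane) : Prop := IsOpen E ∧ IsConnected E

/-- `n` is the outward unit normal to `∂E` at `x`: it is a unit vector, and to first order at `x`
the set `E` is the half-plane `⟪y - x, n⟫ < 0`. -/
def IsOutwardUnitNormal (E : Set Plane) (x n : Plane) : Prop :=
  ‖n‖ = 1 ∧ ∀ ε > 0, ∀ᶠ y in 𝓝 x,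
    (y ∈ E → inner ℝ (y - x) n ≤ ε * ‖y - x‖) ∧
    (y ∉ E → -(ε * ‖y - x‖) ≤ inner ℝ (y - x) n)

/-- The outward unit normal `ν(x)` to `∂E` at `x` (with an irrelevant value where there is none). -/
def outwardNormal (E : Set Plane) (x : Plane) : Plane :=
  Classical.epsilon fun n => IsOutwardUnitNormal E x n

/-- Arc length `σ` on `∂E`, i.e. one-dimensional Hausdorff measure restricted to `∂E`. -/
def bdryMeasure (E : Set Plane) : Measure Plane :=
  (Measure.hausdorffMeasure 1).restrict (frontier E)

/-- The complex Hilbert space `L²(∂E)`. -/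
abbrev L2Bdry (E : Set Plane) : Type := Lp ℂ 2 (bdryMeasure E)

/-- The fundamental solution `G(x) = (1 / 2π) ln |x|` of the Laplacian in the plane. -/
def fundamentalSolution (x : Plane) : ℝ := 1 / (2 * Real.pi) * Real.log ‖x‖

/-- The single layer potential `S_{∂E}[φ](x) = ∫_{∂E} G(x - y) φ(y) dσ(y)`. -/
def singleLayer (E : Set Plane) (φ : Plane → ℂ) (x : Plane) : ℂ :=
  ∫ y, fundamentalSolution (x - y) • φ y ∂(bdryMeasure E)

/-- The normal derivative on `∂E` of a function that is differentiable across `∂E`: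
`∂u/∂ν (x) = ⟨∇u(x), ν(x)⟩`, where `ν` is the outward unit normal to `∂E`. -/
def normalDeriv (E : Set Plane) (u : Plane → ℂ) (x : Plane) : ℂ :=
  fderiv ℝ u x (outwardNormal E x)

/-- The kernel `(1 / 2π) ⟨x - y, ν(x)⟩ / |x - y|²` of the operator `K*_{∂E}`. -/
def npAdjointKernel (E : Set Plane) (x y : Plane) : ℝ :=
  1 / (2 * Real.pi) * (inner ℝ (x - y) (outwardNormal E x) / ‖x - y‖ ^ 2)

/-- `K*_{∂E}[φ](x) = (1 / 2π) ∫_{∂E} ⟨x - y, ν(x)⟩ / |x - y|² φ(y) dσ(y)`. -/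
def npAdjoint (E : Set Plane) (φ : Plane → ℂ) (x : Plane) : ℂ :=
  ∫ y, npAdjointKernel E x y • φ y ∂(bdryMeasure E)

/-- The Hilbert space `L²(∂D) × L²(∂Ω)`. -/
abbrev BdryPair (D Ω : Set Plane) : Type := WithLp 2 (L2Bdry D × L2Bdry Ω)

/-- The bounded operator `K` on `L²(∂D) × L²(∂Ω)` is the Neumann–Poincaré-type operator
`𝕂* = [[-K*_{∂D}, -∂/∂ν_i S_{∂Ω}], [∂/∂ν_e S_{∂D}, K*_{∂Ω}]]`. The first four fields say that the
integrals and derivatives in this matrix really exist, the last two that `K` is given by it. -/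
structure IsNPTypeOperator (D Ω : Set Plane) (K : BdryPair D Ω →L[ℂ] BdryPair D Ω) : Prop where
  integrable_inner : ∀ φ : L2Bdry D, ∀ᵐ x ∂(bdryMeasure D),
    Integrable (fun y => npAdjointKernel D x y • φ y) (bdryMeasure D)
  integrable_outer : ∀ φ : L2Bdry Ω, ∀ᵐ x ∂(bdryMeasure Ω),
    Integrable (fun y => npAdjointKernel Ω x y • φ y) (bdryMeasure Ω)
  differentiableAt_inner : ∀ φ : L2Bdry Ω, ∀ x ∈ frontier D,
    DifferentiableAt ℝ (singleLayer Ω φ) x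
  differentiableAt_outer : ∀ φ : L2Bdry D, ∀ x ∈ frontier Ω,
    DifferentiableAt ℝ (singleLayer D φ) x
  fst_eq : ∀ Φ : BdryPair D Ω, ∀ᵐ x ∂(bdryMeasure D),
    (K Φ).fst x = -npAdjoint D Φ.fst x - normalDeriv D (singleLayer Ω Φ.snd) x
  snd_eq : ∀ Φ : BdryPair D Ω, ∀ᵐ x ∂(bdryMeasure Ω),
    (K Φ).snd x = normalDeriv Ω (singleLayer D Φ.fst) x + npAdjoint Ω Φ.snd x

/-- There is at most one such operator. -/
theorem IsNPTypeOperator.unique {D Ω : Set Plane} {K K' : BdryPair D Ω →L[ℂ] BdryPair D Ω}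
    (h : IsNPTypeOperator D Ω K) (h' : IsNPTypeOperator D Ω K') : K = K' := by
  ext Φ : 1
  have h1 : (K Φ).fst = (K' Φ).fst := by
    apply Lp.ext
    filter_upwards [h.fst_eq Φ, h'.fst_eq Φ] with x hx hx'
    rw [hx, hx']
  have h2 : (K Φ).snd = (K' Φ).snd := by
    apply Lp.ext
    filter_upwards [h.snd_eq Φ, h'.snd_eq Φ] with x hx hx'
    rw [hx, hx']
  exact (WithLp.equiv 2 _).injective (Prod.ext h1 h2)

/-- There is at most one outward unit normal at a given point. -/
theorem IsOutwardUnitNormal.unique {E : Set Plane} {x n n' : Plane}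
    (h : IsOutwardUnitNormal E x n) (h' : IsOutwardUnitNormal E x n') : n = n' := by
  have key : ∀ v : Plane, 0 < inner ℝ v n → 0 ≤ inner ℝ v n' := by
    intro v hv
    by_contra! hneg
    have hv0 : 0 < ‖v‖ := by
      rw [norm_pos_iff]
      rintro rfl
      simp at hv
    have hlim : Tendsto (fun t : ℝ => x + t • v) (𝓝[>] 0) (𝓝 x) := by
      have hc : Continuous fun t : ℝ => x + t • v := by fun_prop
      have := hc.tendsto 0
      simp only [zero_smul, add_zero] at this
      exact this.mono_left nhdsWithin_le_nhds
    have e1 := hlim.eventually (h.2 (inner ℝ v n / (2 * ‖v‖)) (by positivity))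
    have e2 := hlim.eventually (h'.2 (-inner ℝ v n' / (2 * ‖v‖)) (by
      apply div_pos <;> linarith))
    obtain ⟨t, ⟨⟨a1, a2⟩, b1, b2⟩, ht⟩ :=
      ((e1.and e2).and (self_mem_nhdsWithin : Set.Ioi (0 : ℝ) ∈ 𝓝[>] 0)).exists
    have ht : 0 < t := ht
    simp only [add_sub_cancel_left, inner_smul_left, norm_smul, Real.norm_eq_abs, abs_of_pos ht,
      RCLike.conj_to_real] at a1 a2 b1 b2
    by_cases hm : x + t • v ∈ E
    · have := a1 hm
      have hh : inner ℝ v n / (2 * ‖v‖) * (t * ‖v‖) = t * inner ℝ v n / 2 := by field_simp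
      rw [hh] at this
      nlinarith [mul_pos ht hv]
    · have := b2 hm
      have hh : -inner ℝ v n' / (2 * ‖v‖) * (t * ‖v‖) = -(t * inner ℝ v n' / 2) := by field_simp
      rw [hh] at this
      nlinarith [mul_pos_of_neg_of_neg hneg (neg_neg_of_pos ht)]
  have hle : 1 ≤ inner ℝ n n' := by
    by_contra! hlt
    have hn : inner ℝ n n = 1 := by rw [real_inner_self_eq_norm_sq, h.1]; norm_num
    have hn' : inner ℝ n' n' = 1 := by rw [real_inner_self_eq_norm_sq, h'.1]; norm_num
    have hge : 0 ≤ inner ℝ n n' := key n (by rw [hn]; norm_num)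
    set c : ℝ := inner ℝ n n' with hc
    have hc' : inner ℝ n' n = c := by rw [real_inner_comm]
    have := key (n - ((1 + c) / 2) • n') (by
      rw [inner_sub_left, inner_smul_left, hn, hc']
      simp only [RCLike.conj_to_real]
      nlinarith)
    rw [inner_sub_left, inner_smul_left, hn', ← hc] at this
    simp only [RCLike.conj_to_real] at this
    linarith
  exact (inner_eq_one_iff_of_norm_eq_one h.1 h'.1).1
    (le_antisymm ((real_inner_le_norm n n').trans (by rw [h.1, h'.1]; norm_num)) hle)

/-- A set of class `C^{1,α}` has an outward unit normal at each boundary point. -/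
theorem IsOfClassC1Holder.exists_outwardUnitNormal {α : ℝ≥0} {E : Set Plane} (h : IsOfClassC1Holder α E) {p : Plane} (hp : p ∈ frontier E) :
    ∃ n, IsOutwardUnitNormal E p n := by
  obtain ⟨e, f, C, r, hr, hf, -, hE⟩ := h p hp
  have hcont : Continuous f := hf.continuous
  have f0 : f 0 = 0 := by
    have c1 : Continuous fun x : Plane => f (e (x - p) 0) := by fun_prop
    have c2 : Continuous fun x : Plane => e (x - p) 1 := by fun_prop
    have hb : Metric.ball p r ∈ 𝓝 p := Metric.ball_mem_nhds p hr
    rcases lt_trichotomy (f 0) 0 with h0 | h0 | h0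
    · exfalso
      have : ∀ᶠ x in 𝓝 p, f (e (x - p) 0) < e (x - p) 1 :=
        c1.continuousAt.eventually_lt c2.continuousAt (by simpa using h0)
      have : E ∈ 𝓝 p := by
        filter_upwards [this, hb] with x h1 h2 using (hE x h2).2 h1
      exact hp.2 (mem_interior_iff_mem_nhds.2 this)
    · exact h0
    · exfalso
      have : ∀ᶠ x in 𝓝 p, e (x - p) 1 < f (e (x - p) 0) :=
        c2.continuousAt.eventually_lt c1.continuousAt (by simpa using h0)
      have : ∀ᶠ x in 𝓝 p, x ∉ E := by
        filter_upwards [this, hb] with x h1 h2 h3 using lt_asymm h1 ((hE x h2).1 h3)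
      obtain ⟨x, hx, hx'⟩ := mem_closure_iff_nhds.1 hp.1 _ this
      exact hx hx'
  set a := deriv f 0
  have hd : HasDerivAt f a 0 := (hf.differentiable (by norm_num) 0).hasDerivAt
  set s := Real.sqrt (a ^ 2 + 1) with hs
  have hs1 : 0 < s := Real.sqrt_pos.2 (by positivity)
  have hss : s ^ 2 = a ^ 2 + 1 := Real.sq_sqrt (by positivity)
  have hs1' : 1 ≤ s := by nlinarith [sq_nonneg a]
  set m : Plane := !₂[a / s, -1 / s]
  have hm : ∀ v : Plane, inner ℝ v (e.symm m) = (a * e v 0 - e v 1) / s := by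
    intro v
    rw [← e.inner_map_map, e.apply_symm_apply]
    simp [m, PiLp.inner_apply, Fin.sum_univ_two]
    field_simp
    ring
  refine ⟨e.symm m, ?_, ?_⟩
  · rw [e.symm.norm_map, EuclideanSpace.norm_eq, Fin.sum_univ_two]
    simp [m, div_pow]
    rw [hss]; field_simp
  · intro ε hε
    rw [hasDerivAt_iff_isLittleO] at hd
    have h1 := hd.def hε
    have c1 : Continuous fun x : Plane => (e (x - p) 0) := by fun_prop
    have h2 := c1.continuousAt.tendsto (x := p)
    simp only [sub_self, map_zero, PiLp.zero_apply] at h2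
    filter_upwards [h2.eventually h1, Metric.ball_mem_nhds p hr] with y hy hyb
    rw [hm, hE y hyb]
    simp only [f0, sub_zero, smul_eq_mul, Real.norm_eq_abs] at hy
    have hn : |e (y - p) 0| ≤ ‖y - p‖ := by
      rw [← e.norm_map (y-p)]; exact PiLp.norm_apply_le (e (y-p)) 0
    have hy' := abs_le.1 (hy.trans (mul_le_mul_of_nonneg_left hn hε.le))
    have hp : 0 ≤ ε * ‖y - p‖ := by positivity
    constructor
    · intro h
      rw [div_le_iff₀ hs1]; nlinarith
    · intro h
      push Not at h
      rw [le_div_iff₀ hs1]; nlinarith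

end NeumannPoincare

end

noncomputable section

/-! Put Γ = ∂D ∪ ∂Ω and identify L²(∂D) × L²(∂Ω) with L²(Γ). The outward normal n of the annular
region A = Ω \ D is -ν_i on ∂D and ν_e on ∂Ω, so the signs in the matrix make 𝕂* the
Neumann–Poincaré operator φ ↦ ∫_Γ ⟨∇G(x - y), n(x)⟩ φ(y) dσ(y) of the single set A. The Hölder
condition gives |⟨x - y, n(x)⟩| ≤ C |x - y|^(1+α) near the diagonal, so the kernel is O(|x -
y|^(α-1)): weakly singular on a curve. Schur's test makes the operator bounded, and approximation by
finite rank operators makes it compact (`exists_compact_clm_of_isWeaklySingular`). Every nonzero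
spectral point is therefore an eigenvalue.

Let φ ≠ 0 be an eigenfunction for l ≠ 1/2, with single layer potential u. Then ∂u/∂n = (l - 1/2) φ
from inside A, and Δu = φσ in the plane. Testing with a function equal to 1 near A ∪ Γ gives ∫ φ dσ
= 0, so u decays at infinity. Testing with conj u gives, for a = ∫ conj(u) φ dσ, P = ∫_A |∇u|² = (l
- 1/2) a and Q = ∫_{ℝ²} |∇u|² = -a. In particular a is real. If Q = 0 then ∇u = 0, hence φ = 0;
otherwise l = 1/2 - P/Q with 0 ≤ P ≤ Q, which is the claim (`IsNPData.eigenvalue_mem`).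

No boundary traces are used. G is replaced by G_δ(z) = (1/4π) log(|z|² + δ²), whose Laplacian is an
approximate identity; at a boundary point half of its mass falls into A. Letting δ → 0 in the
divergence theorem for w ∇G_δ(· - y) yields the jump relation for a point charge in weak form
(`setIntegral_fderiv_gradG_zero`), and Fubini's theorem transfers it to u
(`IsNPData.setIntegral_eigen`, `integral_sum_fderiv_mul_gradPotential`). The energy identities come
from the test functions χ_R conj(u_δ), where χ_R is a cutoff and u_δ the potential built from G_δ
(`IsNPData.exists_energy`). Gradients are dominated, uniformly in δ, by a locally square integrable
function (`absPotential`), and the mean zero property makes the cutoff error O(1/R).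

The geometric input is collected in `IsNPData`: linear growth of arc length on balls, the kernel
bound, the blow-up to a half-plane, and the Gauss–Green formula. It is proved in graph charts, where
an area formula computes the one-dimensional Hausdorff measure
(`hausdorffMeasure_restrict_range_graphCurve`), and patched by compactness. -/

namespace NeumannPoincare

/-! ### Weakly singular integrals and Schur's test -/

/-- A measure with `μ (closedBall x r) ≤ C r ^ d` integrates `‖x - y‖ ^ (-β)` uniformly in `x`
when `0 < β < d`. -/
theorem exists_lintegral_norm_rpow_neg_le {μ : Measure Plane} [IsFiniteMeasure μ] {C d β : ℝ}
    (hC : 0 ≤ C) (hβ : 0 < β) (hβd : β < d)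
    (hμ : ∀ x r, 0 < r → μ (Metric.closedBall x r) ≤ ENNReal.ofReal (C * r ^ d)) :
    ∃ M : ℝ≥0, ∀ x, ∫⁻ y, ENNReal.ofReal (‖x - y‖ ^ (-β)) ∂μ ≤ M := by
  have hint : IntegrableOn (fun t : ℝ => C * t ^ (-(d / β))) (Set.Ioi 1) :=
    (integrableOn_Ioi_rpow_of_lt (by rw [neg_lt_neg_iff, one_lt_div hβ]; exact hβd)
      one_pos).const_mul C
  have hfin : ∫⁻ t in Set.Ioi (1 : ℝ), ENNReal.ofReal (C * t ^ (-(d / β))) < ∞ := by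
    have := hint.2
    rw [hasFiniteIntegral_iff_ofReal] at this
    · exact this
    · filter_upwards [ae_restrict_mem measurableSet_Ioi] with t ht
      have : (0 : ℝ) < t := lt_trans one_pos ht
      positivity
  have hfin' : μ Set.univ + ∫⁻ t in Set.Ioi (1 : ℝ), ENNReal.ofReal (C * t ^ (-(d / β))) < ∞ :=
    ENNReal.add_lt_top.2 ⟨measure_lt_top _ _, hfin⟩
  refine ⟨(μ Set.univ + ∫⁻ t in Set.Ioi (1 : ℝ), ENNReal.ofReal (C * t ^ (-(d / β)))).toNNReal,
    fun x => ?_⟩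
  -- Layer-cake formula. For t > 1 the superlevel set lies in a ball of radius t^(-1/β), of mass at
  -- most C t^(-d/β), which is integrable at infinity because β < d; for t ≤ 1 the total mass
  -- suffices.
  rw [ENNReal.coe_toNNReal hfin'.ne, lintegral_eq_lintegral_meas_lt μ
    (ae_of_all _ fun y => by positivity) (by fun_prop)]
  rw [← Set.Ioc_union_Ioi_eq_Ioi (zero_le_one (α := ℝ))]
  refine (lintegral_union_le _ _ _).trans (add_le_add ?_ ?_)
  · calc ∫⁻ t in Set.Ioc (0 : ℝ) 1, μ {a | t < ‖x - a‖ ^ (-β)}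
        ≤ ∫⁻ t in Set.Ioc (0 : ℝ) 1, μ Set.univ := by
          gcongr; exact Set.subset_univ _
      _ = μ Set.univ := by simp
  · refine setLIntegral_mono' measurableSet_Ioi fun t ht => ?_
    have ht0 : (0 : ℝ) < t := lt_trans one_pos ht
    have hsub : {a | t < ‖x - a‖ ^ (-β)} ⊆ Metric.closedBall x (t ^ (-(1 / β))) := by
      intro a ha
      simp only [Set.mem_ofPred_eq] at ha
      rw [Metric.mem_closedBall, dist_comm, dist_eq_norm]
      rcases (norm_nonneg (x - a)).eq_or_lt with h0 | h0
      · rw [← h0]; positivity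
      have h1 := Real.rpow_le_rpow ht0.le ha.le (by positivity : 0 ≤ 1 / β)
      rw [← Real.rpow_mul h0.le, neg_mul, mul_one_div_cancel hβ.ne', Real.rpow_neg_one] at h1
      rw [Real.rpow_neg ht0.le]
      exact (le_inv_comm₀ (by positivity) h0).1 h1
    refine (measure_mono hsub).trans ((hμ x _ (by positivity)).trans_eq ?_)
    rw [← Real.rpow_mul ht0.le]
    congr 3
    field_simp

section Schur

variable {X Y : Type*} [MeasurableSpace X] [MeasurableSpace Y] {μ : Measure Y} {ν : Measure X}

/-- Cauchy–Schwarz for the measure f dμ: split f g as f^(1/2) · (f^(1/2) g). -/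
theorem lintegral_mul_sq_le (f g : Y → ℝ≥0∞) (hf : AEMeasurable f μ) (hg : AEMeasurable g μ) :
    (∫⁻ y, f y * g y ∂μ) ^ 2 ≤ (∫⁻ y, f y ∂μ) * ∫⁻ y, f y * g y ^ 2 ∂μ := by
  have h := ENNReal.lintegral_mul_le_Lp_mul_Lq μ Real.HolderConjugate.two_two
    (f := fun y => f y ^ (1 / 2 : ℝ)) (g := fun y => f y ^ (1 / 2 : ℝ) * g y)
    (by fun_prop) (by fun_prop)
  have e1 : ∀ a : ℝ≥0∞, a ^ (1 / 2 : ℝ) * a ^ (1 / 2 : ℝ) = a := by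
    intro a
    rw [← ENNReal.rpow_add_of_nonneg _ _ (by norm_num) (by norm_num)]
    norm_num
  have e2 : ∀ a : ℝ≥0∞, (a ^ (1 / 2 : ℝ)) ^ (2 : ℝ) = a := by
    intro a; rw [← ENNReal.rpow_mul]; norm_num
  simp only [Pi.mul_apply, ← mul_assoc, e1, ENNReal.mul_rpow_of_nonneg _ _ zero_le_two, e2] at h
  have h2 := ENNReal.rpow_le_rpow h zero_le_two
  rw [ENNReal.mul_rpow_of_nonneg _ _ zero_le_two, e2, e2] at h2
  simpa [ENNReal.rpow_two] using h2

/-- Schur's test, as an estimate of integrals. -/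
theorem lintegral_sq_lintegral_mul_le [SFinite μ] [SFinite ν] {k : X → Y → ℝ≥0∞}
    (hk : Measurable (Function.uncurry k)) {c₁ c₂ : ℝ≥0∞}
    (h1 : ∀ᵐ x ∂ν, ∫⁻ y, k x y ∂μ ≤ c₁) (h2 : ∀ᵐ y ∂μ, ∫⁻ x, k x y ∂ν ≤ c₂)
    {g : Y → ℝ≥0∞} (hg : AEMeasurable g μ) :
    ∫⁻ x, (∫⁻ y, k x y * g y ∂μ) ^ 2 ∂ν ≤ c₁ * c₂ * ∫⁻ y, g y ^ 2 ∂μ := by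
  have hkx : ∀ x, Measurable (k x) := fun x => hk.of_uncurry_left
  have hky : ∀ y, Measurable fun x => k x y := fun y => hk.of_uncurry_right
  have hm : AEMeasurable (Function.uncurry fun x y => k x y * g y ^ 2) (ν.prod μ) :=
    hk.aemeasurable.mul (hg.comp_snd.pow_const 2)
  calc ∫⁻ x, (∫⁻ y, k x y * g y ∂μ) ^ 2 ∂ν
      ≤ ∫⁻ x, c₁ * ∫⁻ y, k x y * g y ^ 2 ∂μ ∂ν := by
        refine lintegral_mono_ae ?_
        filter_upwards [h1] with x hx
        exact (lintegral_mul_sq_le _ _ (hkx x).aemeasurable hg).trans (by gcongr)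
    _ = c₁ * ∫⁻ x, ∫⁻ y, k x y * g y ^ 2 ∂μ ∂ν :=
        lintegral_const_mul'' _ hm.lintegral_prod_right'
    _ = c₁ * ∫⁻ y, ∫⁻ x, k x y * g y ^ 2 ∂ν ∂μ := by rw [lintegral_lintegral_swap hm]
    _ = c₁ * ∫⁻ y, (∫⁻ x, k x y ∂ν) * g y ^ 2 ∂μ := by
        congr 2; ext y; exact lintegral_mul_const _ (hky y)
    _ ≤ c₁ * ∫⁻ y, c₂ * g y ^ 2 ∂μ := by
        gcongr c₁ * ?_
        refine lintegral_mono_ae ?_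
        filter_upwards [h2] with y hy
        gcongr
    _ = c₁ * c₂ * ∫⁻ y, g y ^ 2 ∂μ := by
        rw [lintegral_const_mul'' _ (hg.pow_const 2), mul_assoc]

theorem lintegral_enorm_sq_eq (φ : Lp ℂ 2 μ) : ∫⁻ y, ‖φ y‖ₑ ^ 2 ∂μ = ‖φ‖ₑ ^ 2 := by
  rw [Lp.enorm_def, eLpNorm_eq_lintegral_rpow_enorm_toReal two_ne_zero ENNReal.ofNat_ne_top,
    ← ENNReal.rpow_natCast, ← ENNReal.rpow_mul]
  norm_num

/-- Schur's estimate for the absolute values shows that the square of ∫ |k(x, y)| |φ(y)| dμ(y) is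
integrable in x, hence finite almost everywhere. -/
theorem ae_integrable_kernel_smul [SFinite μ] [SFinite ν] {k : X → Y → ℝ}
    (hk : Measurable (Function.uncurry k)) {c : ℝ≥0}
    (h1 : ∀ᵐ x ∂ν, ∫⁻ y, ‖k x y‖ₑ ∂μ ≤ c) (h2 : ∀ᵐ y ∂μ, ∫⁻ x, ‖k x y‖ₑ ∂ν ≤ c)
    {φ : Y → ℂ} (hφ : MemLp φ 2 μ) : ∀ᵐ x ∂ν, Integrable (fun y => k x y • φ y) μ := by
  have hs := lintegral_sq_lintegral_mul_le (k := fun x y => ‖k x y‖ₑ) hk.enorm h1 h2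
    hφ.1.enorm
  have hfin : ∫⁻ y, ‖φ y‖ₑ ^ 2 ∂μ < ∞ := by
    have := hφ.2
    rw [eLpNorm_lt_top_iff_lintegral_rpow_enorm_lt_top two_ne_zero ENNReal.ofNat_ne_top] at this
    simpa using this
  have hm : AEMeasurable (Function.uncurry fun x y => ‖k x y‖ₑ * ‖φ y‖ₑ) (ν.prod μ) :=
    hk.enorm.aemeasurable.mul hφ.1.enorm.comp_snd
  have := ae_lt_top' (hm.lintegral_prod_right'.pow_const 2)
    (hs.trans_lt (ENNReal.mul_lt_top (by finiteness) hfin)).ne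
  filter_upwards [this] with x hx
  refine ⟨(hk.of_uncurry_left).aestronglyMeasurable.smul hφ.1, ?_⟩
  rw [hasFiniteIntegral_iff_enorm]
  simp only [enorm_smul]
  rw [ENNReal.pow_lt_top_iff] at hx
  simpa using hx

theorem eLpNorm_kernel_integral_le [SFinite μ] [SFinite ν] {k : X → Y → ℝ}
    (hk : Measurable (Function.uncurry k)) {c : ℝ≥0}
    (h1 : ∀ᵐ x ∂ν, ∫⁻ y, ‖k x y‖ₑ ∂μ ≤ c) (h2 : ∀ᵐ y ∂μ, ∫⁻ x, ‖k x y‖ₑ ∂ν ≤ c)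
    (φ : Lp ℂ 2 μ) : eLpNorm (fun x => ∫ y, k x y • φ y ∂μ) 2 ν ≤ c * ‖φ‖ₑ := by
  have hs := lintegral_sq_lintegral_mul_le (k := fun x y => ‖k x y‖ₑ) hk.enorm h1 h2
    (Lp.aestronglyMeasurable φ).enorm
  rw [lintegral_enorm_sq_eq] at hs
  rw [eLpNorm_eq_lintegral_rpow_enorm_toReal two_ne_zero ENNReal.ofNat_ne_top]
  have : ∫⁻ x, ‖∫ y, k x y • φ y ∂μ‖ₑ ^ 2 ∂ν ≤ (c * ‖φ‖ₑ) ^ 2 := by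
    refine (lintegral_mono fun x => ?_).trans (hs.trans_eq (by ring))
    gcongr
    refine (enorm_integral_le_lintegral_enorm _).trans_eq ?_
    simp only [enorm_smul]
  calc _ ≤ ((c * ‖φ‖ₑ) ^ 2) ^ (1 / 2 : ℝ) := by
        simpa using ENNReal.rpow_le_rpow this (by norm_num : (0 : ℝ) ≤ 1 / 2)
    _ = c * ‖φ‖ₑ := by
        rw [← ENNReal.rpow_natCast, ← ENNReal.rpow_mul]
        norm_num

/-- Schur's test: the bounded operator with a given kernel. -/
theorem exists_clm_of_schur [SFinite μ] [SFinite ν] {k : X → Y → ℝ}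
    (hk : Measurable (Function.uncurry k)) {c : ℝ≥0}
    (h1 : ∀ᵐ x ∂ν, ∫⁻ y, ‖k x y‖ₑ ∂μ ≤ c) (h2 : ∀ᵐ y ∂μ, ∫⁻ x, ‖k x y‖ₑ ∂ν ≤ c) :
    ∃ T : Lp ℂ 2 μ →L[ℂ] Lp ℂ 2 ν, ‖T‖ ≤ c ∧
      ∀ φ : Lp ℂ 2 μ, T φ =ᵐ[ν] fun x => ∫ y, k x y • φ y ∂μ := by
  have hL : ∀ φ : Lp ℂ 2 μ, MemLp (fun x => ∫ y, k x y • φ y ∂μ) 2 ν := by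
    intro φ
    refine ⟨?_, (eLpNorm_kernel_integral_le hk h1 h2 φ).trans_lt (by finiteness)⟩
    have : AEStronglyMeasurable (fun p : X × Y => k p.1 p.2 • φ p.2) (ν.prod μ) :=
      hk.aestronglyMeasurable.smul (Lp.aestronglyMeasurable φ).comp_snd
    exact this.integral_prod_right'
  have hi := fun φ : Lp ℂ 2 μ => ae_integrable_kernel_smul hk h1 h2 (Lp.memLp φ)
  let T₀ : Lp ℂ 2 μ →ₗ[ℂ] Lp ℂ 2 ν :=
    { toFun := fun φ => (hL φ).toLp _
      map_add' := by
        intro φ ψ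
        apply Lp.ext
        filter_upwards [(hL (φ + ψ)).coeFn_toLp, (hL φ).coeFn_toLp, (hL ψ).coeFn_toLp,
          Lp.coeFn_add ((hL φ).toLp _) ((hL ψ).toLp _), hi φ, hi ψ] with x a b c d e f
        rw [a, d, Pi.add_apply, b, c, ← integral_add e f]
        refine integral_congr_ae ?_
        filter_upwards [Lp.coeFn_add φ ψ] with y hy
        rw [hy, Pi.add_apply, smul_add]
      map_smul' := by
        intro t φ
        apply Lp.ext
        filter_upwards [(hL (t • φ)).coeFn_toLp, (hL φ).coeFn_toLp,
          Lp.coeFn_smul t ((hL φ).toLp _)] with x a b d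
        rw [a, RingHom.id_apply, d, Pi.smul_apply, b, ← integral_smul]
        refine integral_congr_ae ?_
        filter_upwards [Lp.coeFn_smul t φ] with y hy
        rw [hy, Pi.smul_apply, smul_comm] }
  have hb : ∀ φ, ‖T₀ φ‖ ≤ c * ‖φ‖ := by
    intro φ
    change ‖(hL φ).toLp _‖ ≤ _
    rw [Lp.norm_toLp]
    refine ENNReal.toReal_le_of_le_ofReal (by positivity) ?_
    refine (eLpNorm_kernel_integral_le hk h1 h2 φ).trans_eq ?_
    rw [ENNReal.ofReal_mul (by positivity), ofReal_norm, ENNReal.ofReal_coe_nnreal]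
  exact ⟨T₀.mkContinuous c hb, T₀.mkContinuous_norm_le c.2 hb, fun φ => (hL φ).coeFn_toLp⟩

end Schur

/-! ### Norm approximation and finite rank kernels -/

section Compact

variable {X Y : Type*} [MeasurableSpace X] [MeasurableSpace Y] {μ : Measure Y} {ν : Measure X}

/-- The difference of two kernel operators is the operator of the difference kernel, so closeness of
kernels in the Schur sense is closeness in operator norm. The integrability hypotheses are what
permits subtracting under the integral. -/
theorem clm_norm_sub_le_of_schur [SFinite μ] [SFinite ν] {k k' : X → Y → ℝ}
    (hk : Measurable (Function.uncurry k)) (hk' : Measurable (Function.uncurry k')) {c : ℝ≥0}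
    (h1 : ∀ᵐ x ∂ν, ∫⁻ y, ‖k x y - k' x y‖ₑ ∂μ ≤ c)
    (h2 : ∀ᵐ y ∂μ, ∫⁻ x, ‖k x y - k' x y‖ₑ ∂ν ≤ c)
    {T T' : Lp ℂ 2 μ →L[ℂ] Lp ℂ 2 ν}
    (hi : ∀ φ : Lp ℂ 2 μ, ∀ᵐ x ∂ν, Integrable (fun y => k x y • φ y) μ)
    (hi' : ∀ φ : Lp ℂ 2 μ, ∀ᵐ x ∂ν, Integrable (fun y => k' x y • φ y) μ)
    (hT : ∀ φ : Lp ℂ 2 μ, T φ =ᵐ[ν] fun x => ∫ y, k x y • φ y ∂μ)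
    (hT' : ∀ φ : Lp ℂ 2 μ, T' φ =ᵐ[ν] fun x => ∫ y, k' x y • φ y ∂μ) : ‖T - T'‖ ≤ c := by
  obtain ⟨S, hS, hS'⟩ := exists_clm_of_schur (k := fun x y => k x y - k' x y) (hk.sub hk') h1 h2
  have : S = T - T' := by
    ext φ : 1
    apply Lp.ext
    filter_upwards [hS' φ, hT φ, hT' φ, Lp.coeFn_sub (T φ) (T' φ), hi φ, hi' φ] with x a b d e f g
    rw [sub_apply, a, e, Pi.sub_apply, b, d, ← integral_sub f g]
    simp only [sub_smul]
  rwa [← this]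

/-- A kernel that sees x only through finitely many values `s x` produces combinations of the
indicators of the fibres of `s`, so the range is finite dimensional. -/
theorem isCompactOperator_of_simpleFunc [IsFiniteMeasure ν] {Z : Type*} (s : SimpleFunc X Z)
    {k : Z → Y → ℝ} {T : Lp ℂ 2 μ →L[ℂ] Lp ℂ 2 ν}
    (hT : ∀ φ : Lp ℂ 2 μ, T φ =ᵐ[ν] fun x => ∫ y, k (s x) y • φ y ∂μ) : IsCompactOperator T := by
  let b : Z → Lp ℂ 2 ν := fun z =>
    indicatorConstLp 2 (s.measurableSet_fiber z) (measure_ne_top ν _) (1 : ℂ)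
  let V : Submodule ℂ (Lp ℂ 2 ν) := Submodule.span ℂ (b '' s.range)
  have hV : ∀ φ, T φ ∈ V := by
    intro φ
    have : T φ = ∑ z ∈ s.range, (∫ y, k z y • φ y ∂μ) • b z := by
      apply Lp.ext
      have hb : ∀ᵐ x ∂ν, ∀ z ∈ s.range, b z x = (s ⁻¹' {z}).indicator (fun _ => (1 : ℂ)) x := by
        rw [Filter.eventually_all_finset]
        exact fun z _ => indicatorConstLp_coeFn
      have hm : ∀ᵐ x ∂ν, ∀ z ∈ s.range, ((∫ y, k z y • φ y ∂μ) • b z : Lp ℂ 2 ν) x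
          = (∫ y, k z y • φ y ∂μ) • b z x := by
        rw [Filter.eventually_all_finset]
        exact fun z _ => Lp.coeFn_smul _ _
      filter_upwards [hT φ, hb, hm, Lp.coeFn_finsetSum s.range
        (fun z => (∫ y, k z y • φ y ∂μ) • b z)] with x a c d e
      rw [a, e]
      simp only [Finset.sum_apply]
      rw [Finset.sum_eq_single (s x)]
      · rw [d _ (s.mem_range_self x), c _ (s.mem_range_self x)]
        simp
      · intro z hz hne
        rw [d z hz, c z hz, Set.indicator_of_notMem, smul_zero]
        exact fun h => hne h.symm
      · exact fun h => absurd (s.mem_range_self x) h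
    rw [this]
    exact Submodule.sum_mem _ fun z hz => Submodule.smul_mem _ _
      (Submodule.subset_span ⟨z, hz, rfl⟩)
  have : FiniteDimensional ℂ V := FiniteDimensional.span_of_finite ℂ (s.range.finite_toSet.image b)
  have : LocallyCompactSpace V := by
    have := FiniteDimensional.proper ℂ V
    infer_instance
  have hc : IsCompactOperator (V.subtypeL : V →L[ℂ] Lp ℂ 2 ν) :=
    isCompactOperator_of_locallyCompactSpace_rng V.subtypeL
  exact hc.comp_clm (T.codRestrict V hV)

end Compact

/-! ### Regularised kernels and compactness of weakly singular operators -/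

/-- The gradient of `z ↦ (1 / 4π) log (‖z‖² + δ²)`, which for `δ = 0` is the fundamental
solution. -/
def gradG (δ : ℝ) (z : Plane) : Plane := (2 * Real.pi * (‖z‖ ^ 2 + δ ^ 2))⁻¹ • z

theorem measurable_gradG (δ : ℝ) : Measurable (gradG δ) := by
  unfold gradG; fun_prop

theorem continuousAt_gradG {δ : ℝ} {z : Plane} (h : ‖z‖ ^ 2 + δ ^ 2 ≠ 0) :
    ContinuousAt (gradG δ) z := by
  unfold gradG
  refine ContinuousAt.smul (f := fun z : Plane => (2 * Real.pi * (‖z‖ ^ 2 + δ ^ 2))⁻¹)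
    (ContinuousAt.inv₀ (Continuous.continuousAt (by fun_prop)) ?_) continuousAt_id
  have := Real.pi_pos
  positivity

theorem continuous_gradG {δ : ℝ} (hδ : δ ≠ 0) : Continuous (gradG δ) :=
  continuous_iff_continuousAt.2 fun _ => continuousAt_gradG (by positivity)

theorem norm_gradG_zero (z : Plane) : ‖gradG 0 z‖ = (2 * Real.pi)⁻¹ * ‖z‖⁻¹ := by
  have := Real.pi_pos
  rw [gradG, norm_smul, Real.norm_eq_abs, abs_of_nonneg (by positivity)]
  rcases eq_or_ne ‖z‖ 0 with h | h
  · simp [h]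
  · field_simp; simp

/-- The regularised gradient is the singular one times a scalar in [0, 1], so bounds for δ = 0 hold
for every δ. At z = 0 both sides vanish, since `gradG 0 0 = 0`. -/
theorem gradG_eq_smul (δ : ℝ) (z : Plane) :
    gradG δ z = (‖z‖ ^ 2 / (‖z‖ ^ 2 + δ ^ 2)) • gradG 0 z := by
  have := Real.pi_pos
  rcases eq_or_ne z 0 with rfl | h
  · simp [gradG]
  have h' : ‖z‖ ≠ 0 := norm_ne_zero_iff.2 h
  rw [gradG, gradG, smul_smul]
  congr 1
  field_simp
  ring

theorem sq_div_le_one (a δ : ℝ) : a ^ 2 / (a ^ 2 + δ ^ 2) ≤ 1 :=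
  div_le_one_of_le₀ (by nlinarith) (by positivity)

theorem norm_gradG_le (δ : ℝ) (z : Plane) : ‖gradG δ z‖ ≤ ‖gradG 0 z‖ := by
  rw [gradG_eq_smul, norm_smul, Real.norm_eq_abs, abs_of_nonneg (by positivity)]
  exact mul_le_of_le_one_left (norm_nonneg _) (sq_div_le_one _ _)

theorem abs_inner_gradG_le (δ : ℝ) (z v : Plane) :
    |inner ℝ (gradG δ z) v| ≤ |inner ℝ (gradG 0 z) v| := by
  rw [gradG_eq_smul, real_inner_smul_left, abs_mul, abs_of_nonneg (by positivity)]
  exact mul_le_of_le_one_left (abs_nonneg _) (sq_div_le_one _ _)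

/-- The lost factor is δ² / (‖z‖² + δ²) ≤ min(1, (δ/‖z‖)²) ≤ (δ/‖z‖)^η. A slightly worse singularity
is traded for the small factor δ^η. -/
theorem abs_inner_gradG_sub_le {δ η : ℝ} (hδ : 0 < δ) (hη : 0 ≤ η) (hη2 : η ≤ 2) (z v : Plane) :
    |inner ℝ (gradG 0 z) v - inner ℝ (gradG δ z) v| ≤
      |inner ℝ (gradG 0 z) v| * (δ ^ η * ‖z‖ ^ (-η)) := by
  rcases eq_or_ne z 0 with rfl | h
  · simp [gradG]
  have h' : 0 < ‖z‖ := norm_pos_iff.2 h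
  rw [gradG_eq_smul δ, real_inner_smul_left, ← one_sub_mul, abs_mul, mul_comm]
  gcongr
  have e : 1 - ‖z‖ ^ 2 / (‖z‖ ^ 2 + δ ^ 2) = δ ^ 2 / (‖z‖ ^ 2 + δ ^ 2) := by field_simp; ring
  rw [e, abs_of_nonneg (by positivity), Real.rpow_neg h'.le, ← div_eq_mul_inv,
    ← Real.div_rpow hδ.le h'.le]
  rcases le_total δ ‖z‖ with hle | hle
  · calc δ ^ 2 / (‖z‖ ^ 2 + δ ^ 2) ≤ δ ^ 2 / ‖z‖ ^ 2 := by gcongr; nlinarith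
      _ = (δ / ‖z‖) ^ (2 : ℝ) := by rw [Real.rpow_two, div_pow]
      _ ≤ (δ / ‖z‖) ^ η :=
        Real.rpow_le_rpow_of_exponent_ge (by positivity) ((div_le_one h').2 hle) hη2
  · calc δ ^ 2 / (‖z‖ ^ 2 + δ ^ 2) ≤ 1 := div_le_one_of_le₀ (by nlinarith) (by positivity)
      _ ≤ (δ / ‖z‖) ^ η := Real.one_le_rpow ((one_le_div h').2 hle) hη

/-- The measure `μ` is upper Ahlfors regular of dimension one. -/
def IsUpperRegular (μ : Measure Plane) : Prop :=
  ∃ C : ℝ, 0 ≤ C ∧ ∀ x r, 0 < r → μ (Metric.closedBall x r) ≤ ENNReal.ofReal (C * r)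

theorem IsUpperRegular.exists_lintegral_le {μ : Measure Plane} [IsFiniteMeasure μ]
    (h : IsUpperRegular μ) {β : ℝ} (hβ : 0 < β) (hβ1 : β < 1) :
    ∃ M : ℝ≥0, ∀ x, ∫⁻ y, ENNReal.ofReal (‖x - y‖ ^ (-β)) ∂μ ≤ M := by
  obtain ⟨C, hC, h⟩ := h
  exact exists_lintegral_norm_rpow_neg_le hC hβ hβ1 (by simpa using h)

theorem lintegral_enorm_le_of_weakly_singular {μ : Measure Plane} {Γ : Set Plane}
    (hμ : ∀ᵐ y ∂μ, y ∈ Γ) {f : Plane → ℝ} {x : Plane} {B β : ℝ} {M : ℝ≥0}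
    (hf : ∀ y ∈ Γ, |f y| ≤ B * ‖x - y‖ ^ (-β))
    (hM : ∫⁻ y, ENNReal.ofReal (‖x - y‖ ^ (-β)) ∂μ ≤ M) :
    ∫⁻ y, ‖f y‖ₑ ∂μ ≤ (B.toNNReal * M : ℝ≥0) := by
  calc ∫⁻ y, ‖f y‖ₑ ∂μ ≤ ∫⁻ y, B.toNNReal * ENNReal.ofReal (‖x - y‖ ^ (-β)) ∂μ := by
        refine lintegral_mono_ae ?_
        filter_upwards [hμ] with y hy
        rw [Real.enorm_eq_ofReal_abs]
        change _ ≤ ENNReal.ofReal B * _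
        rw [← ENNReal.ofReal_mul' (by positivity)]
        exact ENNReal.ofReal_le_ofReal (hf y hy)
    _ ≤ _ := by
        rw [lintegral_const_mul' _ _ (by finiteness)]
        push_cast
        gcongr

/-- The kernel `∂G_δ / ∂n (x - y)` for the direction field `n`; for `δ = 0` and the outward normal
this is the kernel of the Neumann–Poincaré operator. -/
def dnG (n : Plane → Plane) (δ : ℝ) (x y : Plane) : ℝ := inner ℝ (gradG δ (x - y)) (n x)

theorem measurable_dnG {n : Plane → Plane} (hn : Measurable n) (δ : ℝ) :
    Measurable (Function.uncurry (dnG n δ)) := by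
  have := measurable_gradG δ
  unfold dnG Function.uncurry
  fun_prop

/-- The kernel `dnG n 0` is weakly singular on `Γ₁ × Γ₂`. -/
def IsWeaklySingular (n : Plane → Plane) (Γ₁ Γ₂ : Set Plane) : Prop :=
  ∃ B β : ℝ, 0 ≤ B ∧ 0 < β ∧ β < 1 ∧ ∀ x ∈ Γ₁, ∀ y ∈ Γ₂, |dnG n 0 x y| ≤ B * ‖x - y‖ ^ (-β)

/-- `M` depends on the measures and on β but not on the kernel: the Schur norm is thus controlled by
B alone, which may tend to zero along a family of kernels. -/
theorem exists_schur_bounds {μ ν : Measure Plane} [IsFiniteMeasure μ] [IsFiniteMeasure ν]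
    (hμr : IsUpperRegular μ) (hνr : IsUpperRegular ν) {Γ₁ Γ₂ : Set Plane}
    (hν : ∀ᵐ x ∂ν, x ∈ Γ₁) (hμ : ∀ᵐ y ∂μ, y ∈ Γ₂) {β : ℝ} (hβ : 0 < β) (hβ1 : β < 1) :
    ∃ M : ℝ≥0, ∀ (B : ℝ) (k : Plane → Plane → ℝ),
      (∀ x ∈ Γ₁, ∀ y ∈ Γ₂, |k x y| ≤ B * ‖x - y‖ ^ (-β)) →
      (∀ᵐ x ∂ν, ∫⁻ y, ‖k x y‖ₑ ∂μ ≤ (B.toNNReal * M : ℝ≥0)) ∧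
      ∀ᵐ y ∂μ, ∫⁻ x, ‖k x y‖ₑ ∂ν ≤ (B.toNNReal * M : ℝ≥0) := by
  obtain ⟨M₁, h₁⟩ := hμr.exists_lintegral_le hβ hβ1
  obtain ⟨M₂, h₂⟩ := hνr.exists_lintegral_le hβ hβ1
  refine ⟨max M₁ M₂, fun B k hk => ⟨?_, ?_⟩⟩
  · filter_upwards [hν] with x hx
    refine lintegral_enorm_le_of_weakly_singular hμ (hk x hx) ((h₁ x).trans ?_)
    exact_mod_cast le_max_left _ _
  · filter_upwards [hμ] with y hy
    refine lintegral_enorm_le_of_weakly_singular (x := y) (f := fun x => k x y) hν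
      (fun x hx => ?_) ((h₂ y).trans ?_)
    · rw [norm_sub_rev]; exact hk x hx y hy
    · exact_mod_cast le_max_right _ _

/-- Nearest point in a finite net. The net has to lie in `Γ` because the direction field will be
continuous only there. -/
theorem exists_simpleFunc_dist_lt {Γ : Set Plane} (hΓ : IsCompact Γ) (hne : Γ.Nonempty) {ρ : ℝ}
    (hρ : 0 < ρ) : ∃ s : SimpleFunc Plane Plane, ∀ x ∈ Γ, s x ∈ Γ ∧ dist (s x) x < ρ := by
  have : Nonempty Γ := hne.to_subtype
  let e : ℕ → Plane := fun i => TopologicalSpace.denseSeq Γ i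
  have hcov : Γ ⊆ ⋃ i, Metric.ball (e i) ρ := by
    intro x hx
    obtain ⟨i, hi⟩ := (TopologicalSpace.denseRange_denseSeq Γ).exists_dist_lt (⟨x, hx⟩ : Γ) hρ
    exact Set.mem_iUnion.2 ⟨i, hi⟩
  obtain ⟨t, ht⟩ := hΓ.elim_finite_subcover _ (fun _ => Metric.isOpen_ball) hcov
  refine ⟨SimpleFunc.nearestPt e (t.sup id), fun x hx => ⟨?_, ?_⟩⟩
  · exact (TopologicalSpace.denseSeq Γ _).2
  · obtain ⟨i, hi, hxi⟩ := Set.mem_iUnion₂.1 (ht hx)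
    have h1 := SimpleFunc.edist_nearestPt_le e x (Finset.le_sup (f := id) hi)
    rw [edist_dist, edist_dist] at h1
    exact ((ENNReal.ofReal_le_ofReal_iff dist_nonneg).1 h1).trans_lt
      (by rw [dist_comm]; exact hxi)

theorem dnG_uniform {n : Plane → Plane} {δ : ℝ} (hδ : δ ≠ 0) {Γ₁ Γ₂ : Set Plane}
    (hΓ₁ : IsCompact Γ₁) (hΓ₂ : IsCompact Γ₂) (hn : ContinuousOn n Γ₁) {ε : ℝ} (hε : 0 < ε) :
    ∃ ρ > 0, ∀ x ∈ Γ₁, ∀ x' ∈ Γ₁, dist x' x < ρ → ∀ y ∈ Γ₂, |dnG n δ x y - dnG n δ x' y| < ε := by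
  have hc : ContinuousOn (fun p : Plane × Plane => dnG n δ p.1 p.2) (Γ₁ ×ˢ Γ₂) := by
    unfold dnG
    refine ContinuousOn.inner ?_ (hn.comp continuousOn_fst fun p hp => hp.1)
    exact ((continuous_gradG hδ).comp (by fun_prop)).continuousOn
  have hu := (hΓ₁.prod hΓ₂).uniformContinuousOn_of_continuous hc
  obtain ⟨ρ, hρ, h⟩ := Metric.uniformContinuousOn_iff.1 hu ε hε
  refine ⟨ρ, hρ, fun x hx x' hx' hd y hy => ?_⟩
  have := h (x, y) ⟨hx, hy⟩ (x', y) ⟨hx', hy⟩ (by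
    rw [Prod.dist_eq]; exact max_lt (by rwa [dist_comm]) (by simpa using hρ))
  rwa [Real.dist_eq] at this

/-- For δ ≠ 0 the kernel is uniformly continuous on Γ₁ × Γ₂. Replacing x by a nearby net point gives
finite rank operators that converge in norm. -/
theorem isCompactOperator_dnG {μ ν : Measure Plane} [IsFiniteMeasure μ] [IsFiniteMeasure ν]
    {Γ₁ Γ₂ : Set Plane} (hΓ₁ : IsCompact Γ₁) (hΓ₂ : IsCompact Γ₂)
    (hν : ∀ᵐ x ∂ν, x ∈ Γ₁) (hμ : ∀ᵐ y ∂μ, y ∈ Γ₂) {n : Plane → Plane} (hnm : Measurable n)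
    (hn : ContinuousOn n Γ₁) {δ : ℝ} (hδ : δ ≠ 0) {c : ℝ≥0}
    (h1 : ∀ᵐ x ∂ν, ∫⁻ y, ‖dnG n δ x y‖ₑ ∂μ ≤ c) (h2 : ∀ᵐ y ∂μ, ∫⁻ x, ‖dnG n δ x y‖ₑ ∂ν ≤ c)
    {T : Lp ℂ 2 μ →L[ℂ] Lp ℂ 2 ν}
    (hT : ∀ φ : Lp ℂ 2 μ, T φ =ᵐ[ν] fun x => ∫ y, dnG n δ x y • φ y ∂μ) :
    IsCompactOperator T := by
  rcases Γ₁.eq_empty_or_nonempty with rfl | hne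
  · have : T = 0 := by
      ext φ : 1
      apply Lp.ext
      filter_upwards [hν] with x hx using absurd hx (Set.notMem_empty x)
    rw [this]
    exact isCompactOperator_zero
  have hmeas := measurable_dnG hnm δ
  let m : ℝ≥0 := max (μ Set.univ).toNNReal (ν Set.univ).toNNReal
  have hmμ : μ Set.univ ≤ m := by
    rw [← ENNReal.coe_toNNReal (measure_ne_top μ Set.univ)]
    exact_mod_cast le_max_left _ _
  have hmν : ν Set.univ ≤ m := by
    rw [← ENNReal.coe_toNNReal (measure_ne_top ν Set.univ)]
    exact_mod_cast le_max_right _ _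
  have key : ∀ i : ℕ, ∃ T' : Lp ℂ 2 μ →L[ℂ] Lp ℂ 2 ν, IsCompactOperator T' ∧
      ‖T - T'‖ ≤ 1 / ((i : ℝ) + 1) * m := by
    intro i
    let ε : ℝ≥0 := 1 / ((i : ℝ≥0) + 1)
    have hε : 0 < ε := by positivity
    obtain ⟨ρ, hρ, hu⟩ := dnG_uniform hδ hΓ₁ hΓ₂ hn (show (0 : ℝ) < ε from hε)
    obtain ⟨s, hs⟩ := exists_simpleFunc_dist_lt hΓ₁ hne hρ
    have hd : ∀ x ∈ Γ₁, ∀ y ∈ Γ₂, ‖dnG n δ x y - dnG n δ (s x) y‖ₑ ≤ ε := by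
      intro x hx y hy
      rw [Real.enorm_eq_ofReal_abs]
      refine ENNReal.ofReal_le_of_le_toReal ?_
      exact (hu x hx (s x) (hs x hx).1 (hs x hx).2 y hy).le
    have hs' : Measurable fun p : Plane × Plane => (s p.1, p.2) :=
      (s.measurable.comp measurable_fst).prodMk measurable_snd
    have hmeas' : Measurable (Function.uncurry fun x y => dnG n δ (s x) y) := by
      change Measurable (Function.uncurry (dnG n δ) ∘ fun p : Plane × Plane => (s p.1, p.2))
      exact hmeas.comp hs'
    have d1 : ∀ᵐ x ∂ν, ∫⁻ y, ‖dnG n δ x y - dnG n δ (s x) y‖ₑ ∂μ ≤ (ε * m : ℝ≥0) := by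
      filter_upwards [hν] with x hx
      calc _ ≤ ∫⁻ y, ε ∂μ := lintegral_mono_ae (by filter_upwards [hμ] with y hy using hd x hx y hy)
        _ ≤ _ := by rw [lintegral_const]; push_cast; gcongr
    have d2 : ∀ᵐ y ∂μ, ∫⁻ x, ‖dnG n δ x y - dnG n δ (s x) y‖ₑ ∂ν ≤ (ε * m : ℝ≥0) := by
      filter_upwards [hμ] with y hy
      calc _ ≤ ∫⁻ x, ε ∂ν := lintegral_mono_ae (by filter_upwards [hν] with x hx using hd x hx y hy)
        _ ≤ _ := by rw [lintegral_const]; push_cast; gcongr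
    have tri : ∀ x y, ‖dnG n δ (s x) y‖ₑ ≤ ‖dnG n δ x y‖ₑ + ‖dnG n δ x y - dnG n δ (s x) y‖ₑ := by
      intro x y
      have : dnG n δ (s x) y = dnG n δ x y - (dnG n δ x y - dnG n δ (s x) y) := by ring
      conv_lhs => rw [this]
      exact enorm_sub_le
    have h1' : ∀ᵐ x ∂ν, ∫⁻ y, ‖dnG n δ (s x) y‖ₑ ∂μ ≤ (c + ε * m : ℝ≥0) := by
      filter_upwards [h1, d1] with x a b
      refine (lintegral_mono (tri x)).trans ?_
      rw [lintegral_add_left hmeas.of_uncurry_left.enorm, ENNReal.coe_add]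
      gcongr
    have h2' : ∀ᵐ y ∂μ, ∫⁻ x, ‖dnG n δ (s x) y‖ₑ ∂ν ≤ (c + ε * m : ℝ≥0) := by
      filter_upwards [h2, d2] with y a b
      refine (lintegral_mono (tri · y)).trans ?_
      rw [lintegral_add_left hmeas.of_uncurry_right.enorm, ENNReal.coe_add]
      gcongr
    obtain ⟨T', -, hT'⟩ := exists_clm_of_schur hmeas' h1' h2'
    refine ⟨T', isCompactOperator_of_simpleFunc s hT', ?_⟩
    have := clm_norm_sub_le_of_schur hmeas hmeas' d1 d2
      (fun φ => ae_integrable_kernel_smul hmeas h1 h2 (Lp.memLp φ))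
      (fun φ => ae_integrable_kernel_smul hmeas' h1' h2' (Lp.memLp φ)) hT hT'
    simpa [ε] using this
  choose T' hc hT' using key
  refine isCompactOperator_of_tendsto (F := T') (l := atTop) ?_ (Eventually.of_forall hc)
  rw [tendsto_iff_norm_sub_tendsto_zero]
  refine squeeze_zero (g := fun i : ℕ => 1 / ((i : ℝ) + 1) * m) (fun _ => norm_nonneg _)
    (fun i => (norm_sub_rev _ _).trans_le (hT' i)) ?_
  simpa using (tendsto_one_div_add_atTop_nhds_zero_nat (𝕜 := ℝ)).mul_const (m : ℝ)

/-- A weakly singular kernel `∂G / ∂n (x - y)` defines a compact operator. -/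
theorem exists_compact_clm_of_isWeaklySingular {μ ν : Measure Plane} [IsFiniteMeasure μ]
    [IsFiniteMeasure ν] (hμr : IsUpperRegular μ) (hνr : IsUpperRegular ν)
    {Γ₁ Γ₂ : Set Plane} (hΓ₁ : IsCompact Γ₁) (hΓ₂ : IsCompact Γ₂)
    (hν : ∀ᵐ x ∂ν, x ∈ Γ₁) (hμ : ∀ᵐ y ∂μ, y ∈ Γ₂) {n : Plane → Plane} (hnm : Measurable n)
    (hn : ContinuousOn n Γ₁) (hk : IsWeaklySingular n Γ₁ Γ₂) :
    ∃ T : Lp ℂ 2 μ →L[ℂ] Lp ℂ 2 ν, IsCompactOperator T ∧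
      (∀ φ : Lp ℂ 2 μ, ∀ᵐ x ∂ν, Integrable (fun y => dnG n 0 x y • φ y) μ) ∧
      ∀ φ : Lp ℂ 2 μ, T φ =ᵐ[ν] fun x => ∫ y, dnG n 0 x y • φ y ∂μ := by
  obtain ⟨B, β, hB, hβ, hβ1, hk⟩ := hk
  obtain ⟨M, hM⟩ := exists_schur_bounds hμr hνr hν hμ hβ hβ1
  -- With η = (1 - β)/2 the exponent β + η = (1 + β)/2 of the difference kernel is still below 1, so
  -- Schur's test applies to it.
  have hη : 0 < (1 - β) / 2 := by linarith
  obtain ⟨M', hM'⟩ := exists_schur_bounds hμr hνr hν hμ (β := β + (1 - β) / 2) (by linarith)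
    (by linarith)
  have hmeas := measurable_dnG hnm
  have hb := fun δ => hM B (dnG n δ) fun x hx y hy =>
    (abs_inner_gradG_le δ (x - y) (n x)).trans (hk x hx y hy)
  have hi := fun δ (φ : Lp ℂ 2 μ) =>
    ae_integrable_kernel_smul (hmeas δ) (hb δ).1 (hb δ).2 (Lp.memLp φ)
  choose T _ hT using fun δ => exists_clm_of_schur (hmeas δ) (hb δ).1 (hb δ).2
  refine ⟨T 0, ?_, hi 0, hT 0⟩
  have hdiff : ∀ δ > 0, ‖T 0 - T δ‖ ≤ (B * δ ^ ((1 - β) / 2)).toNNReal * M' := by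
    intro δ hδ
    have hd := hM' (B * δ ^ ((1 - β) / 2)) (fun x y => dnG n 0 x y - dnG n δ x y) (by
      intro x hx y hy
      refine (abs_inner_gradG_sub_le hδ hη.le (by linarith) (x - y) (n x)).trans ?_
      refine (mul_le_mul_of_nonneg_right (hk x hx y hy) (by positivity)).trans_eq ?_
      -- On the diagonal both sides are zero, as `0` raised to a nonzero real power is `0`.
      rcases eq_or_ne x y with rfl | hxy
      · rw [sub_self, norm_zero, Real.zero_rpow (x := -β) (by linarith),
          Real.zero_rpow (x := -(β + (1 - β) / 2)) (by linarith)]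
        ring
      · rw [neg_add, Real.rpow_add (norm_pos_iff.2 (sub_ne_zero.2 hxy))]
        ring)
    exact_mod_cast clm_norm_sub_le_of_schur (hmeas 0) (hmeas δ) hd.1 hd.2 (hi 0) (hi δ) (hT 0) (hT δ)
  refine isCompactOperator_of_tendsto (F := T) (l := 𝓝[>] 0) ?_ ?_
  · rw [tendsto_iff_norm_sub_tendsto_zero]
    refine squeeze_zero' (Eventually.of_forall fun _ => norm_nonneg _)
      (g := fun δ : ℝ => (B * δ ^ ((1 - β) / 2)).toNNReal * M') ?_ ?_
    · filter_upwards [self_mem_nhdsWithin] with δ hδ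
      rw [norm_sub_rev]
      exact hdiff δ hδ
    · have hc : Continuous fun δ : ℝ => ((B * δ ^ ((1 - β) / 2)).toNNReal : ℝ) * M' := by
        have := Real.continuous_rpow_const hη.le
        fun_prop
      have := (hc.tendsto 0).mono_left (nhdsWithin_le_nhds (s := Set.Ioi 0))
      simpa [Real.zero_rpow hη.ne'] using this
  · filter_upwards [self_mem_nhdsWithin] with δ hδ
    exact isCompactOperator_dnG hΓ₁ hΓ₂ hν hμ hnm hn (ne_of_gt hδ) (hb δ).1 (hb δ).2 (hT δ)

/-! ### The regularised Laplacian as an approximate identity, and blow-up at boundary points -/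

/-- The standard basis of the plane. -/
abbrev stdVec (i : Fin 2) : Plane := EuclideanSpace.single i 1

theorem inner_stdVec (v : Plane) (i : Fin 2) : inner ℝ v (stdVec i) = v i := by
  simp [stdVec, EuclideanSpace.inner_single_right]

theorem eq_sum_stdVec (v : Plane) : v = ∑ i, v i • stdVec i := by
  ext j
  fin_cases j <;> simp [stdVec]

theorem norm_sq_eq_add (v : Plane) : ‖v‖ ^ 2 = v 0 ^ 2 + v 1 ^ 2 := by
  rw [EuclideanSpace.norm_sq_eq, Fin.sum_univ_two]; simp

/-- The Laplacian of `z ↦ (1 / 4π) log (‖z‖² + δ²)`: an approximate identity. -/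
def lapG (δ : ℝ) (z : Plane) : ℝ := δ ^ 2 / (Real.pi * (‖z‖ ^ 2 + δ ^ 2) ^ 2)

theorem lapG_nonneg (δ : ℝ) (z : Plane) : 0 ≤ lapG δ z := by
  have := Real.pi_pos
  unfold lapG; positivity

theorem continuous_lapG {δ : ℝ} (hδ : δ ≠ 0) : Continuous (lapG δ) := by
  have := Real.pi_pos
  unfold lapG
  exact Continuous.div (by fun_prop) (by fun_prop) fun z => by positivity

/-- Only the trace of the derivative matters: it is the divergence of `gradG δ`, that is, the
Laplacian of the regularised fundamental solution. -/
theorem hasFDerivAt_gradG {δ : ℝ} (hδ : δ ≠ 0) (z : Plane) :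
    ∃ L : Plane →L[ℝ] Plane, HasFDerivAt (gradG δ) L z ∧ (∑ i, L (stdVec i) i) = lapG δ z := by
  have hpi := Real.pi_pos
  have hq : 2 * Real.pi * (‖z‖ ^ 2 + δ ^ 2) ≠ 0 := by positivity
  have h1 : HasFDerivAt (fun z : Plane => 2 * Real.pi * (‖z‖ ^ 2 + δ ^ 2))
      ((2 * Real.pi) • (2 • (innerSL ℝ z))) z :=
    ((hasStrictFDerivAt_norm_sq z).hasFDerivAt.add_const _).const_mul _
  have h2 := ((hasDerivAt_inv hq).comp_hasFDerivAt z h1).smul (hasFDerivAt_id z)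
  refine ⟨_, h2, ?_⟩
  have e : ‖z‖ ^ 2 + δ ^ 2 ≠ 0 := by positivity
  have e' : z 0 ^ 2 + z 1 ^ 2 + δ ^ 2 ≠ 0 := by positivity
  simp [stdVec, EuclideanSpace.inner_single_right, lapG, norm_sq_eq_add, Fin.sum_univ_two]
  field_simp
  ring

theorem contDiff_gradG {δ : ℝ} (hδ : δ ≠ 0) : ContDiff ℝ 1 (gradG δ) := by
  have := Real.pi_pos
  have h : ContDiff ℝ 1 fun z : Plane => (2 * Real.pi * (‖z‖ ^ 2 + δ ^ 2))⁻¹ := by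
    refine ContDiff.inv ?_ fun z => by positivity
    exact contDiff_const.mul ((contDiff_norm_sq ℝ).add contDiff_const)
  exact h.smul contDiff_id

/-- In polar coordinates the radial integrand r / (π (r² + 1)²) has antiderivative -1 / (2π (r² +
1)). -/
theorem integral_lapG_one : ∫ z, lapG 1 z = 1 := by
  have hpi := Real.pi_pos
  have h := integral_fun_norm_addHaar (E := Plane) volume
    (fun r : ℝ => (1 : ℝ) / (Real.pi * (r ^ 2 + 1) ^ 2))
  have hl : ∀ z : Plane, lapG 1 z = (fun r : ℝ => (1 : ℝ) / (Real.pi * (r ^ 2 + 1) ^ 2)) ‖z‖ := by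
    intro z; simp [lapG]
  simp_rw [hl]
  rw [h]
  have hI : ∫ y in Set.Ioi (0 : ℝ), y ^ (Module.finrank ℝ Plane - 1) •
      ((1 : ℝ) / (Real.pi * (y ^ 2 + 1) ^ 2)) = (2 * Real.pi)⁻¹ := by
    have hd : ∀ y ∈ Set.Ici (0 : ℝ), HasDerivAt (fun y : ℝ => -(2 * Real.pi * (y ^ 2 + 1))⁻¹)
        (y ^ (Module.finrank ℝ Plane - 1) • ((1 : ℝ) / (Real.pi * (y ^ 2 + 1) ^ 2))) y := by
      intro y _
      have h1 : HasDerivAt (fun y : ℝ => 2 * Real.pi * (y ^ 2 + 1)) (2 * Real.pi * (2 * y)) y := by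
        have := ((hasDerivAt_pow 2 y).add_const 1).const_mul (2 * Real.pi)
        simpa using this
      have := (h1.inv (by positivity)).neg
      refine this.congr_deriv ?_
      have e : Module.finrank ℝ Plane - 1 = 1 := by simp
      rw [e, smul_eq_mul]
      field_simp
    have ht : Tendsto (fun y : ℝ => -(2 * Real.pi * (y ^ 2 + 1))⁻¹) atTop (𝓝 0) := by
      rw [← neg_zero]
      refine Tendsto.neg (Tendsto.inv_tendsto_atTop ?_)
      refine Tendsto.const_mul_atTop (by positivity) ?_
      exact tendsto_atTop_add_const_right _ _ (tendsto_pow_atTop two_ne_zero)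
    have := integral_Ioi_of_hasDerivAt_of_nonneg' hd (fun y hy => by
      have : (0 : ℝ) < y := hy
      simp only [smul_eq_mul]; positivity) ht
    rw [this]
    simp
  rw [hI, Measure.real, EuclideanSpace.volume_ball_fin_two]
  simp [ENNReal.toReal_ofReal hpi.le]

/-- The Bochner integral of a non-integrable function is 0 by convention, whereas this integral is
1. -/
theorem integrable_lapG_one : Integrable (lapG 1) := by
  by_contra h
  have := integral_undef h
  rw [integral_lapG_one] at this
  exact one_ne_zero this

theorem volume_inner_eq_zero {n : Plane} (hn : n ≠ 0) :
    volume {t : Plane | inner ℝ t n = 0} = 0 := by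
  have := Measure.addHaar_submodule (volume : Measure Plane) (LinearMap.ker (innerₛₗ ℝ n)) (by
    intro h
    rw [LinearMap.ker_eq_top] at h
    have := congrArg (fun L => L n) h
    simp [hn] at this)
  refine Eq.trans (congrArg _ ?_) this
  ext t
  simp [real_inner_comm]

/-- `lapG 1` is even, and t ↦ -t exchanges the half-plane with its complement up to a null line. -/
theorem setIntegral_lapG_one_halfPlane {n : Plane} (hn : n ≠ 0) :
    ∫ t in {t : Plane | inner ℝ t n < 0}, lapG 1 t = 1 / 2 := by
  have hm : MeasurableSet {t : Plane | inner ℝ t n < 0} :=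
    measurableSet_lt (by fun_prop) measurable_const
  have h1 := integral_add_compl hm integrable_lapG_one
  have h2 : ∫ t in {t : Plane | inner ℝ t n < 0}ᶜ, lapG 1 t
      = ∫ t in {t : Plane | inner ℝ t n < 0}, lapG 1 t := by
    rw [← integral_indicator hm, ← integral_indicator hm.compl, ← integral_neg_eq_self]
    refine integral_congr_ae ?_
    have : ∀ᵐ t : Plane, inner ℝ t n ≠ 0 := by
      rw [ae_iff]; simpa using volume_inner_eq_zero hn
    filter_upwards [this] with t ht
    by_cases h : inner ℝ t n < 0
    · rw [Set.indicator_of_mem (s := {t : Plane | inner ℝ t n < 0}) h,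
        Set.indicator_of_mem (by simpa using h.le)]
      simp [lapG]
    · rw [Set.indicator_of_notMem (s := {t : Plane | inner ℝ t n < 0}) h,
        Set.indicator_of_notMem]
      simpa using lt_of_le_of_ne (not_lt.1 h) ht.symm
  rw [h2, integral_lapG_one] at h1
  linarith

/-- Near `y`, the set `A` blows up to a set which carries the fraction `c` of the mass of a
radial approximate identity. -/
def HasBlowUpDensity (A : Set Plane) (y : Plane) (c : ℝ) : Prop :=
  ∃ H : Set Plane, MeasurableSet H ∧ ∫ t in H, lapG 1 t = c ∧
    ∀ᵐ t, ∀ᶠ ε : ℝ in 𝓝[>] 0, (y + ε • t ∈ A ↔ t ∈ H)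

theorem hasBlowUpDensity_univ (y : Plane) : HasBlowUpDensity Set.univ y 1 :=
  ⟨Set.univ, MeasurableSet.univ, by simp [integral_lapG_one], by simp⟩

/-- The definition of the normal says that A is a half-plane to first order, so each direction t off
the boundary line is eventually on the correct side. -/
theorem IsOutwardUnitNormal.hasBlowUpDensity {A : Set Plane} {y n : Plane}
    (h : IsOutwardUnitNormal A y n) : HasBlowUpDensity A y (1 / 2) := by
  have hn : n ≠ 0 := by rintro rfl; simpa using h.1
  refine ⟨{t | inner ℝ t n < 0}, measurableSet_lt (by fun_prop) measurable_const,
    setIntegral_lapG_one_halfPlane hn, ?_⟩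
  have : ∀ᵐ t : Plane, inner ℝ t n ≠ 0 := by
    rw [ae_iff]; simpa using volume_inner_eq_zero hn
  filter_upwards [this] with t ht
  have ht0 : 0 < ‖t‖ := norm_pos_iff.2 (by rintro rfl; simp at ht)
  have hlim : Tendsto (fun ε : ℝ => y + ε • t) (𝓝[>] 0) (𝓝 y) := by
    have hc : Continuous fun ε : ℝ => y + ε • t := by fun_prop
    have := hc.tendsto 0
    simp only [zero_smul, add_zero] at this
    exact this.mono_left nhdsWithin_le_nhds
  have ha : 0 < |inner ℝ t n| := abs_pos.2 ht
  -- This tolerance makes the allowed error ε |⟨t, n⟩| / 2, too small to reverse the sign of ε ⟨t,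
  -- n⟩.
  filter_upwards [hlim.eventually (h.2 (|inner ℝ t n| / (2 * ‖t‖)) (by positivity)),
    self_mem_nhdsWithin] with ε hε hε0
  have hε0 : 0 < ε := hε0
  simp only [add_sub_cancel_left, real_inner_smul_left, norm_smul, Real.norm_eq_abs,
    abs_of_pos hε0] at hε
  have e : |inner ℝ t n| / (2 * ‖t‖) * (ε * ‖t‖) = ε * (|inner ℝ t n| / 2) := by field_simp
  rw [e, mul_le_mul_iff_right₀ hε0, ← mul_neg, mul_le_mul_iff_right₀ hε0] at hε
  change y + ε • t ∈ A ↔ inner ℝ t n < 0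
  constructor
  · intro hA
    by_contra hge
    have := hε.1 hA
    rw [abs_of_nonneg (not_lt.1 hge)] at this
    exact ht (le_antisymm (by linarith) (not_lt.1 hge))
  · intro hlt
    by_contra hA
    have := hε.2 hA
    rw [abs_of_neg hlt] at this
    linarith

theorem lapG_smul {δ : ℝ} (hδ : δ ≠ 0) (t : Plane) : δ ^ 2 * lapG δ (δ • t) = lapG 1 t := by
  have := Real.pi_pos
  simp only [lapG, norm_smul, mul_pow, Real.norm_eq_abs, sq_abs]
  field_simp

/-- The substitution z = y + δt turns `lapG δ` into `lapG 1`. The rescaled indicators of A converge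
to that of the blow-up set, and `lapG 1` times a bound for w dominates. -/
theorem tendsto_setIntegral_lapG {A : Set Plane} (hA : MeasurableSet A) {y : Plane} {c : ℝ}
    (h : HasBlowUpDensity A y c) {w : Plane → ℂ} (hw : Continuous w) (hwc : HasCompactSupport w) :
    Tendsto (fun δ : ℝ => ∫ z in A, lapG δ (z - y) • w z) (𝓝[>] 0) (𝓝 (c • w y)) := by
  obtain ⟨H, hH, hHc, hblow⟩ := h
  obtain ⟨M, hM⟩ := hw.bounded_above_of_compact_support hwc
  have hsub : ∀ δ : ℝ, 0 < δ → ∫ z in A, lapG δ (z - y) • w z =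
      ∫ t, A.indicator (fun z => lapG 1 t • w z) (y + δ • t) := by
    intro δ hδ
    rw [← integral_indicator hA]
    have h1 := Measure.integral_comp_smul (volume : Measure Plane)
      (fun t => A.indicator (fun z => lapG δ (z - y) • w z) (y + t)) δ
    rw [integral_add_left_eq_self (μ := (volume : Measure Plane))
      (fun z => A.indicator (fun z => lapG δ (z - y) • w z) z) y] at h1
    simp only [finrank_euclideanSpace, Fintype.card_fin] at h1
    rw [abs_of_pos (by positivity), eq_inv_smul_iff₀ (by positivity), ← integral_smul] at h1
    rw [← h1]
    congr 1
    ext t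
    by_cases ht : y + δ • t ∈ A
    · rw [Set.indicator_of_mem ht, Set.indicator_of_mem ht, smul_smul, add_sub_cancel_left,
        lapG_smul hδ.ne']
    · rw [Set.indicator_of_notMem ht, Set.indicator_of_notMem ht, smul_zero]
  have hlim : Tendsto (fun δ : ℝ => ∫ t, A.indicator (fun z => lapG 1 t • w z) (y + δ • t))
      (𝓝[>] 0) (𝓝 (∫ t, H.indicator (fun t => lapG 1 t • w y) t)) := by
    refine tendsto_integral_filter_of_dominated_convergence (fun t => lapG 1 t * M) ?_ ?_
      (integrable_lapG_one.mul_const M) ?_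
    · refine Eventually.of_forall fun δ => Measurable.aestronglyMeasurable ?_
      have h1 : Measurable fun t : Plane => y + δ • t := by fun_prop
      have e : (fun t => A.indicator (fun z => lapG 1 t • w z) (y + δ • t)) =
          ((fun t => y + δ • t) ⁻¹' A).indicator fun t => lapG 1 t • w (y + δ • t) := by
        ext t; rfl
      rw [e]
      refine Measurable.indicator ?_ (h1 hA)
      exact (continuous_lapG one_ne_zero).measurable.smul (hw.measurable.comp h1)
    · refine Eventually.of_forall fun δ => Eventually.of_forall fun t => ?_
      refine (norm_indicator_le_norm_self _ _).trans ?_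
      rw [norm_smul, Real.norm_eq_abs, abs_of_nonneg (lapG_nonneg _ _)]
      exact mul_le_mul_of_nonneg_left (hM _) (lapG_nonneg _ _)
    · filter_upwards [hblow] with t ht
      have hc : Continuous fun δ : ℝ => y + δ • t := by fun_prop
      have hlim : Tendsto (fun δ : ℝ => lapG 1 t • w (y + δ • t)) (𝓝[>] 0) (𝓝 (lapG 1 t • w y)) := by
        have : Continuous fun δ : ℝ => lapG 1 t • w (y + δ • t) := by fun_prop
        have := this.tendsto 0
        simp only [zero_smul, add_zero] at this
        exact this.mono_left nhdsWithin_le_nhds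
      by_cases hH : t ∈ H
      · rw [Set.indicator_of_mem hH]
        refine hlim.congr' ?_
        filter_upwards [ht] with δ hδ
        rw [Set.indicator_of_mem (hδ.2 hH)]
      · rw [Set.indicator_of_notMem hH]
        refine tendsto_const_nhds.congr' ?_
        filter_upwards [ht] with δ hδ
        rw [Set.indicator_of_notMem (fun h => hH (hδ.1 h))]
  rw [integral_indicator hH, integral_smul_const, hHc] at hlim
  refine hlim.congr' ?_
  filter_upwards [self_mem_nhdsWithin] with δ hδ
  exact (hsub δ hδ).symm

/-! ### Gauss–Green and the weak jump relation for a point charge -/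

/-- The Gauss–Green formula for the set `A`, with boundary measure `σ` and normal field `n`. -/
def IsGaussGreen (A : Set Plane) (σ : Measure Plane) (n : Plane → Plane) : Prop :=
  ∀ (w : Plane → ℂ) (a : Plane), ContDiff ℝ 1 w → HasCompactSupport w →
    ∫ z in A, fderiv ℝ w z a = ∫ x, (inner ℝ a (n x) : ℝ) • w x ∂σ

/-- The plane is treated as a set without boundary, so that ΔG = δ₀ becomes the case c = 1 of the
jump relation. -/
theorem isGaussGreen_univ : IsGaussGreen Set.univ 0 0 := by
  intro w a hw hwc
  have h1 : Continuous fun z => fderiv ℝ w z a := (hw.continuous_fderiv one_ne_zero).clm_apply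
    continuous_const
  have := integral_mul_fderiv_eq_neg_fderiv_mul_of_integrable (μ := (volume : Measure Plane))
    (f := fun _ => (1 : ℂ)) (g := w) (v := a) (by simp)
    (by simpa using h1.integrable_of_hasCompactSupport (hwc.fderiv_apply (𝕜 := ℝ) a))
    (by simpa using hw.continuous.integrable_of_hasCompactSupport hwc)
    (by simp) (fun x _ => hw.differentiable one_ne_zero x)
  simpa using this

theorem exists_lintegral_volume_le {K : Set Plane} (hK : IsCompact K) {β : ℝ} (hβ : 0 < β)
    (hβ2 : β < 2) :
    ∃ M : ℝ≥0, ∀ x, ∫⁻ z in K, ENNReal.ofReal (‖x - z‖ ^ (-β)) ≤ M := by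
  have : IsFiniteMeasure (volume.restrict K) := ⟨by simpa using hK.measure_lt_top⟩
  refine exists_lintegral_norm_rpow_neg_le (C := Real.pi) (d := 2) Real.pi_pos.le hβ hβ2 ?_
  intro x r hr
  refine (Measure.restrict_apply_le _ _).trans_eq ?_
  rw [EuclideanSpace.volume_closedBall_fin_two, ← ENNReal.ofReal_pow hr.le,
    ENNReal.ofReal_mul Real.pi_pos.le, Real.rpow_two, mul_comm]

theorem integrableOn_norm_gradG {K : Set Plane} (hK : IsCompact K) (y : Plane) :
    IntegrableOn (fun z => ‖gradG 0 (z - y)‖) K := by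
  obtain ⟨M, hM⟩ := exists_lintegral_volume_le hK one_pos one_lt_two
  refine ⟨((measurable_gradG 0).comp (by fun_prop)).norm.aestronglyMeasurable, ?_⟩
  rw [hasFiniteIntegral_iff_ofReal (Eventually.of_forall fun _ => norm_nonneg _)]
  have hpi := Real.pi_pos
  calc _ = ∫⁻ z in K, ENNReal.ofReal (2 * Real.pi)⁻¹ * ENNReal.ofReal (‖y - z‖ ^ (-1 : ℝ)) := by
        refine lintegral_congr fun z => ?_
        rw [norm_gradG_zero, ENNReal.ofReal_mul (by positivity), norm_sub_rev, Real.rpow_neg_one]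
    _ < ∞ := by
        rw [lintegral_const_mul' _ _ (by finiteness)]
        exact ENNReal.mul_lt_top (by finiteness) ((hM y).trans_lt (by finiteness))

theorem inner_eq_sum (u v : Plane) : (inner ℝ u v : ℝ) = ∑ i, u i * inner ℝ (stdVec i) v := by
  conv_lhs => rw [eq_sum_stdVec u]
  rw [sum_inner]
  simp only [real_inner_smul_left]

theorem fderiv_gradG_smul {δ : ℝ} (hδ : δ ≠ 0) (y : Plane) {w : Plane → ℂ} {z : Plane}
    (hw : DifferentiableAt ℝ w z) :
    ∑ i, fderiv ℝ (fun z => gradG δ (z - y) i • w z) z (stdVec i) =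
      lapG δ (z - y) • w z + fderiv ℝ w z (gradG δ (z - y)) := by
  obtain ⟨L, hL, htr⟩ := hasFDerivAt_gradG hδ (z - y)
  have h1 : ∀ i, fderiv ℝ (fun z => gradG δ (z - y) i • w z) z (stdVec i) =
      gradG δ (z - y) i • fderiv ℝ w z (stdVec i) + L (stdVec i) i • w z := by
    intro i
    have hLi : HasFDerivAt (fun z => gradG δ (z - y) i)
        ((EuclideanSpace.proj i : Plane →L[ℝ] ℝ).comp L) z := by
      have h2 : HasFDerivAt (fun z : Plane => z - y) (ContinuousLinearMap.id ℝ Plane) z :=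
        (hasFDerivAt_id z).sub_const y
      exact (EuclideanSpace.proj i : Plane →L[ℝ] ℝ).hasFDerivAt.comp z (hL.comp z h2)
    have h3 : fderiv ℝ (fun z => gradG δ (z - y) i • w z) z = _ :=
      (hLi.smul hw.hasFDerivAt).fderiv
    rw [h3]
    simp
  simp only [h1, Finset.sum_add_distrib, ← Finset.sum_smul, htr]
  rw [add_comm]
  congr 1
  conv_rhs => rw [eq_sum_stdVec (gradG δ (z - y)), map_sum]
  simp only [map_smul]

/-- The divergence theorem for a compactly supported vector field. -/
theorem IsGaussGreen.setIntegral_div {A : Set Plane} {σ : Measure Plane} [IsFiniteMeasure σ]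
    {n : Plane → Plane} (hnm : Measurable n) (hn1 : ∀ x, ‖n x‖ ≤ 1) (hGG : IsGaussGreen A σ n)
    {g : Fin 2 → Plane → ℂ} (hc : ∀ i, ContDiff ℝ 1 (g i)) (hcc : ∀ i, HasCompactSupport (g i)) :
    ∫ z in A, ∑ i, fderiv ℝ (g i) z (stdVec i) =
      ∫ x, ∑ i, (inner ℝ (stdVec i) (n x) : ℝ) • g i x ∂σ := by
  have hint : ∀ i, Integrable fun z => fderiv ℝ (g i) z (stdVec i) :=
    fun i => (((hc i).continuous_fderiv one_ne_zero).clm_apply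
      continuous_const).integrable_of_hasCompactSupport ((hcc i).fderiv_apply (𝕜 := ℝ) (stdVec i))
  have hintσ : ∀ i, Integrable (fun x => (inner ℝ (stdVec i) (n x) : ℝ) • g i x) σ := by
    intro i
    obtain ⟨M, hM⟩ := (hc i).continuous.bounded_above_of_compact_support (hcc i)
    refine Integrable.mono' (integrable_const M) ?_ (Eventually.of_forall fun x => ?_)
    · have hm : Measurable fun x => (inner ℝ (stdVec i) (n x) : ℝ) := by fun_prop
      exact hm.aestronglyMeasurable.smul (hc i).continuous.aestronglyMeasurable
    · rw [norm_smul]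
      refine (mul_le_of_le_one_left (norm_nonneg _) ?_).trans (hM x)
      refine (norm_inner_le_norm _ _).trans ?_
      simpa [stdVec] using hn1 x
  rw [integral_finsetSum _ fun i _ => (hint i).integrableOn,
    integral_finsetSum _ fun i _ => hintσ i]
  exact Finset.sum_congr rfl fun i _ => hGG _ (stdVec i) (hc i) (hcc i)

/-- The divergence theorem for the field w ∇G_δ(· - y), which is C¹ everywhere because δ ≠ 0. -/
theorem setIntegral_lapG_add_fderiv {A : Set Plane} {σ : Measure Plane} [IsFiniteMeasure σ]
    {n : Plane → Plane} (hnm : Measurable n) (hn1 : ∀ x, ‖n x‖ ≤ 1) (hGG : IsGaussGreen A σ n)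
    {δ : ℝ} (hδ : δ ≠ 0) (y : Plane) {w : Plane → ℂ} (hw : ContDiff ℝ 1 w)
    (hwc : HasCompactSupport w) :
    (∫ z in A, lapG δ (z - y) • w z) + ∫ z in A, fderiv ℝ w z (gradG δ (z - y)) =
      ∫ x, dnG n δ x y • w x ∂σ := by
  have hgc : ∀ i, ContDiff ℝ 1 fun z => gradG δ (z - y) i := fun i =>
    ((EuclideanSpace.proj i : Plane →L[ℝ] ℝ).contDiff).comp
      ((contDiff_gradG hδ).comp (contDiff_id.sub contDiff_const))
  have hcc : ∀ i, HasCompactSupport fun z => gradG δ (z - y) i • w z := fun i =>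
    HasCompactSupport.smul_left (f := fun z => gradG δ (z - y) i) hwc
  have hc : ∀ i, ContDiff ℝ 1 fun z => gradG δ (z - y) i • w z := fun i => (hgc i).smul hw
  have hdiv := hGG.setIntegral_div hnm hn1 hc hcc
  have hl : Integrable fun z => lapG δ (z - y) • w z :=
    (((continuous_lapG hδ).comp (continuous_id.sub continuous_const)).smul
      hw.continuous).integrable_of_hasCompactSupport hwc.smul_left
  have hr : Integrable fun z => fderiv ℝ w z (gradG δ (z - y)) :=
    ((hw.continuous_fderiv one_ne_zero).clm_apply ((continuous_gradG hδ).comp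
      (continuous_id.sub continuous_const))).integrable_of_hasCompactSupport (by
        refine (hwc.fderiv (𝕜 := ℝ)).mono ?_
        intro z hz h0
        apply hz
        simp only [h0, zero_apply])
  rw [← integral_add hl.integrableOn hr.integrableOn]
  have e1 : ∀ z, lapG δ (z - y) • w z + fderiv ℝ w z (gradG δ (z - y)) =
      ∑ i, fderiv ℝ (fun z => gradG δ (z - y) i • w z) z (stdVec i) := fun z =>
    (fderiv_gradG_smul hδ y (hw.differentiable one_ne_zero z)).symm
  have e2 : ∀ x, dnG n δ x y • w x =
      ∑ i, (inner ℝ (stdVec i) (n x) : ℝ) • gradG δ (x - y) i • w x := fun x => by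
    rw [dnG, inner_eq_sum, Finset.sum_smul]
    refine Finset.sum_congr rfl fun i _ => ?_
    rw [smul_smul, mul_comm]
  simp_rw [e1, e2]
  exact hdiv

theorem tendsto_gradG_zero (z : Plane) : Tendsto (fun δ => gradG δ z) (𝓝[>] 0) (𝓝 (gradG 0 z)) := by
  rcases eq_or_ne z 0 with rfl | h
  · simp [gradG]
  have hpi := Real.pi_pos
  have hz : 0 < ‖z‖ := norm_pos_iff.2 h
  have : ContinuousAt (fun δ : ℝ => gradG δ z) 0 := by
    unfold gradG
    have h1 : ContinuousAt (fun δ : ℝ => (2 * Real.pi * (‖z‖ ^ 2 + δ ^ 2))⁻¹) 0 :=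
      ContinuousAt.inv₀ (Continuous.continuousAt (by fun_prop)) (by positivity)
    exact h1.smul continuousAt_const
  exact this.tendsto.mono_left nhdsWithin_le_nhds

/-- The weak form of the jump relation for the normal derivative of the potential of a point
charge. -/
theorem setIntegral_fderiv_gradG_zero {A : Set Plane} (hA : MeasurableSet A) {σ : Measure Plane}
    [IsFiniteMeasure σ] {n : Plane → Plane} (hnm : Measurable n) (hn1 : ∀ x, ‖n x‖ ≤ 1)
    (hGG : IsGaussGreen A σ n) {y : Plane} {c : ℝ} (hy : HasBlowUpDensity A y c)
    (hint : Integrable (fun x => dnG n 0 x y) σ) {w : Plane → ℂ} (hw : ContDiff ℝ 1 w)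
    (hwc : HasCompactSupport w) :
    ∫ z in A, fderiv ℝ w z (gradG 0 (z - y)) = (∫ x, dnG n 0 x y • w x ∂σ) - c • w y := by
  obtain ⟨M, hM⟩ := hw.continuous.bounded_above_of_compact_support hwc
  obtain ⟨M', hM'⟩ := (hw.continuous_fderiv one_ne_zero).bounded_above_of_compact_support
    (hwc.fderiv (𝕜 := ℝ))
  -- Let δ → 0 in the divergence theorem: the Laplacian term concentrates to c w(y), and the two
  -- gradient terms converge under their δ = 0 majorants.
  have l1 := tendsto_setIntegral_lapG hA hy hw.continuous hwc
  have l2 : Tendsto (fun δ => ∫ z in A, fderiv ℝ w z (gradG δ (z - y))) (𝓝[>] 0)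
      (𝓝 (∫ z in A, fderiv ℝ w z (gradG 0 (z - y)))) := by
    refine tendsto_integral_filter_of_dominated_convergence
      ((tsupport w).indicator fun z => M' * ‖gradG 0 (z - y)‖) ?_ ?_ ?_ ?_
    · filter_upwards [self_mem_nhdsWithin] with δ hδ
      exact ((hw.continuous_fderiv one_ne_zero).clm_apply ((continuous_gradG (ne_of_gt hδ)).comp
        (by fun_prop))).aestronglyMeasurable
    · refine Eventually.of_forall fun δ => Eventually.of_forall fun z => ?_
      by_cases hz : z ∈ tsupport w
      · rw [Set.indicator_of_mem hz]
        refine (ContinuousLinearMap.le_opNorm _ _).trans ?_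
        exact mul_le_mul (hM' z) (norm_gradG_le _ _) (norm_nonneg _)
          ((norm_nonneg _).trans (hM' z))
      · rw [Set.indicator_of_notMem hz,
          image_eq_zero_of_notMem_tsupport (fun h => hz (tsupport_fderiv_subset ℝ h))]
        simp
    · refine Integrable.integrableOn ?_
      rw [integrable_indicator_iff (isClosed_tsupport w).measurableSet]
      exact (integrableOn_norm_gradG hwc y).const_mul M'
    · refine Eventually.of_forall fun z => ?_
      exact ((fderiv ℝ w z).continuous.tendsto _).comp (tendsto_gradG_zero _)
  have l3 : Tendsto (fun δ => ∫ x, dnG n δ x y • w x ∂σ) (𝓝[>] 0)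
      (𝓝 (∫ x, dnG n 0 x y • w x ∂σ)) := by
    refine tendsto_integral_filter_of_dominated_convergence (fun x => |dnG n 0 x y| * M) ?_ ?_
      (hint.abs.mul_const M) ?_
    · exact Eventually.of_forall fun δ =>
        ((measurable_dnG hnm δ).of_uncurry_right.smul hw.continuous.measurable).aestronglyMeasurable
    · refine Eventually.of_forall fun δ => Eventually.of_forall fun x => ?_
      rw [norm_smul]
      exact mul_le_mul (abs_inner_gradG_le _ _ _) (hM x) (norm_nonneg _) (abs_nonneg _)
    · refine Eventually.of_forall fun x => Tendsto.smul_const ?_ _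
      exact (tendsto_gradG_zero _).inner tendsto_const_nhds
  have l4 := l1.add l2
  have : c • w y + ∫ z in A, fderiv ℝ w z (gradG 0 (z - y)) = ∫ x, dnG n 0 x y • w x ∂σ := by
    refine tendsto_nhds_unique l4 (l3.congr' ?_)
    filter_upwards [self_mem_nhdsWithin] with δ hδ
    exact (setIntegral_lapG_add_fderiv hnm hn1 hGG (ne_of_gt hδ) y hw hwc).symm
  rw [← this]
  ring

/-- The weak form of `ΔG = δ₀`. -/
theorem integral_fderiv_gradG_zero (y : Plane) {w : Plane → ℂ} (hw : ContDiff ℝ 1 w)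
    (hwc : HasCompactSupport w) : ∫ z, fderiv ℝ w z (gradG 0 (z - y)) = -w y := by
  have := setIntegral_fderiv_gradG_zero MeasurableSet.univ (σ := 0) (n := 0) measurable_zero
    (by simp) isGaussGreen_univ (hasBlowUpDensity_univ y) (by simp) hw hwc
  simpa using this

/-! ### Single layer potentials: local integrability and regularisation -/

section Potential

variable {σ : Measure Plane}

/-- The majorant behind the later uses of Fubini's theorem: integration over z in K is bounded
uniformly in y, which leaves only |φ| to integrate. -/
theorem integrable_prod_gradG [IsFiniteMeasure σ] {K : Set Plane} (hK : IsCompact K) {φ : Plane → ℂ}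
    (hφ : Integrable φ σ) :
    Integrable (fun p : Plane × Plane => ‖gradG 0 (p.1 - p.2)‖ * ‖φ p.2‖)
      ((volume.restrict K).prod σ) := by
  have hg : Measurable fun p : Plane × Plane => gradG 0 (p.1 - p.2) :=
    (measurable_gradG 0).comp (measurable_fst.sub measurable_snd)
  have hm : AEStronglyMeasurable (fun p : Plane × Plane => ‖gradG 0 (p.1 - p.2)‖ * ‖φ p.2‖)
      ((volume.restrict K).prod σ) :=
    hg.norm.aestronglyMeasurable.mul hφ.1.comp_snd.norm
  obtain ⟨M, hM⟩ := exists_lintegral_volume_le hK one_pos one_lt_two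
  refine (integrable_prod_iff' hm).2 ⟨?_, ?_⟩
  · exact Eventually.of_forall fun y => (integrableOn_norm_gradG hK y).mul_const ‖φ y‖
  · have hb : ∀ y, ‖∫ z in K, ‖‖gradG 0 (z - y)‖ * ‖φ y‖‖‖ ≤ (2 * Real.pi)⁻¹ * M * ‖φ y‖ := by
      intro y
      have hpi := Real.pi_pos
      have e : ∀ z, ‖‖gradG 0 (z - y)‖ * ‖φ y‖‖ = ‖gradG 0 (z - y)‖ * ‖φ y‖ := fun z =>
        Real.norm_of_nonneg (by positivity)
      simp_rw [e]
      rw [integral_mul_const, norm_mul, norm_norm]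
      gcongr
      rw [Real.norm_of_nonneg (integral_nonneg fun _ => norm_nonneg _),
        integral_eq_lintegral_of_nonneg_ae (Eventually.of_forall fun _ => norm_nonneg _)
          (integrableOn_norm_gradG hK y).1]
      refine ENNReal.toReal_le_of_le_ofReal (by positivity) ?_
      rw [ENNReal.ofReal_mul (by positivity), ENNReal.ofReal_coe_nnreal]
      calc _ = ∫⁻ z in K, ENNReal.ofReal (2 * Real.pi)⁻¹ * ENNReal.ofReal (‖y - z‖ ^ (-1 : ℝ)) := by
            refine lintegral_congr fun z => ?_
            rw [norm_gradG_zero, ENNReal.ofReal_mul (by positivity), norm_sub_rev,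
              Real.rpow_neg_one]
        _ ≤ _ := by
            rw [lintegral_const_mul' _ _ (by finiteness)]
            gcongr
            exact hM y
    refine Integrable.mono' (hφ.norm.const_mul ((2 * Real.pi)⁻¹ * M)) ?_ (Eventually.of_forall hb)
    exact hm.norm.prod_swap.integral_prod_right'

/-- The potential of the absolute values dominates the gradient of a single layer potential. -/
def absPotential (σ : Measure Plane) (φ : Plane → ℂ) (z : Plane) : ℝ≥0∞ :=
  ∫⁻ y, ‖gradG 0 (z - y)‖ₑ * ‖φ y‖ₑ ∂σ

theorem aemeasurable_absPotential [IsFiniteMeasure σ] {φ : Plane → ℂ} (hφ : AEStronglyMeasurable φ σ)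
    (μ : Measure Plane) [SFinite μ] : AEMeasurable (absPotential σ φ) μ := by
  have hg : Measurable fun p : Plane × Plane => gradG 0 (p.1 - p.2) :=
    (measurable_gradG 0).comp (measurable_fst.sub measurable_snd)
  have hm : AEMeasurable (fun p : Plane × Plane => ‖gradG 0 (p.1 - p.2)‖ₑ * ‖φ p.2‖ₑ) (μ.prod σ) :=
    hg.enorm.aemeasurable.mul hφ.comp_snd.enorm
  exact hm.lintegral_prod_right'

/-- Write |z - y|^(-1) as f · f with f = |z - y|^(-1/2). Cauchy–Schwarz leaves a factor ∫ f dσ,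
bounded because 1/2 < 1 on a curve, times ∫ f³ |φ|² dσ. The latter has a finite area integral over K
because 3/2 < 2. This is where square integrability of φ becomes finite local energy. -/
theorem lintegral_absPotential_sq_lt_top [IsFiniteMeasure σ] (hσ : IsUpperRegular σ) {K : Set Plane} (hK : IsCompact K)
    {φ : Plane → ℂ} (hφ : MemLp φ 2 σ) : ∫⁻ z in K, absPotential σ φ z ^ 2 < ∞ := by
  obtain ⟨M₁, h₁⟩ := hσ.exists_lintegral_le (β := 1 / 2) (by norm_num) (by norm_num)
  obtain ⟨M₂, h₂⟩ := exists_lintegral_volume_le hK (β := 3 / 2) (by norm_num) (by norm_num)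
  have hfin : ∫⁻ y, ‖φ y‖ₑ ^ 2 ∂σ < ∞ := by
    have := hφ.2
    rw [eLpNorm_lt_top_iff_lintegral_rpow_enorm_lt_top two_ne_zero ENNReal.ofNat_ne_top] at this
    simpa using this
  have hpi := Real.pi_pos
  let c : ℝ≥0∞ := ENNReal.ofReal (2 * Real.pi)⁻¹
  let f : Plane → Plane → ℝ≥0∞ := fun z y => ENNReal.ofReal (‖z - y‖ ^ (-(1 / 2) : ℝ))
  let h : Plane → Plane → ℝ≥0∞ := fun z y => ENNReal.ofReal (‖z - y‖ ^ (-(3 / 2) : ℝ))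
  have hfm : Measurable (Function.uncurry f) := by
    unfold f Function.uncurry; fun_prop
  have hhm : Measurable (Function.uncurry h) := by
    unfold h Function.uncurry; fun_prop
  have e1 : ∀ z y, ‖gradG 0 (z - y)‖ₑ = c * (f z y * f z y) := by
    intro z y
    simp only [f, c]
    rw [← ofReal_norm, norm_gradG_zero, ← ENNReal.ofReal_mul (by positivity),
      ← ENNReal.ofReal_mul (by positivity)]
    rcases eq_or_ne z y with rfl | hzy
    · simp
    · rw [← Real.rpow_add (norm_pos_iff.2 (sub_ne_zero.2 hzy)), ← Real.rpow_neg_one ‖z - y‖]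
      norm_num
  have e2 : ∀ z y, f z y * f z y ^ 2 = h z y := by
    intro z y
    simp only [f, h]
    rw [← ENNReal.ofReal_pow (by positivity), ← ENNReal.ofReal_mul (by positivity)]
    rcases eq_or_ne z y with rfl | hzy
    · simp
    · have h0 := norm_pos_iff.2 (sub_ne_zero.2 hzy)
      rw [← Real.rpow_natCast, ← Real.rpow_mul h0.le, ← Real.rpow_add h0]
      norm_num
  have key : ∀ z, absPotential σ φ z ^ 2 ≤ c ^ 2 * M₁ * ∫⁻ y, h z y * ‖φ y‖ₑ ^ 2 ∂σ := by
    intro z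
    have hfz : Measurable (f z) := hfm.of_uncurry_left
    have h3 := lintegral_mul_sq_le (μ := σ) (f z) (fun y => f z y * ‖φ y‖ₑ) hfz.aemeasurable
      (hfz.aemeasurable.mul hφ.1.enorm)
    have e3 : absPotential σ φ z = c * ∫⁻ y, f z y * (f z y * ‖φ y‖ₑ) ∂σ := by
      rw [← lintegral_const_mul' _ _ (by finiteness)]
      refine lintegral_congr fun y => ?_
      rw [e1]; ring
    rw [e3, mul_pow, mul_assoc]
    refine mul_le_mul_right (h3.trans ?_) _
    refine mul_le_mul' (h₁ z) (lintegral_mono fun y => ?_)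
    rw [mul_pow, ← mul_assoc, e2]
  calc _ ≤ ∫⁻ z in K, c ^ 2 * M₁ * ∫⁻ y, h z y * ‖φ y‖ₑ ^ 2 ∂σ := lintegral_mono key
    _ = c ^ 2 * M₁ * ∫⁻ z in K, ∫⁻ y, h z y * ‖φ y‖ₑ ^ 2 ∂σ :=
        lintegral_const_mul' _ _ (by finiteness)
    _ = c ^ 2 * M₁ * ∫⁻ y, (∫⁻ z in K, h z y * ‖φ y‖ₑ ^ 2) ∂σ := by
        congr 1
        refine lintegral_lintegral_swap ?_
        exact hhm.aemeasurable.mul (hφ.1.enorm.comp_snd.pow_const 2)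
    _ ≤ c ^ 2 * M₁ * ∫⁻ y, M₂ * ‖φ y‖ₑ ^ 2 ∂σ := by
        refine mul_le_mul_right (lintegral_mono fun y => ?_) _
        rw [lintegral_mul_const _ hhm.of_uncurry_right]
        refine mul_le_mul_left ?_ _
        refine le_trans (le_of_eq ?_) (h₂ y)
        refine lintegral_congr fun z => ?_
        simp only [h]
        rw [norm_sub_rev]
    _ < ∞ := by
        rw [lintegral_const_mul' _ _ (by finiteness)]
        exact ENNReal.mul_lt_top (by finiteness) (ENNReal.mul_lt_top (by finiteness) hfin)

theorem ae_absPotential_lt_top [IsFiniteMeasure σ] {φ : Plane → ℂ} (hφ : Integrable φ σ) :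
    ∀ᵐ z : Plane, absPotential σ φ z < ∞ := by
  have h : ∀ k : ℕ, ∀ᵐ z ∂(volume.restrict (Metric.closedBall (0 : Plane) k)),
      absPotential σ φ z < ∞ := by
    intro k
    have := (integrable_prod_gradG (σ := σ) (isCompact_closedBall (0 : Plane) (k : ℝ)) hφ).prod_right_ae
    filter_upwards [this] with z hz
    have := hz.2
    rw [hasFiniteIntegral_iff_enorm] at this
    simpa [enorm_mul, absPotential] using this
  have hU : ⋃ k : ℕ, Metric.closedBall (0 : Plane) k = Set.univ :=
    Metric.iUnion_closedBall_nat 0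
  rw [← Measure.restrict_univ (μ := (volume : Measure Plane)), ← hU, ae_restrict_iUnion_iff]
  exact h

/-- The `i`-th partial derivative of the (regularized) single layer potential. -/
def gradPotential (σ : Measure Plane) (φ : Plane → ℂ) (δ : ℝ) (i : Fin 2) (z : Plane) : ℂ :=
  ∫ y, gradG δ (z - y) i • φ y ∂σ

theorem enorm_coord_gradG_le (δ : ℝ) (i : Fin 2) (z : Plane) : ‖gradG δ z i‖ₑ ≤ ‖gradG 0 z‖ₑ := by
  rw [enorm_le_iff_norm_le]
  exact (PiLp.norm_apply_le _ _).trans (norm_gradG_le _ _)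

theorem measurable_gradG_apply (δ : ℝ) (i : Fin 2) : Measurable fun z => gradG δ z i :=
  (EuclideanSpace.proj i : Plane →L[ℝ] ℝ).measurable.comp (measurable_gradG δ)

theorem measurable_coord_gradG (δ : ℝ) (i : Fin 2) :
    Measurable fun p : Plane × Plane => gradG δ (p.1 - p.2) i :=
  (measurable_gradG_apply δ i).comp (measurable_fst.sub measurable_snd)

theorem aestronglyMeasurable_gradPotential [IsFiniteMeasure σ] {φ : Plane → ℂ} (hφ : AEStronglyMeasurable φ σ) (δ : ℝ)
    (i : Fin 2) (μ : Measure Plane) [SFinite μ] :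
    AEStronglyMeasurable (gradPotential σ φ δ i) μ := by
  have hm : AEStronglyMeasurable (fun p : Plane × Plane => gradG δ (p.1 - p.2) i • φ p.2)
      (μ.prod σ) := (measurable_coord_gradG δ i).aestronglyMeasurable.smul hφ.comp_snd
  exact hm.integral_prod_right'

theorem enorm_gradPotential_le (φ : Plane → ℂ) (δ : ℝ) (i : Fin 2) (z : Plane) :
    ‖gradPotential σ φ δ i z‖ₑ ≤ absPotential σ φ z := by
  refine (enorm_integral_le_lintegral_enorm _).trans (lintegral_mono fun y => ?_)
  rw [enorm_smul]
  gcongr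
  exact enorm_coord_gradG_le _ _ _

theorem integrable_gradG_smul {φ : Plane → ℂ} (hφ : AEStronglyMeasurable φ σ) {z : Plane}
    (hz : absPotential σ φ z < ∞) (δ : ℝ) (i : Fin 2) :
    Integrable (fun y => gradG δ (z - y) i • φ y) σ := by
  have hm : Measurable fun y => gradG δ (z - y) i :=
    (measurable_gradG_apply δ i).comp (measurable_const.sub measurable_id)
  refine ⟨hm.aestronglyMeasurable.smul hφ, ?_⟩
  rw [hasFiniteIntegral_iff_enorm]
  refine lt_of_le_of_lt ?_ hz
  unfold absPotential
  refine lintegral_mono fun y => ?_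
  rw [enorm_smul]
  exact mul_le_mul_left (enorm_coord_gradG_le δ i (z - y)) _

theorem tendsto_gradPotential {φ : Plane → ℂ} (hφ : AEStronglyMeasurable φ σ) {z : Plane}
    (hz : absPotential σ φ z < ∞) (i : Fin 2) :
    Tendsto (fun δ => gradPotential σ φ δ i z) (𝓝[>] 0) (𝓝 (gradPotential σ φ 0 i z)) := by
  refine tendsto_integral_filter_of_dominated_convergence
    (fun y => (‖gradG 0 (z - y)‖ₑ * ‖φ y‖ₑ).toReal) ?_ ?_ ?_ ?_
  · exact Eventually.of_forall fun δ => (integrable_gradG_smul hφ hz δ i).1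
  · refine Eventually.of_forall fun δ => Eventually.of_forall fun y => ?_
    rw [norm_smul, ENNReal.toReal_mul, toReal_enorm, toReal_enorm]
    gcongr
    exact (PiLp.norm_apply_le _ _).trans (norm_gradG_le _ _)
  · refine integrable_toReal_of_lintegral_ne_top ?_ hz.ne
    have hm : Measurable fun y => gradG 0 (z - y) := (measurable_gradG 0).comp (by fun_prop)
    exact hm.enorm.aemeasurable.mul hφ.enorm
  · refine Eventually.of_forall fun y => Tendsto.smul_const ?_ _
    exact ((EuclideanSpace.proj i : Plane →L[ℝ] ℝ).continuous.tendsto _).comp (tendsto_gradG_zero _)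

/-- The regularized fundamental solution. -/
def regG (δ : ℝ) (z : Plane) : ℝ := (4 * Real.pi)⁻¹ * Real.log (‖z‖ ^ 2 + δ ^ 2)

theorem hasFDerivAt_regG {δ : ℝ} (hδ : δ ≠ 0) (z : Plane) :
    HasFDerivAt (regG δ) (innerSL ℝ (gradG δ z)) z := by
  have hpi := Real.pi_pos
  have hq : ‖z‖ ^ 2 + δ ^ 2 ≠ 0 := by positivity
  have h1 : HasFDerivAt (fun z : Plane => ‖z‖ ^ 2 + δ ^ 2) (2 • (innerSL ℝ z)) z :=
    (hasStrictFDerivAt_norm_sq z).hasFDerivAt.add_const _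
  have h2 := (h1.log hq).const_mul (4 * Real.pi)⁻¹
  refine h2.congr_fderiv ?_
  ext v
  simp [gradG]
  field_simp
  norm_num

theorem continuous_regG {δ : ℝ} (hδ : δ ≠ 0) : Continuous (regG δ) :=
  continuous_iff_continuousAt.2 fun z => (hasFDerivAt_regG hδ z).continuousAt

theorem norm_gradG_le_const {δ : ℝ} (hδ : 0 < δ) (z : Plane) : ‖gradG δ z‖ ≤ δ⁻¹ := by
  have hpi := Real.pi_gt_three
  rw [gradG, norm_smul, Real.norm_eq_abs, abs_of_nonneg (by positivity), inv_mul_le_iff₀ (by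
    positivity), ← div_eq_mul_inv, le_div_iff₀ hδ]
  nlinarith [sq_nonneg (‖z‖ - δ), norm_nonneg z, sq_nonneg ‖z‖, sq_nonneg δ]

/-- The regularized single layer potential. -/
def regPotential (σ : Measure Plane) (φ : Plane → ℂ) (δ : ℝ) (z : Plane) : ℂ :=
  ∫ y, regG δ (z - y) • φ y ∂σ

theorem integrable_regG_smul {Γ : Set Plane} (hΓ : IsCompact Γ) (hσΓ : ∀ᵐ y ∂σ, y ∈ Γ)
    {φ : Plane → ℂ} (hφ : Integrable φ σ) {δ : ℝ} (hδ : δ ≠ 0) (z : Plane) :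
    Integrable (fun y => regG δ (z - y) • φ y) σ := by
  have hc : Continuous fun y => regG δ (z - y) :=
    (continuous_regG hδ).comp (continuous_const.sub continuous_id)
  obtain ⟨M, hM⟩ := hΓ.exists_bound_of_continuousOn hc.continuousOn
  refine Integrable.mono' (hφ.norm.const_mul M) (hc.aestronglyMeasurable.smul hφ.1) ?_
  filter_upwards [hσΓ] with y hy
  rw [norm_smul]
  exact mul_le_mul_of_nonneg_right (hM y hy) (norm_nonneg _)

/-- For δ > 0 the gradient of the kernel is bounded by 1/δ, so differentiation under the integral is
legitimate even on Γ. These potentials therefore serve as test functions. -/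
theorem hasFDerivAt_regPotential {Γ : Set Plane} (hΓ : IsCompact Γ) (hσΓ : ∀ᵐ y ∂σ, y ∈ Γ)
    {φ : Plane → ℂ} (hφ : Integrable φ σ) {δ : ℝ} (hδ : 0 < δ) (z : Plane) :
    HasFDerivAt (regPotential σ φ δ)
      (∫ y, (innerSL ℝ (gradG δ (z - y))).smulRight (φ y) ∂σ) z := by
  have hm : ∀ z, AEStronglyMeasurable
      (fun y => (innerSL ℝ (gradG δ (z - y))).smulRight (φ y)) σ := by
    intro z
    have hc : Continuous fun y => innerSL ℝ (gradG δ (z - y)) :=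
      (innerSL ℝ).continuous.comp
        ((continuous_gradG hδ.ne').comp (continuous_const.sub continuous_id))
    have hB : Continuous fun p : (Plane →L[ℝ] ℝ) × ℂ => p.1.smulRight p.2 :=
      ((ContinuousLinearMap.smulRightL ℝ Plane ℂ).continuous₂)
    exact hB.comp_aestronglyMeasurable₂ hc.aestronglyMeasurable hφ.1
  refine hasFDerivAt_integral_of_dominated_of_fderiv_le (F := fun z y => regG δ (z - y) • φ y)
    (F' := fun z y => (innerSL ℝ (gradG δ (z - y))).smulRight (φ y)) (s := Set.univ)
    (bound := fun y => δ⁻¹ * ‖φ y‖) univ_mem ?_ ?_ (hm z) ?_ (hφ.norm.const_mul _) ?_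
  · exact Eventually.of_forall fun z => (integrable_regG_smul hΓ hσΓ hφ hδ.ne' z).1
  · exact integrable_regG_smul hΓ hσΓ hφ hδ.ne' z
  · refine Eventually.of_forall fun y z _ => ?_
    rw [ContinuousLinearMap.norm_smulRight_apply, innerSL_apply_norm]
    exact mul_le_mul_of_nonneg_right (norm_gradG_le_const hδ _) (norm_nonneg _)
  · refine Eventually.of_forall fun y z _ => ?_
    have h2 : HasFDerivAt (fun z : Plane => z - y) (ContinuousLinearMap.id ℝ Plane) z :=
      (hasFDerivAt_id z).sub_const y
    have h3 : HasFDerivAt (fun z : Plane => regG δ (z - y)) (innerSL ℝ (gradG δ (z - y))) z :=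
      HasFDerivAt.comp (g := regG δ) (f := fun z : Plane => z - y) z
        (hasFDerivAt_regG hδ.ne' (z - y)) h2
    exact h3.smul_const (φ y)

theorem fderiv_regPotential {Γ : Set Plane} (hΓ : IsCompact Γ) (hσΓ : ∀ᵐ y ∂σ, y ∈ Γ)
    {φ : Plane → ℂ} (hφ : Integrable φ σ) {δ : ℝ} (hδ : 0 < δ) (z : Plane) (i : Fin 2) :
    fderiv ℝ (regPotential σ φ δ) z (stdVec i) = gradPotential σ φ δ i z := by
  have hi : Integrable (fun y => (innerSL ℝ (gradG δ (z - y))).smulRight (φ y)) σ := by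
    have hc : Continuous fun y => innerSL ℝ (gradG δ (z - y)) :=
      (innerSL ℝ).continuous.comp
        ((continuous_gradG hδ.ne').comp (continuous_const.sub continuous_id))
    have hB : Continuous fun p : (Plane →L[ℝ] ℝ) × ℂ => p.1.smulRight p.2 :=
      ((ContinuousLinearMap.smulRightL ℝ Plane ℂ).continuous₂)
    refine Integrable.mono' (hφ.norm.const_mul δ⁻¹)
      (hB.comp_aestronglyMeasurable₂ hc.aestronglyMeasurable hφ.1) (Eventually.of_forall fun y => ?_)
    rw [ContinuousLinearMap.norm_smulRight_apply, innerSL_apply_norm]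
    exact mul_le_mul_of_nonneg_right (norm_gradG_le_const hδ _) (norm_nonneg _)
  rw [(hasFDerivAt_regPotential hΓ hσΓ hφ hδ z).fderiv, ContinuousLinearMap.integral_apply hi]
  refine integral_congr_ae (Eventually.of_forall fun y => ?_)
  simp only [ContinuousLinearMap.smulRight_apply, innerSL_apply_apply, inner_stdVec]

theorem contDiff_regPotential {Γ : Set Plane} (hΓ : IsCompact Γ) (hσΓ : ∀ᵐ y ∂σ, y ∈ Γ)
    {φ : Plane → ℂ} (hφ : Integrable φ σ) {δ : ℝ} (hδ : 0 < δ) :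
    ContDiff ℝ 1 (regPotential σ φ δ) := by
  rw [contDiff_one_iff_hasFDerivAt]
  refine ⟨_, ?_, fun z => hasFDerivAt_regPotential hΓ hσΓ hφ hδ z⟩
  have hB : Continuous fun p : (Plane →L[ℝ] ℝ) × ℂ => p.1.smulRight p.2 :=
    ((ContinuousLinearMap.smulRightL ℝ Plane ℂ).continuous₂)
  refine continuous_of_dominated (bound := fun y => δ⁻¹ * ‖φ y‖) ?_ ?_ (hφ.norm.const_mul _) ?_
  · intro z
    have hc : Continuous fun y => innerSL ℝ (gradG δ (z - y)) :=
      (innerSL ℝ).continuous.comp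
        ((continuous_gradG hδ.ne').comp (continuous_const.sub continuous_id))
    exact hB.comp_aestronglyMeasurable₂ hc.aestronglyMeasurable hφ.1
  · refine fun z => Eventually.of_forall fun y => ?_
    rw [ContinuousLinearMap.norm_smulRight_apply, innerSL_apply_norm]
    exact mul_le_mul_of_nonneg_right (norm_gradG_le_const hδ _) (norm_nonneg _)
  · refine Eventually.of_forall fun y => ?_
    have hc : Continuous fun z => innerSL ℝ (gradG δ (z - y)) :=
      (innerSL ℝ).continuous.comp
        ((continuous_gradG hδ.ne').comp (continuous_id.sub continuous_const))
    exact hB.comp (hc.prodMk continuous_const)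

end Potential

/-! ### Weak equations for the single layer potential of an eigenfunction -/

/-- The data needed for the energy estimates on the bounded set `A` with boundary `Γ`, boundary
measure `σ` and outward normal `n`. -/
structure IsNPData (A Γ : Set Plane) (σ : Measure Plane) (n : Plane → Plane) : Prop where
  measurableSet : MeasurableSet A
  isBounded : Bornology.IsBounded A
  isCompact : IsCompact Γ
  ae_mem : ∀ᵐ x ∂σ, x ∈ Γ
  isUpperRegular : IsUpperRegular σ
  measurable : Measurable n
  norm_le : ∀ x, ‖n x‖ ≤ 1
  isWeaklySingular : IsWeaklySingular n Γ Γ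
  isGaussGreen : IsGaussGreen A σ n
  hasBlowUpDensity : ∀ y ∈ Γ, HasBlowUpDensity A y (1 / 2)

section Fubini

variable {σ : Measure Plane} [IsFiniteMeasure σ]

theorem integrable_fderiv_gradG_mul {φ : Plane → ℂ} (hφ : Integrable φ σ) {w : Plane → ℂ}
    (hw : ContDiff ℝ 1 w) (hwc : HasCompactSupport w) (A : Set Plane) :
    Integrable (fun p : Plane × Plane => fderiv ℝ w p.1 (gradG 0 (p.1 - p.2)) * φ p.2)
      ((volume.restrict A).prod σ) := by
  obtain ⟨M', hM'⟩ := (hw.continuous_fderiv one_ne_zero).bounded_above_of_compact_support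
    (hwc.fderiv (𝕜 := ℝ))
  have hM0 : 0 ≤ M' := (norm_nonneg _).trans (hM' 0)
  have hK : IsCompact (tsupport w) := hwc
  have hg : Measurable fun p : Plane × Plane => gradG 0 (p.1 - p.2) :=
    (measurable_gradG 0).comp (measurable_fst.sub measurable_snd)
  have hd : Measurable fun p : Plane × Plane => fderiv ℝ w p.1 :=
    (hw.continuous_fderiv one_ne_zero).measurable.comp measurable_fst
  have happ : Continuous fun q : (Plane →L[ℝ] ℂ) × Plane => q.1 q.2 := by fun_prop
  have hFm : Measurable fun p : Plane × Plane => fderiv ℝ w p.1 (gradG 0 (p.1 - p.2)) :=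
    happ.measurable.comp (hd.prodMk hg)
  have h1 : Integrable (fun p : Plane × Plane => fderiv ℝ w p.1 (gradG 0 (p.1 - p.2)) * φ p.2)
      ((volume.restrict (tsupport w)).prod σ) := by
    refine Integrable.mono' ((integrable_prod_gradG hK hφ).const_mul M')
      (hFm.aestronglyMeasurable.mul hφ.1.comp_snd) (Eventually.of_forall fun p => ?_)
    rw [norm_mul, ← mul_assoc]
    refine mul_le_mul_of_nonneg_right ?_ (norm_nonneg _)
    exact (ContinuousLinearMap.le_opNorm _ _).trans
      (mul_le_mul_of_nonneg_right (hM' _) (norm_nonneg _))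
  have e : ∀ B : Set Plane, (volume.restrict B).prod σ =
      ((volume : Measure Plane).prod σ).restrict (B ×ˢ Set.univ) := fun B => by
    rw [← Measure.prod_restrict, Measure.restrict_univ]
  rw [e] at h1 ⊢
  have h2 := (integrableOn_iff_integrable_of_support_subset (s := tsupport w ×ˢ Set.univ) (by
    intro p hp
    refine ⟨?_, trivial⟩
    by_contra hz
    apply hp
    have : fderiv ℝ w p.1 = 0 :=
      image_eq_zero_of_notMem_tsupport (fun h => hz (tsupport_fderiv_subset ℝ h))
    simp only [this, zero_apply, zero_mul])).1 h1
  exact h2.restrict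

theorem clm_apply_eq_sum (L : Plane →L[ℝ] ℂ) (v : Plane) : L v = ∑ i, v i • L (stdVec i) := by
  conv_lhs => rw [eq_sum_stdVec v, map_sum]
  simp only [map_smul]

/-- Fubini's theorem for the pairing of a test function with a single layer potential. -/
theorem setIntegral_sum_fderiv_mul_gradPotential {φ : Plane → ℂ} (hφ : Integrable φ σ)
    {w : Plane → ℂ} (hw : ContDiff ℝ 1 w) (hwc : HasCompactSupport w) (A : Set Plane) :
    ∫ z in A, ∑ i, fderiv ℝ w z (stdVec i) * gradPotential σ φ 0 i z =
      ∫ y, (∫ z in A, fderiv ℝ w z (gradG 0 (z - y))) * φ y ∂σ := by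
  have hI := integrable_fderiv_gradG_mul hφ hw hwc A
  have hswap := integral_integral_swap
    (f := fun z y => fderiv ℝ w z (gradG 0 (z - y)) * φ y) hI
  simp_rw [integral_mul_const] at hswap
  rw [← hswap]
  refine integral_congr_ae ?_
  filter_upwards [ae_restrict_of_ae (ae_absPotential_lt_top hφ)] with z hz
  have hi := fun i => integrable_gradG_smul hφ.1 hz 0 i
  have h1 : ∀ i, fderiv ℝ w z (stdVec i) * gradPotential σ φ 0 i z =
      ∫ y, fderiv ℝ w z (stdVec i) * (gradG 0 (z - y) i • φ y) ∂σ := fun i =>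
    (integral_const_mul _ _).symm
  simp_rw [h1]
  rw [← integral_finsetSum _ fun i _ => (hi i).const_mul _]
  refine integral_congr_ae (Eventually.of_forall fun y => ?_)
  simp only
  rw [clm_apply_eq_sum, Finset.sum_mul]
  refine Finset.sum_congr rfl fun i _ => ?_
  rw [mul_smul_comm, smul_mul_assoc]

/-- The weak form of Δu = φσ on the whole plane: superpose ΔG = δ₀ over the charge distribution. -/
theorem integral_sum_fderiv_mul_gradPotential {φ : Plane → ℂ} (hφ : Integrable φ σ)
    {w : Plane → ℂ} (hw : ContDiff ℝ 1 w) (hwc : HasCompactSupport w) :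
    ∫ z, ∑ i, fderiv ℝ w z (stdVec i) * gradPotential σ φ 0 i z = -∫ y, w y * φ y ∂σ := by
  have := setIntegral_sum_fderiv_mul_gradPotential hφ hw hwc Set.univ
  simp only [Measure.restrict_univ] at this
  rw [this, ← integral_neg]
  refine integral_congr_ae (Eventually.of_forall fun y => ?_)
  simp only
  rw [integral_fderiv_gradG_zero y hw hwc, neg_mul]

end Fubini

section Eigen

variable {A Γ : Set Plane} {σ : Measure Plane} [IsFiniteMeasure σ] {n : Plane → Plane}

theorem IsNPData.integrable_dnG (h : IsNPData A Γ σ n) {y : Plane} (hy : y ∈ Γ) :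
    Integrable (fun x => dnG n 0 x y) σ := by
  obtain ⟨B, β, hB, hβ, hβ1, hk⟩ := h.isWeaklySingular
  obtain ⟨M, hM⟩ := h.isUpperRegular.exists_lintegral_le hβ hβ1
  refine ⟨(measurable_dnG h.measurable 0).of_uncurry_right.aestronglyMeasurable, ?_⟩
  refine (lintegral_enorm_le_of_weakly_singular (x := y) h.ae_mem (fun x hx => ?_)
    (hM y)).trans_lt (by finiteness)
  rw [norm_sub_rev]
  exact hk x hx y hy

theorem IsNPData.integrable_prod_dnG (h : IsNPData A Γ σ n) {φ w : Plane → ℂ}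
    (hφ : Integrable φ σ) (hw : Continuous w) (hwc : HasCompactSupport w) :
    Integrable (fun p : Plane × Plane => (dnG n 0 p.2 p.1 • w p.2) * φ p.1) (σ.prod σ) := by
  obtain ⟨M, hM⟩ := hw.bounded_above_of_compact_support hwc
  have hM0 : 0 ≤ M := (norm_nonneg _).trans (hM 0)
  obtain ⟨B, β, hB, hβ, hβ1, hk⟩ := h.isWeaklySingular
  obtain ⟨N, hN⟩ := h.isUpperRegular.exists_lintegral_le hβ hβ1
  have hd : Measurable fun p : Plane × Plane => dnG n 0 p.2 p.1 := by
    change Measurable (Function.uncurry (dnG n 0) ∘ Prod.swap)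
    exact (measurable_dnG h.measurable 0).comp measurable_swap
  have hw2 : Measurable fun p : Plane × Plane => w p.2 := hw.measurable.comp measurable_snd
  have hdw : Measurable fun p : Plane × Plane => dnG n 0 p.2 p.1 • w p.2 := hd.smul hw2
  have hm : AEStronglyMeasurable
      (fun p : Plane × Plane => (dnG n 0 p.2 p.1 • w p.2) * φ p.1) (σ.prod σ) :=
    hdw.aestronglyMeasurable.mul hφ.1.comp_fst
  refine ⟨hm, ?_⟩
  rw [hasFiniteIntegral_iff_enorm, lintegral_prod _ hm.enorm]
  have hb : ∀ᵐ y ∂σ, ∫⁻ x, ‖(dnG n 0 x y • w x) * φ y‖ₑ ∂σ ≤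
      (B.toNNReal * N : ℝ≥0) * ENNReal.ofReal M * ‖φ y‖ₑ := by
    filter_upwards [h.ae_mem] with y hy
    have h1 : ∫⁻ x, ‖dnG n 0 x y‖ₑ ∂σ ≤ (B.toNNReal * N : ℝ≥0) :=
      lintegral_enorm_le_of_weakly_singular (x := y) h.ae_mem (fun x hx => by
        rw [norm_sub_rev]; exact hk x hx y hy) (hN y)
    calc _ ≤ ∫⁻ x, ‖dnG n 0 x y‖ₑ * (ENNReal.ofReal M * ‖φ y‖ₑ) ∂σ := by
          refine lintegral_mono fun x => ?_
          rw [enorm_mul, enorm_smul, mul_assoc]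
          refine mul_le_mul_right (mul_le_mul_left ?_ _) _
          rw [← ofReal_norm]
          exact ENNReal.ofReal_le_ofReal (hM x)
      _ = (∫⁻ x, ‖dnG n 0 x y‖ₑ ∂σ) * (ENNReal.ofReal M * ‖φ y‖ₑ) :=
          lintegral_mul_const' _ _ (by finiteness)
      _ ≤ _ := by
          rw [mul_assoc]
          exact mul_le_mul_left h1 _
  refine (lintegral_mono_ae hb).trans_lt ?_
  rw [lintegral_const_mul' _ _ (by finiteness)]
  exact ENNReal.mul_lt_top (by finiteness) hφ.2

/-- The weak form of `∂u/∂n = (λ - 1/2) φ` from the inside of `A`, for the single layer potential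
`u` of an eigenfunction `φ`. -/
theorem IsNPData.setIntegral_eigen (h : IsNPData A Γ σ n) {φ : Plane → ℂ} (hφ : Integrable φ σ)
    {l : ℂ} (hl : ∀ᵐ x ∂σ, ∫ y, dnG n 0 x y • φ y ∂σ = l * φ x)
    {w : Plane → ℂ} (hw : ContDiff ℝ 1 w) (hwc : HasCompactSupport w) :
    ∫ z in A, ∑ i, fderiv ℝ w z (stdVec i) * gradPotential σ φ 0 i z =
      (l - 1 / 2) * ∫ y, w y * φ y ∂σ := by
  rw [setIntegral_sum_fderiv_mul_gradPotential hφ hw hwc A]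
  have hI := h.integrable_prod_dnG hφ hw.continuous hwc
  have hwφ : Integrable (fun y => w y * φ y) σ := by
    obtain ⟨M, hM⟩ := hw.continuous.bounded_above_of_compact_support hwc
    exact hφ.bdd_mul hw.continuous.aestronglyMeasurable (Eventually.of_forall hM)
  calc ∫ y, (∫ z in A, fderiv ℝ w z (gradG 0 (z - y))) * φ y ∂σ
      = ∫ y, ((∫ x, (dnG n 0 x y • w x) * φ y ∂σ) - 1 / 2 * (w y * φ y)) ∂σ := by
        refine integral_congr_ae ?_
        filter_upwards [h.ae_mem] with y hy
        rw [setIntegral_fderiv_gradG_zero h.measurableSet h.measurable h.norm_le h.isGaussGreen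
          (h.hasBlowUpDensity y hy) (h.integrable_dnG hy) hw hwc, sub_mul, integral_mul_const,
          Complex.real_smul]
        push_cast
        ring
    _ = (∫ y, ∫ x, (dnG n 0 x y • w x) * φ y ∂σ ∂σ) - ∫ y, 1 / 2 * (w y * φ y) ∂σ :=
        integral_sub hI.integral_prod_left (hwφ.const_mul _)
    -- Exchanging the order of integration moves the kernel from w onto φ, so that the eigenvalue
    -- equation becomes applicable.
    _ = (∫ x, w x * ∫ y, dnG n 0 x y • φ y ∂σ ∂σ) - ∫ y, 1 / 2 * (w y * φ y) ∂σ := by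
        rw [integral_integral_swap hI]
        congr 1
        refine integral_congr_ae (Eventually.of_forall fun x => ?_)
        simp only
        rw [← integral_const_mul]
        refine integral_congr_ae (Eventually.of_forall fun y => ?_)
        simp only [Complex.real_smul]
        ring
    _ = (∫ x, l * (w x * φ x) ∂σ) - ∫ y, 1 / 2 * (w y * φ y) ∂σ := by
        congr 1
        refine integral_congr_ae ?_
        filter_upwards [hl] with x hx
        rw [hx]; ring
    _ = _ := by
        rw [integral_const_mul, integral_const_mul]; ring

end Eigen

/-! ### Smooth cutoffs at scale R -/

/-- A fixed smooth bump function which is one on the unit ball and is supported in the ball of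
radius two. -/
def unitBump : ContDiffBump (0 : Plane) := ⟨1, 2, one_pos, one_lt_two⟩

/-- A smooth cutoff which is one on the ball of radius `R` and is supported in the ball of radius
`2 * R`. -/
def cutoff (R : ℝ) (z : Plane) : ℝ := unitBump (R⁻¹ • z)

theorem contDiff_cutoff (R : ℝ) : ContDiff ℝ 1 (cutoff R) :=
  unitBump.contDiff.comp (contDiff_id.const_smul R⁻¹)

theorem cutoff_nonneg (R : ℝ) (z : Plane) : 0 ≤ cutoff R z := unitBump.nonneg

theorem cutoff_le_one (R : ℝ) (z : Plane) : cutoff R z ≤ 1 := unitBump.le_one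

theorem norm_inv_smul {R : ℝ} (hR : 0 < R) (z : Plane) : ‖R⁻¹ • z‖ = ‖z‖ / R := by
  rw [norm_smul, norm_inv, Real.norm_of_nonneg hR.le]; field_simp

theorem cutoff_eq_one {R : ℝ} (hR : 0 < R) {z : Plane} (hz : ‖z‖ ≤ R) : cutoff R z = 1 := by
  refine unitBump.one_of_mem_closedBall ?_
  rw [mem_closedBall_zero_iff, norm_inv_smul hR]
  exact (div_le_one hR).2 hz

theorem cutoff_eq_zero {R : ℝ} (hR : 0 < R) {z : Plane} (hz : 2 * R ≤ ‖z‖) : cutoff R z = 0 := by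
  refine unitBump.zero_of_le_dist ?_
  rw [dist_zero_right, norm_inv_smul hR]
  exact (le_div_iff₀ hR).2 hz

theorem hasCompactSupport_cutoff {R : ℝ} (hR : 0 < R) : HasCompactSupport (cutoff R) := by
  refine HasCompactSupport.intro (isCompact_closedBall (0 : Plane) (2 * R)) fun z hz => ?_
  rw [mem_closedBall_zero_iff, not_le] at hz
  exact cutoff_eq_zero hR hz.le

theorem fderiv_cutoff_eq_zero_of_lt {R : ℝ} (hR : 0 < R) {z : Plane} (hz : ‖z‖ < R) :
    fderiv ℝ (cutoff R) z = 0 := by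
  have : cutoff R =ᶠ[𝓝 z] fun _ => 1 := by
    filter_upwards [(isOpen_lt continuous_norm continuous_const).mem_nhds hz] with x hx
    exact cutoff_eq_one hR (le_of_lt hx)
  rw [this.fderiv_eq, fderiv_fun_const, Pi.zero_apply]

theorem fderiv_cutoff_eq_zero_of_gt {R : ℝ} (hR : 0 < R) {z : Plane} (hz : 2 * R < ‖z‖) :
    fderiv ℝ (cutoff R) z = 0 := by
  have : cutoff R =ᶠ[𝓝 z] fun _ => 0 := by
    filter_upwards [(isOpen_lt continuous_const continuous_norm).mem_nhds hz] with x hx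
    exact cutoff_eq_zero hR (le_of_lt hx)
  rw [this.fderiv_eq, fderiv_fun_const, Pi.zero_apply]

theorem exists_norm_fderiv_cutoff_le :
    ∃ C : ℝ, 0 ≤ C ∧ ∀ R > 0, ∀ z, ‖fderiv ℝ (cutoff R) z‖ ≤ C / R := by
  have hc : ContDiff ℝ 1 unitBump := unitBump.contDiff
  obtain ⟨C, hC⟩ := (hc.continuous_fderiv one_ne_zero).bounded_above_of_compact_support
    (unitBump.hasCompactSupport.fderiv (𝕜 := ℝ))
  refine ⟨C, (norm_nonneg _).trans (hC 0), fun R hR z => ?_⟩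
  have h1 : HasFDerivAt (fun z : Plane => R⁻¹ • z) (R⁻¹ • ContinuousLinearMap.id ℝ Plane) z :=
    (hasFDerivAt_id z).const_smul R⁻¹
  have h2 : HasFDerivAt (cutoff R) ((fderiv ℝ unitBump (R⁻¹ • z)).comp
      (R⁻¹ • ContinuousLinearMap.id ℝ Plane)) z :=
    HasFDerivAt.comp (g := unitBump) z (hc.differentiable one_ne_zero _).hasFDerivAt h1
  rw [h2.fderiv, ContinuousLinearMap.comp_smul, ContinuousLinearMap.comp_id, norm_smul, norm_inv,
    Real.norm_of_nonneg hR.le, div_eq_inv_mul]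
  exact mul_le_mul_of_nonneg_left (hC _) (by positivity)

theorem norm_stdVec (i : Fin 2) : ‖stdVec i‖ = 1 := by simp [stdVec]

/-! ### Energy density and its regularisation -/

section Energy

variable {σ : Measure Plane}

/-- The energy density `|∇u|²` of a single layer potential. -/
def energyDensity (σ : Measure Plane) (φ : Plane → ℂ) (z : Plane) : ℝ :=
  ∑ i, ‖gradPotential σ φ 0 i z‖ ^ 2

theorem energyDensity_nonneg (φ : Plane → ℂ) (z : Plane) : 0 ≤ energyDensity σ φ z :=
  Finset.sum_nonneg fun _ _ => by positivity

theorem gradPotential_conj (φ : Plane → ℂ) (δ : ℝ) (i : Fin 2) (z : Plane) :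
    gradPotential σ (fun y => starRingEnd ℂ (φ y)) δ i z =
      starRingEnd ℂ (gradPotential σ φ δ i z) := by
  unfold gradPotential
  rw [← integral_conj]
  refine integral_congr_ae (Eventually.of_forall fun y => ?_)
  simp

theorem norm_gradPotential_le {φ : Plane → ℂ} (δ : ℝ) (i : Fin 2) {z : Plane}
    (hz : absPotential σ φ z < ∞) : ‖gradPotential σ φ δ i z‖ ≤ (absPotential σ φ z).toReal := by
  rw [← toReal_enorm]
  exact ENNReal.toReal_mono hz.ne (enorm_gradPotential_le φ δ i z)

theorem sum_conj_mul_self (φ : Plane → ℂ) (z : Plane) :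
    ∑ i, starRingEnd ℂ (gradPotential σ φ 0 i z) * gradPotential σ φ 0 i z =
      (energyDensity σ φ z : ℂ) := by
  unfold energyDensity
  push_cast
  exact Finset.sum_congr rfl fun i _ => Complex.conj_mul' _

variable [IsFiniteMeasure σ]

theorem integrable_absPotential_sq (hσ : IsUpperRegular σ) {φ : Plane → ℂ} (hφ : MemLp φ 2 σ)
    {K : Set Plane} (hK : IsCompact K) {μ : Measure Plane} (hμ : μ ≤ volume.restrict K) :
    Integrable (fun z => (absPotential σ φ z).toReal ^ 2) μ := by
  refine Integrable.mono_measure ?_ hμ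
  have := integrable_toReal_of_lintegral_ne_top
    ((aemeasurable_absPotential hφ.1 (volume.restrict K)).pow_const 2)
    (lintegral_absPotential_sq_lt_top hσ hK hφ).ne
  simpa [ENNReal.toReal_pow] using this

theorem ae_norm_mul_gradPotential_le {φ : Plane → ℂ} (hφ : Integrable φ σ) {K : Set Plane}
    {μ : Measure Plane} (hμ : μ ≤ volume.restrict K) {χ : Plane → ℝ} (hχ0 : ∀ z, 0 ≤ χ z)
    (hχ1 : ∀ z, χ z ≤ 1) (δ : ℝ) :
    ∀ᵐ z ∂μ, ‖χ z • ∑ i, starRingEnd ℂ (gradPotential σ φ δ i z) * gradPotential σ φ 0 i z‖ ≤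
      2 * (absPotential σ φ z).toReal ^ 2 := by
  have hac : μ ≪ volume := (Measure.absolutelyContinuous_of_le hμ).trans
    Measure.restrict_le_self.absolutelyContinuous
  filter_upwards [hac.ae_le (ae_absPotential_lt_top hφ)] with z hz
  rw [norm_smul, Real.norm_of_nonneg (hχ0 z)]
  refine (mul_le_of_le_one_left (norm_nonneg _) (hχ1 z)).trans ?_
  refine (norm_sum_le _ _).trans ?_
  rw [Fin.sum_univ_two, two_mul]
  gcongr <;>
  · rw [norm_mul, RCLike.norm_conj, sq]
    exact mul_le_mul (norm_gradPotential_le _ _ hz) (norm_gradPotential_le _ _ hz) (norm_nonneg _)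
      ENNReal.toReal_nonneg

theorem aestronglyMeasurable_energy {φ : Plane → ℂ} (hφ : AEStronglyMeasurable φ σ)
    {μ : Measure Plane} [SFinite μ] {χ : Plane → ℝ} (hχ : Measurable χ) (δ : ℝ) :
    AEStronglyMeasurable (fun z => χ z • ∑ i, starRingEnd ℂ (gradPotential σ φ δ i z) *
      gradPotential σ φ 0 i z) μ := by
  refine hχ.aestronglyMeasurable.smul ?_
  refine Finset.aestronglyMeasurable_fun_sum _ fun i _ => ?_
  exact (RCLike.continuous_conj.comp_aestronglyMeasurable
    (aestronglyMeasurable_gradPotential hφ δ i μ)).mul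
    (aestronglyMeasurable_gradPotential hφ 0 i μ)

theorem integrable_energy (hσ : IsUpperRegular σ) {φ : Plane → ℂ} (hφ : MemLp φ 2 σ)
    {K : Set Plane} (hK : IsCompact K) {μ : Measure Plane} [SFinite μ]
    (hμ : μ ≤ volume.restrict K)
    {χ : Plane → ℝ} (hχ : Measurable χ) (hχ0 : ∀ z, 0 ≤ χ z) (hχ1 : ∀ z, χ z ≤ 1) (δ : ℝ) :
    Integrable (fun z => χ z • ∑ i, starRingEnd ℂ (gradPotential σ φ δ i z) *
      gradPotential σ φ 0 i z) μ :=
  Integrable.mono' ((integrable_absPotential_sq hσ hφ hK hμ).const_mul 2)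
    (aestronglyMeasurable_energy hφ.1 hχ δ)
    (ae_norm_mul_gradPotential_le (hφ.integrable one_le_two) hμ hχ0 hχ1 δ)

theorem integrable_mul_energyDensity (hσ : IsUpperRegular σ) {φ : Plane → ℂ} (hφ : MemLp φ 2 σ)
    {K : Set Plane} (hK : IsCompact K) {μ : Measure Plane} [SFinite μ]
    (hμ : μ ≤ volume.restrict K)
    {χ : Plane → ℝ} (hχ : Measurable χ) (hχ0 : ∀ z, 0 ≤ χ z) (hχ1 : ∀ z, χ z ≤ 1) :
    Integrable (fun z => χ z * energyDensity σ φ z) μ := by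
  have := (integrable_energy hσ hφ hK hμ hχ hχ0 hχ1 0).re
  refine this.congr (Eventually.of_forall fun z => ?_)
  simp only [sum_conj_mul_self]
  simp

/-- Only one gradient is regularised: testing the equation for u with conj(u_δ) produces exactly
this mixed product. It is dominated by 2 `absPotential`², with one summand for each coordinate. -/
theorem tendsto_integral_energy (hσ : IsUpperRegular σ) {φ : Plane → ℂ} (hφ : MemLp φ 2 σ)
    {K : Set Plane} (hK : IsCompact K) {μ : Measure Plane} [SFinite μ]
    (hμ : μ ≤ volume.restrict K)
    {χ : Plane → ℝ} (hχ : Measurable χ) (hχ0 : ∀ z, 0 ≤ χ z) (hχ1 : ∀ z, χ z ≤ 1) :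
    Tendsto (fun δ => ∫ z, χ z • ∑ i, starRingEnd ℂ (gradPotential σ φ δ i z) *
      gradPotential σ φ 0 i z ∂μ) (𝓝[>] 0) (𝓝 ((∫ z, χ z * energyDensity σ φ z ∂μ : ℝ) : ℂ)) := by
  have hac : μ ≪ volume := (Measure.absolutelyContinuous_of_le hμ).trans
    Measure.restrict_le_self.absolutelyContinuous
  have hint : Integrable φ σ := hφ.integrable one_le_two
  rw [← integral_complex_ofReal]
  refine tendsto_integral_filter_of_dominated_convergence
    (fun z => 2 * (absPotential σ φ z).toReal ^ 2) ?_ ?_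
    ((integrable_absPotential_sq hσ hφ hK hμ).const_mul 2) ?_
  · exact Eventually.of_forall fun δ => aestronglyMeasurable_energy hφ.1 hχ δ
  · exact Eventually.of_forall fun δ => ae_norm_mul_gradPotential_le hint hμ hχ0 hχ1 δ
  · filter_upwards [hac.ae_le (ae_absPotential_lt_top hint)] with z hz
    have e : ((χ z * energyDensity σ φ z : ℝ) : ℂ) =
        χ z • ∑ i, starRingEnd ℂ (gradPotential σ φ 0 i z) * gradPotential σ φ 0 i z := by
      rw [sum_conj_mul_self, Complex.real_smul]; push_cast; rfl
    rw [e]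
    refine Tendsto.const_smul (tendsto_finsetSum _ fun i _ => ?_) _
    exact ((RCLike.continuous_conj.tendsto _).comp (tendsto_gradPotential hφ.1 hz i)).mul_const _

end Energy

/-! ### Decay at infinity for densities of mean zero -/

section Decay

variable {σ : Measure Plane}

theorem norm_gradG_le_of_far {R : ℝ} (hR : 0 < R) {z : Plane} (hz : R / 2 ≤ ‖z‖) (δ : ℝ) :
    ‖gradG δ z‖ ≤ 1 / R := by
  refine (norm_gradG_le δ z).trans ?_
  have hpi := Real.pi_gt_three
  have hz0 : 0 < ‖z‖ := lt_of_lt_of_le (by positivity) hz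
  rw [norm_gradG_zero, ← mul_inv, one_div]
  refine inv_anti₀ hR ?_
  nlinarith

theorem norm_gradPotential_le_of_far {φ : Plane → ℂ} (hφ : Integrable φ σ) {R₀ R : ℝ}
    (hσ : ∀ᵐ y ∂σ, ‖y‖ ≤ R₀) (hR : 0 < R) (hR₀ : 2 * R₀ ≤ R) {z : Plane} (hz : R ≤ ‖z‖) (δ : ℝ)
    (i : Fin 2) : ‖gradPotential σ φ δ i z‖ ≤ 1 / R * ∫ y, ‖φ y‖ ∂σ := by
  rw [← integral_const_mul]
  refine norm_integral_le_of_norm_le (hφ.norm.const_mul _) ?_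
  filter_upwards [hσ] with y hy
  rw [norm_smul]
  refine mul_le_mul_of_nonneg_right ?_ (norm_nonneg _)
  refine (PiLp.norm_apply_le _ _).trans (norm_gradG_le_of_far hR ?_ δ)
  have := norm_sub_norm_le z y
  linarith

/-- Mean zero permits subtracting G_δ(z) from the kernel, which removes the logarithmic growth. The
mean value inequality on the ball of radius R₀ around z, where the gradient is at most 1/R, gives
R₀/R uniformly in δ. -/
theorem norm_regPotential_le_of_far [IsFiniteMeasure σ] {Γ : Set Plane} (hΓ : IsCompact Γ) (hσΓ : ∀ᵐ y ∂σ, y ∈ Γ)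
    {φ : Plane → ℂ} (hφ : Integrable φ σ) (h0 : ∫ y, φ y ∂σ = 0) {R₀ R : ℝ}
    (hσ : ∀ᵐ y ∂σ, ‖y‖ ≤ R₀) (hR : 0 < R) (hR₀ : 2 * R₀ ≤ R) {z : Plane} (hz : R ≤ ‖z‖) {δ : ℝ}
    (hδ : 0 < δ) : ‖regPotential σ φ δ z‖ ≤ R₀ / R * ∫ y, ‖φ y‖ ∂σ := by
  have e : regPotential σ φ δ z = ∫ y, (regG δ (z - y) - regG δ z) • φ y ∂σ := by
    have hi : Integrable (fun y => regG δ z • φ y) σ := hφ.smul (regG δ z)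
    simp_rw [sub_smul]
    rw [integral_sub (integrable_regG_smul hΓ hσΓ hφ hδ.ne' z) hi, integral_smul, h0, smul_zero, sub_zero]
    rfl
  rw [e, ← integral_const_mul]
  refine norm_integral_le_of_norm_le (hφ.norm.const_mul _) ?_
  filter_upwards [hσ] with y hy
  rw [norm_smul]
  refine mul_le_mul_of_nonneg_right ?_ (norm_nonneg _)
  have hR₀0 : 0 ≤ R₀ := (norm_nonneg y).trans hy
  have hb : ∀ p ∈ Metric.closedBall z R₀, ‖innerSL ℝ (gradG δ p)‖ ≤ 1 / R := by
    intro p hp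
    rw [innerSL_apply_norm]
    refine norm_gradG_le_of_far hR ?_ δ
    rw [Metric.mem_closedBall, dist_comm, dist_eq_norm] at hp
    have := norm_sub_norm_le z p
    linarith
  have := (convex_closedBall z R₀).norm_image_sub_le_of_norm_hasFDerivWithin_le
    (fun p _ => (hasFDerivAt_regG hδ.ne' p).hasFDerivWithinAt) hb
    (Metric.mem_closedBall_self hR₀0) (y := z - y) (by simpa [dist_eq_norm] using hy)
  refine this.trans ?_
  rw [sub_sub_cancel_left, norm_neg, div_mul_eq_mul_div, one_mul]
  gcongr

/-- The error made by the cutoff in the energy identity is small. -/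
theorem exists_cutoff_error_le [IsFiniteMeasure σ] {Γ : Set Plane} (hΓ : IsCompact Γ) (hσΓ : ∀ᵐ y ∂σ, y ∈ Γ)
    {φ ψ : Plane → ℂ} (hφ : Integrable φ σ) (hψ : Integrable ψ σ) (h0 : ∫ y, ψ y ∂σ = 0) {R₀ : ℝ}
    (hR₀ : 0 ≤ R₀) (hσ : ∀ᵐ y ∂σ, ‖y‖ ≤ R₀) :
    ∃ C : ℝ, ∀ R > 0, 2 * R₀ ≤ R → ∀ δ > 0,
      Integrable (fun z => ∑ i, (fderiv ℝ (cutoff R) z (stdVec i) • regPotential σ ψ δ z) *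
        gradPotential σ φ 0 i z) ∧
      ‖∫ z, ∑ i, (fderiv ℝ (cutoff R) z (stdVec i) • regPotential σ ψ δ z) *
        gradPotential σ φ 0 i z‖ ≤ C / R := by
  obtain ⟨C, hC0, hC⟩ := exists_norm_fderiv_cutoff_le
  let N := ∫ y, ‖φ y‖ ∂σ
  let N' := ∫ y, ‖ψ y‖ ∂σ
  have hN : 0 ≤ N := integral_nonneg fun _ => norm_nonneg _
  have hN' : 0 ≤ N' := integral_nonneg fun _ => norm_nonneg _
  -- The pointwise bound 2 (C/R)(R₀N'/R)(N/R) is multiplied by the area π(2R)² of the ball that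
  -- contains the support.
  refine ⟨8 * Real.pi * (C * R₀ * N' * N), fun R hR h2R δ hδ => ?_⟩
  let b : ℝ := 2 * ((C / R) * (R₀ / R * N') * (1 / R * N))
  have hb0 : 0 ≤ b := by positivity
  have hbound : ∀ z, ‖∑ i, (fderiv ℝ (cutoff R) z (stdVec i) • regPotential σ ψ δ z) *
        gradPotential σ φ 0 i z‖ ≤ (Metric.closedBall (0 : Plane) (2 * R)).indicator (fun _ => b) z := by
    intro z
    rcases lt_or_ge (2 * R) ‖z‖ with hz | hz
    · rw [fderiv_cutoff_eq_zero_of_gt hR hz]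
      simp only [zero_apply, zero_smul, zero_mul, Finset.sum_const_zero, norm_zero]
      exact Set.indicator_nonneg (fun _ _ => hb0) _
    rw [Set.indicator_of_mem (by simpa using hz)]
    rcases lt_or_ge ‖z‖ R with hz' | hz'
    · rw [fderiv_cutoff_eq_zero_of_lt hR hz']
      simpa using hb0
    refine (norm_sum_le _ _).trans ?_
    rw [Fin.sum_univ_two]
    have hi : ∀ i, ‖(fderiv ℝ (cutoff R) z (stdVec i) • regPotential σ ψ δ z) *
        gradPotential σ φ 0 i z‖ ≤ (C / R) * (R₀ / R * N') * (1 / R * N) := by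
      intro i
      rw [norm_mul, norm_smul]
      have h1 : ‖fderiv ℝ (cutoff R) z (stdVec i)‖ ≤ C / R := by
        refine (ContinuousLinearMap.le_opNorm _ _).trans ?_
        rw [norm_stdVec, mul_one]
        exact hC R hR z
      have h2 := norm_regPotential_le_of_far hΓ hσΓ hψ h0 hσ hR h2R hz' hδ
      have h3 := norm_gradPotential_le_of_far hφ hσ hR h2R hz' 0 i
      exact mul_le_mul (mul_le_mul h1 h2 (norm_nonneg _) (by positivity)) h3 (norm_nonneg _)
        (by positivity)
    linarith [hi 0, hi 1]
  have hbi : Integrable ((Metric.closedBall (0 : Plane) (2 * R)).indicator fun _ => b) := by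
    rw [integrable_indicator_iff measurableSet_closedBall]
    exact integrableOn_const (isCompact_closedBall _ _).measure_lt_top.ne
  constructor
  · refine Integrable.mono' hbi ?_ (Eventually.of_forall hbound)
    refine Finset.aestronglyMeasurable_fun_sum _ fun i _ => ?_
    refine AEStronglyMeasurable.mul ?_ (aestronglyMeasurable_gradPotential hφ.1 0 i _)
    have h1 : Continuous fun z => fderiv ℝ (cutoff R) z (stdVec i) :=
      ((contDiff_cutoff R).continuous_fderiv one_ne_zero).clm_apply continuous_const
    have h2 : Continuous (regPotential σ ψ δ) := (contDiff_regPotential hΓ hσΓ hψ hδ).continuous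
    exact (h1.smul h2).aestronglyMeasurable
  · refine (norm_integral_le_of_norm_le hbi (Eventually.of_forall hbound)).trans ?_
    rw [integral_indicator measurableSet_closedBall, setIntegral_const, Measure.real,
      EuclideanSpace.volume_closedBall_fin_two, ENNReal.toReal_mul, ENNReal.toReal_pow,
      ENNReal.toReal_ofReal (by positivity)]
    rw [ENNReal.toReal_ofReal Real.pi_pos.le, smul_eq_mul]
    refine le_of_eq ?_
    simp only [b]
    field_simp
    ring

end Decay

/-! ### Energy identities and location of the eigenvalues -/

section

variable {A Γ : Set Plane} {σ : Measure Plane} {n : Plane → Plane}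
  {φ : Plane → ℂ} {l : ℂ}

theorem fderiv_cutoff_smul {ψ : Plane → ℂ} (hΓ : IsCompact Γ) (hσΓ : ∀ᵐ y ∂σ, y ∈ Γ)
    (hψ : Integrable ψ σ) (R : ℝ) {δ : ℝ} (hδ : 0 < δ) (z : Plane) (i : Fin 2) :
    fderiv ℝ (fun z => cutoff R z • regPotential σ ψ δ z) z (stdVec i) =
      cutoff R z • gradPotential σ ψ δ i z +
        fderiv ℝ (cutoff R) z (stdVec i) • regPotential σ ψ δ z := by
  have h1 : HasFDerivAt (cutoff R) (fderiv ℝ (cutoff R) z) z :=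
    ((contDiff_cutoff R).differentiable one_ne_zero z).hasFDerivAt
  have h2 : HasFDerivAt (regPotential σ ψ δ) (fderiv ℝ (regPotential σ ψ δ) z) z :=
    ((contDiff_regPotential hΓ hσΓ hψ hδ).differentiable one_ne_zero z).hasFDerivAt
  have h3 : fderiv ℝ (fun z => cutoff R z • regPotential σ ψ δ z) z = _ := (h1.smul h2).fderiv
  rw [h3, ← fderiv_regPotential hΓ hσΓ hψ hδ]
  simp

variable [IsFiniteMeasure σ]

/-- An eigenfunction for an eigenvalue other than `1 / 2` has mean zero. -/
theorem IsNPData.integral_eq_zero (h : IsNPData A Γ σ n) (hφ : Integrable φ σ)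
    (hl : ∀ᵐ x ∂σ, ∫ y, dnG n 0 x y • φ y ∂σ = l * φ x) (hl2 : l ≠ 1 / 2) :
    ∫ y, φ y ∂σ = 0 := by
  -- The test function is 1 near every point of A, so its gradient drops out of the left-hand side,
  -- and it is 1 on Γ. What remains is (l - 1/2) ∫ φ dσ = 0.
  obtain ⟨R₀, hR₀, hb⟩ := (h.isBounded.union h.isCompact.isBounded).exists_pos_norm_lt
  let w : Plane → ℂ := fun z => (cutoff R₀ z : ℂ)
  have hw : ContDiff ℝ 1 w := Complex.ofRealCLM.contDiff.comp (contDiff_cutoff R₀)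
  have hwc : HasCompactSupport w := (hasCompactSupport_cutoff hR₀).comp_left Complex.ofReal_zero
  have hI := h.setIntegral_eigen hφ hl hw hwc
  have h1 : ∫ z in A, ∑ i, fderiv ℝ w z (stdVec i) * gradPotential σ φ 0 i z = 0 := by
    refine setIntegral_eq_zero_of_forall_eq_zero fun z hz => ?_
    have hz' : ‖z‖ < R₀ := hb z (Or.inl hz)
    have : w =ᶠ[𝓝 z] fun _ => 1 := by
      filter_upwards [(isOpen_lt continuous_norm continuous_const).mem_nhds hz'] with x hx
      simp only [w]
      rw [cutoff_eq_one hR₀ (le_of_lt hx), Complex.ofReal_one]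
    rw [this.fderiv_eq, fderiv_fun_const]
    simp
  have h2 : ∫ y, w y * φ y ∂σ = ∫ y, φ y ∂σ := by
    refine integral_congr_ae ?_
    filter_upwards [h.ae_mem] with y hy
    simp only [w]
    rw [cutoff_eq_one hR₀ (hb y (Or.inr hy)).le, Complex.ofReal_one, one_mul]
  rw [h1, h2, eq_comm, mul_eq_zero] at hI
  exact hI.resolve_left (sub_ne_zero.2 hl2)

/-- The energy identities for a single layer potential whose density is an eigenfunction. -/
theorem IsNPData.exists_energy (h : IsNPData A Γ σ n) (hφ : MemLp φ 2 σ)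
    (hl : ∀ᵐ x ∂σ, ∫ y, dnG n 0 x y • φ y ∂σ = l * φ x) (hl2 : l ≠ 1 / 2) :
    ∃ (a : ℂ) (R₁ C : ℝ), 0 < R₁ ∧
      (l - 1 / 2) * a = ((∫ z in A, energyDensity σ φ z : ℝ) : ℂ) ∧
      ∀ R ≥ R₁, ∫ z in A, energyDensity σ φ z ≤ ∫ z, cutoff R z * energyDensity σ φ z ∧
        ‖((∫ z, cutoff R z * energyDensity σ φ z : ℝ) : ℂ) + a‖ ≤ C / R := by
  have hint : Integrable φ σ := hφ.integrable one_le_two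
  let ψ : Plane → ℂ := fun y => starRingEnd ℂ (φ y)
  have hψ : Integrable ψ σ :=
    ⟨RCLike.continuous_conj.comp_aestronglyMeasurable hint.1, by
      refine hint.2.mono (Eventually.of_forall fun y => ?_)
      simp [ψ]⟩
  have h0 : ∫ y, ψ y ∂σ = 0 := by
    have := h.integral_eq_zero hint hl hl2
    simp only [ψ]
    rw [integral_conj, this, map_zero]
  obtain ⟨R₀, hR₀, hb⟩ := (h.isBounded.union h.isCompact.isBounded).exists_pos_norm_lt
  have hbσ : ∀ᵐ y ∂σ, ‖y‖ ≤ R₀ := by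
    filter_upwards [h.ae_mem] with y hy using (hb y (Or.inr hy)).le
  obtain ⟨C, hC⟩ := exists_cutoff_error_le h.isCompact h.ae_mem hint hψ h0 hR₀.le hbσ
  let P : ℝ := ∫ z in A, energyDensity σ φ z
  -- This stands for ∫ conj(u) φ dσ. Defining it through the interior identity avoids any discussion
  -- of the boundary values of the logarithmic potential; it will appear as the limit of the
  -- regularised pairings `aδ`.
  let a : ℂ := P / (l - 1 / 2)
  have hl' : l - 1 / 2 ≠ 0 := sub_ne_zero.2 hl2
  refine ⟨a, 2 * R₀, C, by positivity, mul_div_cancel₀ _ hl', fun R hR => ?_⟩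
  have hR0 : 0 < R := lt_of_lt_of_le (by positivity) hR
  have hRR : R₀ < R := by linarith
  let K : Set Plane := Metric.closedBall 0 (2 * R)
  have hK : IsCompact K := isCompact_closedBall _ _
  have hAK : A ⊆ K := fun z hz => by
    have := hb z (Or.inl hz)
    simp only [K, mem_closedBall_zero_iff]
    linarith
  have hμA : volume.restrict A ≤ volume.restrict K := Measure.restrict_mono hAK le_rfl
  have hχ : Measurable (cutoff R) := (contDiff_cutoff R).continuous.measurable
  have hχ0 := cutoff_nonneg R
  have hχ1 := cutoff_le_one R
  have hsupp : ∀ f : Plane → ℂ, (∀ z, z ∉ K → f z = 0) → ∫ z in K, f z = ∫ z, f z := fun f hf =>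
    setIntegral_eq_integral_of_forall_compl_eq_zero hf
  have hcutK : ∀ z ∉ K, cutoff R z = 0 := fun z hz => by
    simp only [K, mem_closedBall_zero_iff, not_le] at hz
    exact cutoff_eq_zero hR0 hz.le
  have hcutA : ∀ z ∈ A, cutoff R z = 1 := fun z hz =>
    cutoff_eq_one hR0 ((hb z (Or.inl hz)).le.trans hRR.le)
  let aδ : ℝ → ℂ := fun δ => ∫ y, regPotential σ ψ δ y * φ y ∂σ
  let E : ℝ → Plane → ℂ := fun δ z => cutoff R z • ∑ i, starRingEnd ℂ (gradPotential σ φ δ i z) *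
      gradPotential σ φ 0 i z
  let err : ℝ → Plane → ℂ := fun δ z => ∑ i,
    (fderiv ℝ (cutoff R) z (stdVec i) • regPotential σ ψ δ z) * gradPotential σ φ 0 i z
  -- The test function is χ_R conj(u_δ), the potential of ψ = conj φ being the conjugate one. Its
  -- gradient splits into the energy integrand `E` and the cutoff error `err`.
  have hw : ∀ δ > 0, ContDiff ℝ 1 fun z => cutoff R z • regPotential σ ψ δ z := fun δ hδ =>
    (contDiff_cutoff R).smul (contDiff_regPotential h.isCompact h.ae_mem hψ hδ)
  have hwc : ∀ δ, HasCompactSupport fun z => cutoff R z • regPotential σ ψ δ z := fun δ =>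
    HasCompactSupport.smul_right (f := cutoff R) (hasCompactSupport_cutoff hR0)
  have hpt : ∀ δ > 0, ∀ z, ∑ i, fderiv ℝ (fun z => cutoff R z • regPotential σ ψ δ z) z (stdVec i) *
      gradPotential σ φ 0 i z = E δ z + err δ z := by
    intro δ hδ z
    simp only [E, err, Finset.smul_sum]
    rw [← Finset.sum_add_distrib]
    refine Finset.sum_congr rfl fun i _ => ?_
    rw [fderiv_cutoff_smul h.isCompact h.ae_mem hψ R hδ, gradPotential_conj, add_mul,
      smul_mul_assoc]
  have haδ : ∀ δ, ∫ y, (cutoff R y • regPotential σ ψ δ y) * φ y ∂σ = aδ δ := fun δ => by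
    refine integral_congr_ae ?_
    filter_upwards [hbσ] with y hy
    rw [cutoff_eq_one hR0 (hy.trans hRR.le), one_smul]
  -- On A the cutoff is locally 1, so the interior identity carries no error term.
  have hin : ∀ δ > 0, ∫ z in A, E δ z = (l - 1 / 2) * aδ δ := by
    intro δ hδ
    rw [← haδ, ← h.setIntegral_eigen hint hl (hw δ hδ) (hwc δ)]
    refine setIntegral_congr_fun h.measurableSet fun z hz => ?_
    rw [hpt δ hδ]
    have : fderiv ℝ (cutoff R) z = 0 :=
      fderiv_cutoff_eq_zero_of_lt hR0 ((hb z (Or.inl hz)).trans hRR)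
    simp only [err, this, zero_apply, zero_smul, zero_mul, Finset.sum_const_zero, add_zero]
  have hEint : ∀ δ, Integrable (E δ) := fun δ => by
    have h1 : IntegrableOn (E δ) K :=
      integrable_energy h.isUpperRegular hφ hK le_rfl hχ hχ0 hχ1 δ
    refine (integrableOn_iff_integrable_of_support_subset fun z hz => ?_).1 h1
    by_contra hzK
    apply hz
    simp only [E]
    rw [hcutK z hzK, zero_smul]
  -- The identity on the whole plane holds up to the cutoff error, whose bound C/R does not involve
  -- δ and so survives the limit δ → 0.
  have hout : ∀ δ > 0, ‖(∫ z in K, E δ z) + aδ δ‖ ≤ C / R := by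
    intro δ hδ
    obtain ⟨hei, he⟩ := hC R hR0 hR δ hδ
    have h1 := integral_sum_fderiv_mul_gradPotential hint (hw δ hδ) (hwc δ)
    rw [haδ] at h1
    simp_rw [hpt δ hδ] at h1
    rw [integral_add (hEint δ) hei] at h1
    have h2 : ∫ z in K, E δ z = ∫ z, E δ z := hsupp _ fun z hz => by
      simp only [E]
      rw [hcutK z hz, zero_smul]
    have h3 : (∫ z in K, E δ z) + aδ δ = -∫ z, err δ z := by
      rw [h2]; linear_combination h1
    rw [h3, norm_neg]
    exact he
  have limA : Tendsto (fun δ => ∫ z in A, E δ z) (𝓝[>] 0)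
      (𝓝 ((∫ z in A, cutoff R z * energyDensity σ φ z : ℝ) : ℂ)) :=
    tendsto_integral_energy h.isUpperRegular hφ hK hμA hχ hχ0 hχ1
  have limK : Tendsto (fun δ => ∫ z in K, E δ z) (𝓝[>] 0)
      (𝓝 ((∫ z in K, cutoff R z * energyDensity σ φ z : ℝ) : ℂ)) :=
    tendsto_integral_energy h.isUpperRegular hφ hK le_rfl hχ hχ0 hχ1
  have hPA : ∫ z in A, cutoff R z * energyDensity σ φ z = P := by
    refine setIntegral_congr_fun h.measurableSet fun z hz => ?_
    rw [hcutA z hz, one_mul]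
  have hPK : ∫ z in K, cutoff R z * energyDensity σ φ z = ∫ z, cutoff R z * energyDensity σ φ z :=
    setIntegral_eq_integral_of_forall_compl_eq_zero fun z hz => by rw [hcutK z hz, zero_mul]
  -- Convergence of the boundary pairings is read off from the interior identity, where l ≠ 1/2
  -- permits division.
  have lima : Tendsto aδ (𝓝[>] 0) (𝓝 a) := by
    rw [hPA] at limA
    refine (limA.div_const (l - 1 / 2)).congr' ?_
    filter_upwards [self_mem_nhdsWithin] with δ hδ
    rw [hin δ hδ, mul_div_cancel_left₀ _ hl']
  constructor
  · refine hPA.symm.trans_le ?_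
    rw [← hPK]
    refine setIntegral_mono_set ?_ ?_ (Eventually.of_forall hAK)
    · exact integrable_mul_energyDensity h.isUpperRegular hφ hK le_rfl hχ hχ0 hχ1
    · exact Eventually.of_forall fun z => mul_nonneg (hχ0 z) (energyDensity_nonneg φ z)
  · rw [← hPK]
    refine le_of_tendsto (limK.add lima).norm ?_
    filter_upwards [self_mem_nhdsWithin] with δ hδ
    exact hout δ hδ

/-- A density whose single layer potential is locally constant vanishes. -/
theorem ae_eq_zero_of_gradPotential_eq_zero (hφ : Integrable φ σ)
    (h : ∀ i, ∀ᵐ z, gradPotential σ φ 0 i z = 0) : ∀ᵐ y ∂σ, φ y = 0 := by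
  -- The weak equation Δu = φσ with ∇u = 0 makes φσ vanish against every test function.
  refine ae_eq_zero_of_integral_contDiff_smul_eq_zero hφ.locallyIntegrable fun g hg hgc => ?_
  let w : Plane → ℂ := fun z => (g z : ℂ)
  have hw : ContDiff ℝ 1 w := (Complex.ofRealCLM.contDiff.comp hg).of_le (by simp)
  have hwc : HasCompactSupport w := hgc.comp_left Complex.ofReal_zero
  have h1 := integral_sum_fderiv_mul_gradPotential hφ hw hwc
  have h2 : ∫ z, ∑ i, fderiv ℝ w z (stdVec i) * gradPotential σ φ 0 i z = 0 := by
    refine integral_eq_zero_of_ae ?_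
    filter_upwards [ae_all_iff.2 h] with z hz
    simp [hz]
  rw [h2, eq_comm, neg_eq_zero] at h1
  simpa [w] using h1

/-- The nonnegative energy in any fixed ball is at most C/R for all large R, hence zero. -/
theorem ae_gradPotential_eq_zero (hσ : IsUpperRegular σ) (hφ : MemLp φ 2 σ) {R₁ C : ℝ}
    (hR₁ : 0 < R₁) (h : ∀ R ≥ R₁, ∫ z, cutoff R z * energyDensity σ φ z ≤ C / R) (i : Fin 2) :
    ∀ᵐ z, gradPotential σ φ 0 i z = 0 := by
  have hint : ∀ R > 0, Integrable fun z => cutoff R z * energyDensity σ φ z := fun R hR => by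
    have h1 : IntegrableOn (fun z => cutoff R z * energyDensity σ φ z)
        (Metric.closedBall 0 (2 * R)) :=
      integrable_mul_energyDensity hσ hφ (isCompact_closedBall _ _) le_rfl
        (contDiff_cutoff R).continuous.measurable (cutoff_nonneg R) (cutoff_le_one R)
    refine (integrableOn_iff_integrable_of_support_subset fun z hz => ?_).1 h1
    by_contra hzK
    simp only [mem_closedBall_zero_iff, not_le] at hzK
    apply hz
    rw [cutoff_eq_zero hR hzK.le, zero_mul]
  have key : ∀ k : ℕ, ∀ᵐ z ∂(volume.restrict (Metric.closedBall (0 : Plane) k)),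
      energyDensity σ φ z = 0 := by
    intro k
    have hi : IntegrableOn (energyDensity σ φ) (Metric.closedBall 0 (k : ℝ)) := by
      have := integrable_mul_energyDensity hσ hφ (isCompact_closedBall (0 : Plane) (k : ℝ)) le_rfl
        (χ := fun _ => 1) measurable_const (fun _ => zero_le_one) (fun _ => le_rfl)
      simpa [IntegrableOn] using this
    have hle : ∀ R ≥ max R₁ k, ∫ z in Metric.closedBall (0 : Plane) k, energyDensity σ φ z ≤
        C / R := by
      intro R hR
      have hR0 : 0 < R := hR₁.trans_le ((le_max_left _ _).trans hR)
      refine le_trans ?_ (h R ((le_max_left _ _).trans hR))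
      have e : ∫ z in Metric.closedBall (0 : Plane) k, energyDensity σ φ z =
          ∫ z in Metric.closedBall (0 : Plane) k, cutoff R z * energyDensity σ φ z := by
        refine setIntegral_congr_fun measurableSet_closedBall fun z hz => ?_
        rw [cutoff_eq_one hR0 ((mem_closedBall_zero_iff.1 hz).trans ((le_max_right _ _).trans hR)),
          one_mul]
      rw [e]
      exact setIntegral_le_integral (hint R hR0) (Eventually.of_forall fun z =>
        mul_nonneg (cutoff_nonneg R z) (energyDensity_nonneg φ z))
    have h0 : ∫ z in Metric.closedBall (0 : Plane) k, energyDensity σ φ z = 0 := by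
      refine le_antisymm ?_ (integral_nonneg fun z => energyDensity_nonneg φ z)
      have hlim : Tendsto (fun R : ℝ => C / R) atTop (𝓝 0) := tendsto_const_nhds.div_atTop tendsto_id
      refine ge_of_tendsto hlim ?_
      filter_upwards [eventually_ge_atTop (max R₁ k)] with R hR using hle R hR
    exact (integral_eq_zero_iff_of_nonneg (fun z => energyDensity_nonneg φ z) hi).1 h0
  have hU : ⋃ k : ℕ, Metric.closedBall (0 : Plane) k = Set.univ := Metric.iUnion_closedBall_nat 0
  have hall : ∀ᵐ z : Plane, energyDensity σ φ z = 0 := by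
    rw [← Measure.restrict_univ (μ := (volume : Measure Plane)), ← hU, ae_restrict_iUnion_iff]
    exact key
  filter_upwards [hall] with z hz
  have := (Finset.sum_eq_zero_iff_of_nonneg (fun i _ => by positivity)).1 hz i (Finset.mem_univ i)
  simpa using this

/-- The eigenvalues of the Neumann–Poincaré operator lie in `[-1/2, 1/2]`. -/
theorem IsNPData.eigenvalue_mem (h : IsNPData A Γ σ n) (hφ : MemLp φ 2 σ)
    (hl : ∀ᵐ x ∂σ, ∫ y, dnG n 0 x y • φ y ∂σ = l * φ x) (hne : ¬ ∀ᵐ y ∂σ, φ y = 0) :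
    l ∈ (fun t : ℝ => (t : ℂ)) '' Set.Icc (-1 / 2) (1 / 2) := by
  by_cases hl2 : l = 1 / 2
  · exact ⟨1 / 2, ⟨by norm_num, le_rfl⟩, by rw [hl2]; norm_num⟩
  obtain ⟨a, R₁, C, hR₁, ha, hR⟩ := h.exists_energy hφ hl hl2
  set P : ℝ := ∫ z in A, energyDensity σ φ z
  have hP0 : 0 ≤ P := integral_nonneg fun z => energyDensity_nonneg φ z
  let Q : ℝ → ℝ := fun R => ∫ z, cutoff R z * energyDensity σ φ z
  have hlim : Tendsto (fun R : ℝ => C / R) atTop (𝓝 0) := tendsto_const_nhds.div_atTop tendsto_id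
  -- The truncated energies are real and tend to -a. So a is real, and -a is the total energy and
  -- dominates P.
  have hQ : Tendsto (fun R => (Q R : ℂ)) atTop (𝓝 (-a)) := by
    rw [tendsto_iff_norm_sub_tendsto_zero]
    refine squeeze_zero' (Eventually.of_forall fun _ => norm_nonneg _) ?_ hlim
    filter_upwards [eventually_ge_atTop R₁] with R hRR
    rw [sub_neg_eq_add]
    exact (hR R hRR).2
  have hre : Tendsto Q atTop (𝓝 (-a.re)) := by
    simpa [Function.comp_def] using (Complex.continuous_re.tendsto _).comp hQ
  have him : a.im = 0 := by
    have h1 := (Complex.continuous_im.tendsto _).comp hQ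
    simp only [Function.comp_def, Complex.ofReal_im, Complex.neg_im] at h1
    have := tendsto_nhds_unique h1 tendsto_const_nhds
    linarith
  have hPa : P ≤ -a.re := ge_of_tendsto hre (by
    filter_upwards [eventually_ge_atTop R₁] with R hRR using (hR R hRR).1)
  have hareal : a = (a.re : ℂ) := Complex.ext rfl (by simpa using him)
  rcases eq_or_ne a.re 0 with h0 | h0
  -- With a = 0 the truncated energy is at most C/R, which forces ∇u = 0 and hence φ = 0.
  · exfalso
    apply hne
    refine ae_eq_zero_of_gradPotential_eq_zero (hφ.integrable one_le_two)
      (ae_gradPotential_eq_zero h.isUpperRegular hφ hR₁ (C := C) fun R hRR => ?_)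
    have := (hR R hRR).2
    rw [hareal, h0, Complex.ofReal_zero, add_zero, Complex.norm_real] at this
    exact (le_abs_self _).trans this
  · have hneg : 0 < -a.re := lt_of_le_of_ne (hP0.trans hPa) (fun h => h0 (by linarith))
    -- Here -a.re is the total energy, so the subtracted quotient is the fraction of the energy
    -- inside A and lies in [0, 1].
    refine ⟨1 / 2 - P / -a.re, ⟨?_, ?_⟩, ?_⟩
    · have := (div_le_one hneg).2 hPa
      linarith
    · have : 0 ≤ P / -a.re := by positivity
      linarith
    · have hac : (a.re : ℂ) ≠ 0 := by exact_mod_cast h0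
      rw [hareal] at ha
      have : l = 1 / 2 + P / a.re := by
        rw [← ha]; field_simp; ring
      rw [this]
      push_cast
      rw [div_neg, sub_neg_eq_add]

end

/-! ### Graph charts: normal, kernel bound and boundary length -/

/-- In the ball `B(p, r)` and in the coordinates `e (· - p)`, the set `E` is the region strictly
above the graph of `f`. -/
structure IsGraphChart (E : Set Plane) (p : Plane) (e : Plane ≃ₗᵢ[ℝ] Plane) (f : ℝ → ℝ)
    (r : ℝ) : Prop where
  pos : 0 < r
  contDiff : ContDiff ℝ 1 f
  mem_iff : ∀ x ∈ Metric.ball p r, x ∈ E ↔ f (e (x - p) 0) < e (x - p) 1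

/-- The outward unit normal of the region above the graph of `f`, in the coordinates `e`. -/
def graphNormal (e : Plane ≃ₗᵢ[ℝ] Plane) (f : ℝ → ℝ) (s : ℝ) : Plane :=
  e.symm (!₂[deriv f s / √(1 + deriv f s ^ 2), -1 / √(1 + deriv f s ^ 2)])

theorem sqrt_one_add_sq_pos (a : ℝ) : 0 < √(1 + a ^ 2) := Real.sqrt_pos.2 (by positivity)

theorem inner_graphNormal (e : Plane ≃ₗᵢ[ℝ] Plane) (f : ℝ → ℝ) (s : ℝ) (v : Plane) :
    inner ℝ v (graphNormal e f s) = (deriv f s * e v 0 - e v 1) / √(1 + deriv f s ^ 2) := by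
  have := sqrt_one_add_sq_pos (deriv f s)
  rw [graphNormal, ← e.inner_map_map, e.apply_symm_apply]
  simp [PiLp.inner_apply, Fin.sum_univ_two]
  field_simp
  ring

theorem norm_graphNormal (e : Plane ≃ₗᵢ[ℝ] Plane) (f : ℝ → ℝ) (s : ℝ) :
    ‖graphNormal e f s‖ = 1 := by
  rw [graphNormal, e.symm.norm_map, EuclideanSpace.norm_eq, Fin.sum_univ_two]
  have h : √(1 + deriv f s ^ 2) ^ 2 = 1 + deriv f s ^ 2 := Real.sq_sqrt (by positivity)
  simp [div_pow]
  rw [h]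
  field_simp
  ring

theorem continuous_graphNormal {f : ℝ → ℝ} (hf : ContDiff ℝ 1 f) (e : Plane ≃ₗᵢ[ℝ] Plane) :
    Continuous (graphNormal e f) := by
  have hd : Continuous (deriv f) := hf.continuous_deriv le_rfl
  have h0 : ∀ s, √(1 + deriv f s ^ 2) ≠ 0 := fun s => (sqrt_one_add_sq_pos _).ne'
  refine e.symm.continuous.comp ((PiLp.continuous_toLp 2 _).comp (continuous_pi fun i => ?_))
  fin_cases i
  · exact hd.div (by fun_prop) h0
  · exact continuous_const.div (by fun_prop) h0

theorem abs_coord_le (e : Plane ≃ₗᵢ[ℝ] Plane) (v : Plane) (i : Fin 2) : |e v i| ≤ ‖v‖ := by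
  rw [← e.norm_map v, ← Real.norm_eq_abs]
  exact PiLp.norm_apply_le _ _

section Chart

variable {E : Set Plane} {p : Plane} {e : Plane ≃ₗᵢ[ℝ] Plane} {f : ℝ → ℝ} {r : ℝ}

theorem IsGraphChart.eq_of_mem_frontier (h : IsGraphChart E p e f r) {x : Plane}
    (hx : x ∈ Metric.ball p r) (hxE : x ∈ frontier E) : e (x - p) 1 = f (e (x - p) 0) := by
  have hcont : Continuous f := h.contDiff.continuous
  have c1 : Continuous fun x : Plane => f (e (x - p) 0) := by fun_prop
  have c2 : Continuous fun x : Plane => e (x - p) 1 := by fun_prop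
  have hb : Metric.ball p r ∈ 𝓝 x := Metric.isOpen_ball.mem_nhds hx
  rcases lt_trichotomy (e (x - p) 1) (f (e (x - p) 0)) with h0 | h0 | h0
  · exfalso
    have : ∀ᶠ y in 𝓝 x, y ∉ E := by
      filter_upwards [c2.continuousAt.eventually_lt c1.continuousAt h0, hb] with y h1 h2 h3
      exact lt_asymm h1 ((h.mem_iff y h2).1 h3)
    obtain ⟨y, hy, hy'⟩ := mem_closure_iff_nhds.1 hxE.1 _ this
    exact hy hy'
  · exact h0
  · exfalso
    have : E ∈ 𝓝 x := by
      filter_upwards [c1.continuousAt.eventually_lt c2.continuousAt h0, hb] with y h1 h2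
      exact (h.mem_iff y h2).2 h1
    exact hxE.2 (mem_interior_iff_mem_nhds.2 this)

theorem IsGraphChart.mem_frontier (h : IsGraphChart E p e f r) {x : Plane}
    (hx : x ∈ Metric.ball p r) (hxe : e (x - p) 1 = f (e (x - p) 0)) : x ∈ frontier E := by
  have hxE : x ∉ E := fun hE => ((h.mem_iff x hx).1 hE).ne' hxe
  refine ⟨?_, fun hi => hxE (interior_subset hi)⟩
  rw [mem_closure_iff_frequently]
  have hlim : Tendsto (fun t : ℝ => x + t • e.symm (stdVec 1)) (𝓝[>] 0) (𝓝 x) := by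
    have hc : Continuous fun t : ℝ => x + t • e.symm (stdVec 1) := by fun_prop
    have := hc.tendsto 0
    simp only [zero_smul, add_zero] at this
    exact this.mono_left nhdsWithin_le_nhds
  refine hlim.frequently (Eventually.frequently ?_)
  filter_upwards [hlim.eventually (Metric.isOpen_ball.mem_nhds hx), self_mem_nhdsWithin] with t ht ht0
  rw [h.mem_iff _ ht, add_sub_right_comm, map_add, map_smul, e.apply_symm_apply]
  simp only [PiLp.add_apply, PiLp.smul_apply, stdVec]
  simp only [PiLp.single_apply]
  rw [hxe]
  simpa [-map_sub] using ht0

/-- The first-order Taylor error of f is at most ε‖y - x‖, and division by √(1 + f'²) ≥ 1 only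
improves the bound. -/
theorem IsGraphChart.isOutwardUnitNormal (h : IsGraphChart E p e f r) {x : Plane}
    (hx : x ∈ Metric.ball p r) (hxE : x ∈ frontier E) :
    IsOutwardUnitNormal E x (graphNormal e f (e (x - p) 0)) := by
  refine ⟨norm_graphNormal _ _ _, fun ε hε => ?_⟩
  set s := e (x - p) 0 with hs
  have hd : HasDerivAt f (deriv f s) s := (h.contDiff.differentiable one_ne_zero s).hasDerivAt
  rw [hasDerivAt_iff_isLittleO] at hd
  have h1 := hd.def hε
  have c1 : Continuous fun y : Plane => e (y - p) 0 := by fun_prop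
  have hq := sqrt_one_add_sq_pos (deriv f s)
  have hq1 : 1 ≤ √(1 + deriv f s ^ 2) := Real.one_le_sqrt.2 (by nlinarith [sq_nonneg (deriv f s)])
  filter_upwards [c1.continuousAt.eventually h1, Metric.isOpen_ball.mem_nhds hx] with y hy hyb
  have hfx := h.eq_of_mem_frontier hx hxE
  have e0 : e (y - p) 0 - s = e (y - x) 0 := by
    rw [hs, ← sub_sub_sub_cancel_right y x p, map_sub]; simp
  have e1 : e (y - p) 1 = f s + e (y - x) 1 := by
    rw [hs, ← hfx, ← sub_sub_sub_cancel_right y x p, map_sub]; simp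
  rw [inner_graphNormal, h.mem_iff y hyb, e1]
  rw [e0] at hy
  simp only [smul_eq_mul, Real.norm_eq_abs] at hy
  have hy' := abs_le.1 (hy.trans (mul_le_mul_of_nonneg_left (abs_coord_le e (y - x) 0) hε.le))
  have hn : 0 ≤ ε * ‖y - x‖ := by positivity
  constructor
  · intro hE
    rw [div_le_iff₀ hq]; nlinarith
  · intro hE
    push Not at hE
    rw [le_div_iff₀ hq]; nlinarith

theorem IsOutwardUnitNormal.outwardNormal_eq {x n : Plane} (h : IsOutwardUnitNormal E x n) :
    outwardNormal E x = n :=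
  (Classical.epsilon_spec (p := fun n => IsOutwardUnitNormal E x n) ⟨n, h⟩).unique h

theorem IsGraphChart.outwardNormal_eq (h : IsGraphChart E p e f r) {x : Plane}
    (hx : x ∈ Metric.ball p r) (hxE : x ∈ frontier E) :
    outwardNormal E x = graphNormal e f (e (x - p) 0) :=
  (h.isOutwardUnitNormal hx hxE).outwardNormal_eq

/-- In coordinates the inner product is (f'(s)(s - t) - (f(s) - f(t))) / √(1 + f'(s)²). The mean
value theorem turns the numerator into (f'(s) - f'(ξ))(s - t) with |s - ξ| ≤ |s - t|, so the Hölder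
condition supplies the extra power α. This is the only use of Hölder continuity. -/
theorem IsGraphChart.abs_inner_outwardNormal_le (h : IsGraphChart E p e f r) {α C : ℝ≥0}
    (hC : HolderWith C α (deriv f)) {x y : Plane} (hx : x ∈ Metric.ball p r)
    (hxE : x ∈ frontier E) (hy : y ∈ Metric.ball p r) (hyE : y ∈ frontier E) :
    |inner ℝ (x - y) (outwardNormal E x)| ≤ C * (‖x - y‖ ^ (α : ℝ) * ‖x - y‖) := by
  rw [h.outwardNormal_eq hx hxE, inner_graphNormal]
  set s := e (x - p) 0 with hs
  set t := e (y - p) 0 with ht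
  have e0 : e (x - y) 0 = s - t := by
    rw [hs, ht, ← sub_sub_sub_cancel_right x y p, map_sub]; simp
  have e1 : e (x - y) 1 = f s - f t := by
    rw [hs, ht, ← h.eq_of_mem_frontier hx hxE, ← h.eq_of_mem_frontier hy hyE,
      ← sub_sub_sub_cancel_right x y p, map_sub]; simp
  have hst : |s - t| ≤ ‖x - y‖ := e0 ▸ abs_coord_le e (x - y) 0
  obtain ⟨ξ, hξ, hξe⟩ : ∃ ξ, |s - ξ| ≤ |s - t| ∧ f s - f t = deriv f ξ * (s - t) := by
    have hcont := h.contDiff.continuous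
    have hdiff := h.contDiff.differentiable one_ne_zero
    rcases lt_trichotomy s t with hlt | heq | hlt
    · obtain ⟨ξ, hξ, he⟩ := exists_deriv_eq_slope f hlt hcont.continuousOn hdiff.differentiableOn
      refine ⟨ξ, ?_, ?_⟩
      · rw [abs_sub_comm, abs_sub_comm s t, abs_of_pos (sub_pos.2 hξ.1), abs_of_pos (sub_pos.2 hlt)]
        linarith [hξ.2]
      · rw [he]
        have := (sub_pos.2 hlt).ne'
        field_simp
        ring
    · exact ⟨t, by rw [heq], by rw [heq]; ring⟩
    · obtain ⟨ξ, hξ, he⟩ := exists_deriv_eq_slope f hlt hcont.continuousOn hdiff.differentiableOn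
      refine ⟨ξ, ?_, ?_⟩
      · rw [abs_of_pos (sub_pos.2 hξ.2), abs_of_pos (sub_pos.2 hlt)]
        linarith [hξ.1]
      · rw [he]
        have := (sub_pos.2 hlt).ne'
        field_simp
  have hH := hC.dist_le s ξ
  rw [Real.dist_eq, Real.dist_eq] at hH
  have hq := sqrt_one_add_sq_pos (deriv f s)
  have hq1 : 1 ≤ √(1 + deriv f s ^ 2) := Real.one_le_sqrt.2 (by nlinarith [sq_nonneg (deriv f s)])
  rw [e0, e1, hξe, ← sub_mul, abs_div, abs_of_pos hq, abs_mul]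
  refine (div_le_self (by positivity) hq1).trans ?_
  rw [← mul_assoc]
  refine mul_le_mul (hH.trans ?_) hst (abs_nonneg _) (by positivity)
  gcongr
  exact hξ.trans hst

/-- The boundary piece is contained in the image of an interval of length 4ρ under a parametrisation
with Lipschitz constant 1 + L, where L bounds |f'| on [-r, r]. -/
theorem IsGraphChart.hausdorffMeasure_inter_closedBall_le (h : IsGraphChart E p e f r) :
    ∃ C : ℝ, 0 ≤ C ∧ ∀ x ρ, 0 < ρ →
      Measure.hausdorffMeasure 1 ((frontier E ∩ Metric.ball p r) ∩ Metric.closedBall x ρ) ≤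
        ENNReal.ofReal (C * ρ) := by
  obtain ⟨L, hL⟩ := (isCompact_Icc (a := -r) (b := r)).exists_bound_of_continuousOn
    (h.contDiff.continuous_deriv le_rfl).continuousOn
  have hL0 : 0 ≤ L := (norm_nonneg _).trans (hL 0 ⟨by linarith [h.pos], h.pos.le⟩)
  let γ : ℝ → Plane := fun s => p + e.symm (!₂[s, f s])
  have hγ : LipschitzOnWith (Real.toNNReal (1 + L)) γ (Set.Icc (-r) r) := by
    refine LipschitzOnWith.of_dist_le_mul fun s hs t ht => ?_
    rw [Real.coe_toNNReal _ (by positivity), dist_eq_norm, Real.dist_eq]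
    have hf : |f s - f t| ≤ L * |s - t| :=
      (convex_Icc (-r) r).norm_image_sub_le_of_norm_deriv_le
        (fun x _ => h.contDiff.differentiable one_ne_zero x) hL ht hs
    have e1 : γ s - γ t = e.symm (!₂[s - t, f s - f t]) := by
      simp only [γ, add_sub_add_left_eq_sub, ← map_sub]
      congr 1
      ext i; fin_cases i <;> simp
    rw [e1, e.symm.norm_map]
    have e2 : (!₂[s - t, f s - f t] : Plane) = (s - t) • stdVec 0 + (f s - f t) • stdVec 1 := by
      ext i; fin_cases i <;> simp [stdVec]
    rw [e2]
    refine (norm_add_le _ _).trans ?_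
    rw [norm_smul, norm_smul, norm_stdVec, norm_stdVec, Real.norm_eq_abs, Real.norm_eq_abs]
    linarith
  refine ⟨4 * (1 + L), by positivity, fun x ρ hρ => ?_⟩
  -- The centre x need not lie on the boundary, so the ball is recentred at a boundary point q; this
  -- doubles the radius.
  rcases ((frontier E ∩ Metric.ball p r) ∩ Metric.closedBall x ρ).eq_empty_or_nonempty with h0 | ⟨q, hq⟩
  · rw [h0]; simp
  set s₀ := e (q - p) 0
  have hsub : (frontier E ∩ Metric.ball p r) ∩ Metric.closedBall x ρ ⊆
      γ '' (Set.Icc (-r) r ∩ Set.Icc (s₀ - 2 * ρ) (s₀ + 2 * ρ)) := by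
    rintro y ⟨⟨hyE, hyb⟩, hyx⟩
    refine ⟨e (y - p) 0, ⟨?_, ?_⟩, ?_⟩
    · refine abs_le.1 ((abs_coord_le e _ 0).trans ?_)
      rw [← dist_eq_norm]
      exact (Metric.mem_ball.1 hyb).le
    · have h1 : |e (y - p) 0 - s₀| ≤ 2 * ρ := by
        have : e (y - p) 0 - s₀ = e (y - q) 0 := by
          rw [← sub_sub_sub_cancel_right y q p, map_sub]; simp [s₀]
        rw [this]
        refine (abs_coord_le e _ 0).trans ?_
        rw [← dist_eq_norm]
        linarith [dist_triangle_right y q x, Metric.mem_closedBall.1 hyx,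
          Metric.mem_closedBall.1 hq.2]
      rw [abs_le] at h1
      constructor <;> linarith [h1.1, h1.2]
    · have : (!₂[e (y - p) 0, f (e (y - p) 0)] : Plane) = e (y - p) := by
        rw [← h.eq_of_mem_frontier hyb hyE]
        ext i; fin_cases i <;> simp
      simp only [γ]
      rw [this, e.symm_apply_apply]
      abel
  calc _ ≤ Measure.hausdorffMeasure 1
        (γ '' (Set.Icc (-r) r ∩ Set.Icc (s₀ - 2 * ρ) (s₀ + 2 * ρ))) := measure_mono hsub
    _ ≤ (Real.toNNReal (1 + L) : ℝ≥0∞) ^ (1 : ℝ) * Measure.hausdorffMeasure 1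
        (Set.Icc (-r) r ∩ Set.Icc (s₀ - 2 * ρ) (s₀ + 2 * ρ)) :=
        (hγ.mono Set.inter_subset_left).hausdorffMeasure_image_le zero_le_one
    _ ≤ (Real.toNNReal (1 + L) : ℝ≥0∞) ^ (1 : ℝ) * Measure.hausdorffMeasure 1
        (Set.Icc (s₀ - 2 * ρ) (s₀ + 2 * ρ)) := by
        gcongr
        exact Set.inter_subset_right
    _ = ENNReal.ofReal (4 * (1 + L) * ρ) := by
        rw [hausdorffMeasure_real, Real.volume_Icc, ENNReal.rpow_one]
        change ENNReal.ofReal (1 + L) * _ = _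
        rw [← ENNReal.ofReal_mul (by positivity)]
        congr 1
        ring

end Chart

/-! ### Boundary measure, normal field and kernel of a bounded set of class C^{1,α} -/

section Global

variable {E : Set Plane} {α : ℝ≥0}

theorem IsOfClassC1Holder.exists_chart (h : IsOfClassC1Holder α E) {p : Plane}
    (hp : p ∈ frontier E) :
    ∃ (e : Plane ≃ₗᵢ[ℝ] Plane) (f : ℝ → ℝ) (C : ℝ≥0) (r : ℝ), HolderWith C α (deriv f) ∧
      IsGraphChart E p e f r := by
  obtain ⟨e, f, C, r, hr, hf, hC, hE⟩ := h p hp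
  exact ⟨e, f, C, r, hC, hr, hf, hE⟩

theorem isCompact_frontier_of_isBounded (hE : Bornology.IsBounded E) : IsCompact (frontier E) :=
  Metric.isCompact_of_isClosed_isBounded isClosed_frontier
    (hE.closure.subset frontier_subset_closure)

theorem IsOfClassC1Holder.continuousOn_outwardNormal (h : IsOfClassC1Holder α E) :
    ContinuousOn (outwardNormal E) (frontier E) := by
  intro p hp
  obtain ⟨e, f, C, r, hC, hch⟩ := h.exists_chart hp
  have hc : Continuous fun x : Plane => graphNormal e f (e (x - p) 0) :=
    (continuous_graphNormal hch.contDiff e).comp (by fun_prop)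
  refine (hc.continuousWithinAt (s := frontier E)).congr_of_eventuallyEq ?_ ?_
  · filter_upwards [self_mem_nhdsWithin, nhdsWithin_le_nhds (Metric.ball_mem_nhds p hch.pos)]
      with x hx hxb using hch.outwardNormal_eq hxb hx
  · exact hch.outwardNormal_eq (Metric.mem_ball_self hch.pos) hp

theorem IsOfClassC1Holder.isOutwardUnitNormal (h : IsOfClassC1Holder α E) {x : Plane}
    (hx : x ∈ frontier E) : IsOutwardUnitNormal E x (outwardNormal E x) :=
  Classical.epsilon_spec (p := fun n => IsOutwardUnitNormal E x n) (h.exists_outwardUnitNormal hx)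

/-- The outward unit normal, extended by zero off the boundary. -/
def normalField (E : Set Plane) : Plane → Plane := (frontier E).indicator (outwardNormal E)

theorem normalField_eq {x : Plane} (hx : x ∈ frontier E) : normalField E x = outwardNormal E x :=
  Set.indicator_of_mem hx _

theorem IsOfClassC1Holder.norm_normalField_le (h : IsOfClassC1Holder α E) (x : Plane) :
    ‖normalField E x‖ ≤ 1 := by
  by_cases hx : x ∈ frontier E
  · rw [normalField_eq hx, (h.isOutwardUnitNormal hx).1]
  · rw [normalField, Set.indicator_of_notMem hx]; simp

theorem IsOfClassC1Holder.continuousOn_normalField (h : IsOfClassC1Holder α E) :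
    ContinuousOn (normalField E) (frontier E) :=
  h.continuousOn_outwardNormal.congr fun _ hx => normalField_eq hx

theorem IsOfClassC1Holder.measurable_normalField (h : IsOfClassC1Holder α E) :
    Measurable (normalField E) := by
  classical
  have := h.continuousOn_outwardNormal.measurable_piecewise (g := 0)
    continuousOn_const isClosed_frontier.measurableSet
  rwa [Set.piecewise_eq_indicator] at this

/-- The growth bound passes to smaller pieces of the boundary, adds up over unions and holds in
every chart; compactness globalises it. -/
theorem IsOfClassC1Holder.isUpperRegular (h : IsOfClassC1Holder α E)
    (hE : Bornology.IsBounded E) : IsUpperRegular (bdryMeasure E) := by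
  have key : ∃ C : ℝ, 0 ≤ C ∧ ∀ x ρ, 0 < ρ →
      Measure.hausdorffMeasure 1 ((frontier E ∩ frontier E) ∩ Metric.closedBall x ρ) ≤
        ENNReal.ofReal (C * ρ) := by
    refine (isCompact_frontier_of_isBounded hE).induction_on
      (p := fun S => ∃ C : ℝ, 0 ≤ C ∧ ∀ x ρ, 0 < ρ →
        Measure.hausdorffMeasure 1 ((frontier E ∩ S) ∩ Metric.closedBall x ρ) ≤
          ENNReal.ofReal (C * ρ)) ?_ ?_ ?_ ?_
    · exact ⟨0, le_rfl, fun x ρ hρ => by simp⟩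
    · rintro S T hST ⟨C, hC, hT⟩
      refine ⟨C, hC, fun x ρ hρ => (measure_mono ?_).trans (hT x ρ hρ)⟩
      gcongr
    · rintro S T ⟨C, hC, hS⟩ ⟨C', hC', hT⟩
      refine ⟨C + C', by positivity, fun x ρ hρ => ?_⟩
      rw [Set.inter_union_distrib_left, Set.union_inter_distrib_right, add_mul,
        ENNReal.ofReal_add (by positivity) (by positivity)]
      exact (measure_union_le _ _).trans (add_le_add (hS x ρ hρ) (hT x ρ hρ))
    · intro p hp
      obtain ⟨e, f, C, r, hC, hch⟩ := h.exists_chart hp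
      exact ⟨Metric.ball p r, nhdsWithin_le_nhds (Metric.ball_mem_nhds p hch.pos),
        hch.hausdorffMeasure_inter_closedBall_le⟩
  obtain ⟨C, hC, hb⟩ := key
  refine ⟨C, hC, fun x ρ hρ => ?_⟩
  rw [bdryMeasure, Measure.restrict_apply measurableSet_closedBall, Set.inter_comm]
  simpa using hb x ρ hρ

theorem IsOfClassC1Holder.isFiniteMeasure (h : IsOfClassC1Holder α E)
    (hE : Bornology.IsBounded E) : IsFiniteMeasure (bdryMeasure E) := by
  obtain ⟨C, hC, hb⟩ := h.isUpperRegular hE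
  obtain ⟨R, hR, hRE⟩ := (isCompact_frontier_of_isBounded hE).isBounded.exists_pos_norm_le
  refine ⟨?_⟩
  have : bdryMeasure E Set.univ ≤ bdryMeasure E (Metric.closedBall 0 R) := by
    rw [bdryMeasure, Measure.restrict_apply MeasurableSet.univ, Set.univ_inter,
      Measure.restrict_apply measurableSet_closedBall]
    exact measure_mono fun x hx => ⟨mem_closedBall_zero_iff.2 (hRE x hx), hx⟩
  exact this.trans_lt ((hb 0 R hR).trans_lt ENNReal.ofReal_lt_top)

theorem ae_mem_frontier (E : Set Plane) : ∀ᵐ x ∂(bdryMeasure E), x ∈ frontier E :=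
  ae_restrict_mem isClosed_frontier.measurableSet

/-- The singularity exponent is 1 - α. Near the diagonal it comes from dividing the hypothesis by |x
- y|², and away from it the kernel is bounded; compactness of Γ₁ × Γ₂ patches the two regimes. -/
theorem isWeaklySingular_of_locally {n : Plane → Plane} (hn1 : ∀ x, ‖n x‖ ≤ 1) {Γ₁ Γ₂ : Set Plane}
    (hΓ₁ : IsCompact Γ₁) (hΓ₂ : IsCompact Γ₂) (hα : 0 < α) (hα1 : α < 1)
    (h : ∀ p ∈ Γ₁, p ∈ Γ₂ → ∃ U ∈ 𝓝 p, ∃ C : ℝ, ∀ x ∈ Γ₁ ∩ U, ∀ y ∈ Γ₂ ∩ U,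
      |inner ℝ (x - y) (n x)| ≤ C * (‖x - y‖ ^ (α : ℝ) * ‖x - y‖)) :
    IsWeaklySingular n Γ₁ Γ₂ := by
  have hα' : (0 : ℝ) < α := hα
  have hα1' : (α : ℝ) < 1 := hα1
  have hpi := Real.pi_gt_three
  have key : ∃ B : ℝ, 0 ≤ B ∧ ∀ q ∈ Γ₁ ×ˢ Γ₂, q ∈ Γ₁ ×ˢ Γ₂ →
      |dnG n 0 q.1 q.2| ≤ B * ‖q.1 - q.2‖ ^ (-(1 - α) : ℝ) := by
    refine (hΓ₁.prod hΓ₂).induction_on (p := fun S => ∃ B : ℝ, 0 ≤ B ∧ ∀ q ∈ S, q ∈ Γ₁ ×ˢ Γ₂ →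
      |dnG n 0 q.1 q.2| ≤ B * ‖q.1 - q.2‖ ^ (-(1 - α) : ℝ)) ?_ ?_ ?_ ?_
    · exact ⟨0, le_rfl, by simp⟩
    · rintro S T hST ⟨B, hB, hT⟩
      exact ⟨B, hB, fun q hq => hT q (hST hq)⟩
    · rintro S T ⟨B, hB, hS⟩ ⟨B', hB', hT⟩
      refine ⟨max B B', le_max_of_le_left hB, fun q hq hq' => ?_⟩
      rcases hq with hq | hq
      · exact (hS q hq hq').trans (by gcongr; exact le_max_left _ _)
      · exact (hT q hq hq').trans (by gcongr; exact le_max_right _ _)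
    · rintro ⟨p, p'⟩ ⟨hp, hp'⟩
      rcases eq_or_ne p p' with rfl | hne
      · obtain ⟨U, hU, C, hC⟩ := h p hp hp'
        refine ⟨U ×ˢ U, nhdsWithin_le_nhds (prod_mem_nhds hU hU), |C|, abs_nonneg C, ?_⟩
        rintro ⟨x, y⟩ ⟨hxU, hyU⟩ ⟨hx, hy⟩
        have h1 := hC x ⟨hx, hxU⟩ y ⟨hy, hyU⟩
        simp only at hx hy hxU hyU ⊢
        rcases eq_or_ne x y with rfl | hxy
        · simp only [dnG, sub_self, gradG, smul_zero, inner_zero_left, abs_zero]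
          positivity
        have h0 : 0 < ‖x - y‖ := norm_pos_iff.2 (sub_ne_zero.2 hxy)
        have e1 : |dnG n 0 x y| = (2 * Real.pi * ‖x - y‖ ^ 2)⁻¹ * |inner ℝ (x - y) (n x)| := by
          rw [dnG, gradG, real_inner_smul_left, abs_mul, abs_of_nonneg (by positivity)]
          simp
        have e2 : ‖x - y‖ ^ (-(1 - α) : ℝ) = ‖x - y‖ ^ (α : ℝ) / ‖x - y‖ := by
          rw [neg_sub, Real.rpow_sub_one h0.ne']
        rw [e1, e2]
        calc _ ≤ (2 * Real.pi * ‖x - y‖ ^ 2)⁻¹ * (|C| * (‖x - y‖ ^ (α : ℝ) * ‖x - y‖)) := by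
              gcongr
              exact h1.trans (mul_le_mul_of_nonneg_right (le_abs_self C) (by positivity))
          _ = (2 * Real.pi)⁻¹ * (|C| * (‖x - y‖ ^ (α : ℝ) / ‖x - y‖)) := by
              field_simp
          _ ≤ 1 * (|C| * (‖x - y‖ ^ (α : ℝ) / ‖x - y‖)) := by
              gcongr
              exact inv_le_one_of_one_le₀ (by linarith)
          _ = _ := one_mul _
      -- Away from the diagonal |x - y| > d, so |x - y|^(-1) = |x - y|^(-α) |x - y|^(-(1-α)) is at
      -- most d^(-α) |x - y|^(-(1-α)).
      · let d := ‖p - p'‖ / 2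
        have hd : 0 < d := by
          have := norm_pos_iff.2 (sub_ne_zero.2 hne)
          simp only [d]; positivity
        have hopen : IsOpen {q : Plane × Plane | d < ‖q.1 - q.2‖} :=
          isOpen_lt continuous_const (by fun_prop)
        refine ⟨{q | d < ‖q.1 - q.2‖}, nhdsWithin_le_nhds (hopen.mem_nhds ?_), d ^ (-(α : ℝ)),
          by positivity, ?_⟩
        · have := norm_pos_iff.2 (sub_ne_zero.2 hne)
          simp only [Set.mem_ofPred_eq, d]; linarith
        · rintro ⟨x, y⟩ hxy -
          simp only [Set.mem_ofPred_eq] at hxy ⊢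
          have h0 : 0 < ‖x - y‖ := hd.trans hxy
          calc |dnG n 0 x y| ≤ ‖gradG 0 (x - y)‖ * ‖n x‖ := abs_real_inner_le_norm _ _
            _ ≤ ‖gradG 0 (x - y)‖ * 1 := by gcongr; exact hn1 x
            _ = (2 * Real.pi)⁻¹ * ‖x - y‖⁻¹ := by rw [mul_one, norm_gradG_zero]
            _ ≤ 1 * ‖x - y‖⁻¹ := by
                gcongr
                exact inv_le_one_of_one_le₀ (by linarith)
            _ = ‖x - y‖ ^ (-(α : ℝ)) * ‖x - y‖ ^ (-(1 - α) : ℝ) := by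
                rw [← Real.rpow_add h0, one_mul, ← Real.rpow_neg_one]; congr 1; ring
            _ ≤ d ^ (-(α : ℝ)) * ‖x - y‖ ^ (-(1 - α) : ℝ) := by
                refine mul_le_mul_of_nonneg_right ?_ (by positivity)
                exact Real.rpow_le_rpow_of_nonpos hd hxy.le (by linarith)
  obtain ⟨B, hB, hk⟩ := key
  exact ⟨B, 1 - α, hB, by linarith, by linarith, fun x hx y hy => hk (x, y) ⟨hx, hy⟩ ⟨hx, hy⟩⟩

theorem IsOfClassC1Holder.exists_abs_inner_le (h : IsOfClassC1Holder α E) {p : Plane}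
    (hp : p ∈ frontier E) : ∃ U ∈ 𝓝 p, ∃ C : ℝ, ∀ x ∈ frontier E ∩ U, ∀ y ∈ frontier E ∩ U,
      |inner ℝ (x - y) (normalField E x)| ≤ C * (‖x - y‖ ^ (α : ℝ) * ‖x - y‖) := by
  obtain ⟨e, f, C, r, hC, hch⟩ := h.exists_chart hp
  refine ⟨Metric.ball p r, Metric.ball_mem_nhds p hch.pos, C, fun x hx y hy => ?_⟩
  rw [normalField_eq hx.1]
  exact hch.abs_inner_outwardNormal_le hC hx.2 hx.1 hy.2 hy.1

end Global

/-! ### The area formula for C¹ graphs -/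

/-- The graph of `f` in the coordinates `e (· - p)`, as a curve. -/
def graphCurve (p : Plane) (e : Plane ≃ₗᵢ[ℝ] Plane) (f : ℝ → ℝ) (s : ℝ) : Plane :=
  p + e.symm (!₂[s, f s])

section Area

variable {p : Plane} {e : Plane ≃ₗᵢ[ℝ] Plane} {f : ℝ → ℝ}

theorem coord_graphCurve (p : Plane) (e : Plane ≃ₗᵢ[ℝ] Plane) (f : ℝ → ℝ) (s : ℝ) :
    e (graphCurve p e f s - p) = !₂[s, f s] := by
  rw [graphCurve, add_sub_cancel_left, e.apply_symm_apply]

theorem injective_graphCurve (p : Plane) (e : Plane ≃ₗᵢ[ℝ] Plane) (f : ℝ → ℝ) :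
    Function.Injective (graphCurve p e f) := by
  intro s t h
  have h1 := coord_graphCurve p e f s
  rw [h, coord_graphCurve] at h1
  simpa using (congrArg (fun v : Plane => v 0) h1).symm

theorem continuous_graphCurve (hf : Continuous f) : Continuous (graphCurve p e f) := by
  refine continuous_const.add (e.symm.continuous.comp
    ((PiLp.continuous_toLp 2 _).comp (continuous_pi fun i => ?_)))
  fin_cases i
  · exact continuous_id
  · exact hf

theorem measurableEmbedding_graphCurve (hf : Continuous f) :
    MeasurableEmbedding (graphCurve p e f) :=
  (continuous_graphCurve hf).measurableEmbedding (injective_graphCurve p e f)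

theorem norm_graphCurve_sub (s t : ℝ) :
    ‖graphCurve p e f s - graphCurve p e f t‖ = √((s - t) ^ 2 + (f s - f t) ^ 2) := by
  rw [graphCurve, graphCurve, add_sub_add_left_eq_sub, ← map_sub, e.symm.norm_map,
    EuclideanSpace.norm_eq, Fin.sum_univ_two]
  simp

/-- The mean value theorem makes a chord equal to |s - t| times the length density at an
intermediate point. Bounds on the density thus become Lipschitz bounds for the curve and for its
inverse. -/
theorem exists_norm_graphCurve_sub_eq (hf : ContDiff ℝ 1 f) (s t : ℝ) :
    ∃ ξ ∈ Set.uIcc s t, ‖graphCurve p e f s - graphCurve p e f t‖ =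
      √(1 + deriv f ξ ^ 2) * |s - t| := by
  have key : ∀ s t, s < t → ∃ ξ ∈ Set.uIcc s t,
      ‖graphCurve p e f s - graphCurve p e f t‖ = √(1 + deriv f ξ ^ 2) * |s - t| := by
    intro s t hst
    obtain ⟨ξ, hξ, he⟩ := exists_deriv_eq_slope f hst hf.continuous.continuousOn
      (hf.differentiable one_ne_zero).differentiableOn
    refine ⟨ξ, ?_, ?_⟩
    · rw [Set.uIcc_of_le hst.le]
      exact Set.Ioo_subset_Icc_self hξ
    · have h0 := (sub_pos.2 hst).ne'
      rw [norm_graphCurve_sub, ← Real.sqrt_sq_eq_abs, ← Real.sqrt_mul (by positivity), he]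
      congr 1
      field_simp
      ring
  rcases lt_trichotomy s t with h | rfl | h
  · exact key s t h
  · exact ⟨s, by simp, by simp⟩
  · obtain ⟨ξ, h1, h2⟩ := key t s h
    exact ⟨ξ, by rwa [Set.uIcc_comm], by rw [norm_sub_rev, h2, abs_sub_comm]⟩

theorem hausdorffMeasure_image_graphCurve_le (hf : ContDiff ℝ 1 f) {a b M : ℝ} (hab : a ≤ b)
    (hM : ∀ ξ ∈ Set.Icc a b, √(1 + deriv f ξ ^ 2) ≤ M) :
    Measure.hausdorffMeasure 1 (graphCurve p e f '' Set.Ioc a b) ≤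
      ENNReal.ofReal (M * (b - a)) := by
  have hM0 : 0 ≤ M := (Real.sqrt_nonneg _).trans (hM a ⟨le_rfl, hab⟩)
  have hL : LipschitzOnWith M.toNNReal (graphCurve p e f) (Set.Ioc a b) := by
    refine LipschitzOnWith.of_dist_le_mul fun s hs t ht => ?_
    rw [Real.coe_toNNReal _ hM0, dist_eq_norm, Real.dist_eq]
    obtain ⟨ξ, hξ, he⟩ := exists_norm_graphCurve_sub_eq (p := p) (e := e) hf s t
    rw [he]
    gcongr
    exact hM ξ (Set.uIcc_subset_Icc (Set.Ioc_subset_Icc_self hs) (Set.Ioc_subset_Icc_self ht) hξ)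
  refine (hL.hausdorffMeasure_image_le zero_le_one).trans ?_
  rw [hausdorffMeasure_real, Real.volume_Ioc, ENNReal.rpow_one, ENNReal.ofReal_mul hM0]
  rfl

/-- Projection to the first coordinate inverts the curve and is Lipschitz with constant 1/m on its
image. -/
theorem le_hausdorffMeasure_image_graphCurve (hf : ContDiff ℝ 1 f) {a b m : ℝ} (hab : a ≤ b)
    (hm : ∀ ξ ∈ Set.Icc a b, m ≤ √(1 + deriv f ξ ^ 2)) :
    ENNReal.ofReal (m * (b - a)) ≤
      Measure.hausdorffMeasure 1 (graphCurve p e f '' Set.Ioc a b) := by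
  rcases le_or_gt m 0 with h0 | h0
  · rw [ENNReal.ofReal_of_nonpos (mul_nonpos_of_nonpos_of_nonneg h0 (sub_nonneg.2 hab))]
    exact zero_le
  have hL : LipschitzOnWith (m⁻¹).toNNReal (fun z : Plane => e (z - p) 0)
      (graphCurve p e f '' Set.Ioc a b) := by
    refine LipschitzOnWith.of_dist_le_mul ?_
    rintro _ ⟨s, hs, rfl⟩ _ ⟨t, ht, rfl⟩
    rw [Real.coe_toNNReal _ (by positivity), dist_eq_norm, dist_eq_norm, coord_graphCurve,
      coord_graphCurve]
    obtain ⟨ξ, hξ, he⟩ := exists_norm_graphCurve_sub_eq (p := p) (e := e) hf s t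
    rw [he]
    have h1 := hm ξ (Set.uIcc_subset_Icc (Set.Ioc_subset_Icc_self hs)
      (Set.Ioc_subset_Icc_self ht) hξ)
    rw [← mul_assoc]
    simp only [Matrix.cons_val_zero, Real.norm_eq_abs]
    refine le_mul_of_one_le_left (abs_nonneg _) ?_
    rw [inv_mul_eq_div, one_le_div h0]
    exact h1
  have h := hL.hausdorffMeasure_image_le zero_le_one
  have himg : (fun z : Plane => e (z - p) 0) '' (graphCurve p e f '' Set.Ioc a b) =
      Set.Ioc a b := by
    rw [Set.image_image]
    simp only [coord_graphCurve]
    simp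
  rw [himg, hausdorffMeasure_real, Real.volume_Ioc, ENNReal.rpow_one] at h
  rw [ENNReal.ofReal_mul h0.le]
  calc _ ≤ ENNReal.ofReal m * (ENNReal.ofReal m⁻¹ *
        Measure.hausdorffMeasure 1 (graphCurve p e f '' Set.Ioc a b)) := by gcongr; exact h
    _ = _ := by
        rw [← mul_assoc, ← ENNReal.ofReal_mul h0.le, mul_inv_cancel₀ h0.ne', ENNReal.ofReal_one,
          one_mul]

/-- The area formula for the graph of a `C¹` function. -/
theorem hausdorffMeasure_restrict_range_graphCurve (hf : ContDiff ℝ 1 f) :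
    (Measure.hausdorffMeasure 1).restrict (Set.range (graphCurve p e f)) =
      (volume.withDensity fun s => ((√(1 + deriv f s ^ 2)).toNNReal : ℝ≥0∞)).map
        (graphCurve p e f) := by
  have hemb := measurableEmbedding_graphCurve (p := p) (e := e) hf.continuous
  rw [← hemb.map_comap]
  congr 1
  -- The pulled-back measure is compared with the density on half-open intervals, which determine a
  -- locally finite measure on ℝ.
  let ν : Measure ℝ := (Measure.hausdorffMeasure 1).comap (graphCurve p e f)
  let g : ℝ → ℝ := fun s => √(1 + deriv f s ^ 2)
  have hg : Continuous g := by
    have : Continuous (deriv f) := hf.continuous_deriv le_rfl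
    fun_prop
  have hν : ∀ s, ν s = Measure.hausdorffMeasure 1 (graphCurve p e f '' s) :=
    fun s => hemb.comap_apply _ s
  have hle : ∀ {a b M : ℝ}, a ≤ b → (∀ ξ ∈ Set.Icc a b, g ξ ≤ M) →
      ν (Set.Ioc a b) ≤ ENNReal.ofReal (M * (b - a)) := by
    intro a b M hab hM
    rw [hν]
    exact hausdorffMeasure_image_graphCurve_le hf hab hM
  have hge : ∀ {a b m : ℝ}, a ≤ b → (∀ ξ ∈ Set.Icc a b, m ≤ g ξ) →
      ENNReal.ofReal (m * (b - a)) ≤ ν (Set.Ioc a b) := by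
    intro a b m hab hm
    rw [hν]
    exact le_hausdorffMeasure_image_graphCurve hf hab hm
  have hfin : ∀ a b, ν (Set.Ioc a b) ≠ ∞ := by
    intro a b
    rcases le_or_gt a b with hab | hab
    · obtain ⟨M, hM⟩ := (isCompact_Icc (a := a) (b := b)).exists_bound_of_continuousOn
        hg.continuousOn
      exact ((hle hab fun ξ hξ => (le_abs_self _).trans (hM ξ hξ)).trans_lt
        ENNReal.ofReal_lt_top).ne
    · simp [Set.Ioc_eq_empty_of_le hab.le]
  have hadd : ∀ {a b c}, a ≤ b → b ≤ c →
      (ν (Set.Ioc a c)).toReal = (ν (Set.Ioc a b)).toReal + (ν (Set.Ioc b c)).toReal := by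
    intro a b c hab hbc
    rw [← Set.Ioc_union_Ioc_eq_Ioc hab hbc, measure_union
      (Set.Ioc_disjoint_Ioc_of_le le_rfl) measurableSet_Ioc, ENNReal.toReal_add (hfin _ _) (hfin _ _)]
  have hcalc : ∀ a b, a ≤ b → (ν (Set.Ioc a b)).toReal = ∫ s in a..b, g s := by
    intro a b hab
    let F : ℝ → ℝ := fun t => (ν (Set.Ioc a t)).toReal
    obtain ⟨M, hM⟩ := (isCompact_Icc (a := a) (b := b)).exists_bound_of_continuousOn hg.continuousOn
    have hM0 : 0 ≤ M := (norm_nonneg _).trans (hM a ⟨le_rfl, hab⟩)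
    have hcont : ContinuousOn F (Set.Icc a b) := by
      have hlip : ∀ s ∈ Set.Icc a b, ∀ t ∈ Set.Icc a b, s ≤ t → |F t - F s| ≤ M * |t - s| := by
        intro s hs t ht hst
        simp only [F]
        rw [hadd hs.1 hst, add_sub_cancel_left, abs_of_nonneg ENNReal.toReal_nonneg,
          abs_of_nonneg (sub_nonneg.2 hst)]
        refine ENNReal.toReal_le_of_le_ofReal (mul_nonneg hM0 (sub_nonneg.2 hst)) (hle hst ?_)
        exact fun ξ hξ => (le_abs_self _).trans (hM ξ ⟨hs.1.trans hξ.1, hξ.2.trans ht.2⟩)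
      refine LipschitzOnWith.continuousOn (K := M.toNNReal)
        (LipschitzOnWith.of_dist_le_mul fun s hs t ht => ?_)
      rw [Real.coe_toNNReal _ hM0, Real.dist_eq, Real.dist_eq]
      rcases le_total s t with h | h
      · rw [abs_sub_comm, abs_sub_comm s t]
        exact hlip s hs t ht h
      · exact hlip t ht s hs h
    -- On a short interval to the right of x the mass lies between (g(x) - ε) and (g(x) + ε) times
    -- the length, so F has right derivative g; the fundamental theorem of calculus then gives its
    -- values.
    have hderiv : ∀ x ∈ Set.Ioo a b, HasDerivWithinAt F (g x) (Set.Ioi x) x := by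
      intro x hx
      rw [hasDerivWithinAt_iff_isLittleO, Asymptotics.isLittleO_iff]
      intro ε hε
      obtain ⟨δ, hδ, hgδ⟩ := Metric.continuousAt_iff.1 hg.continuousAt ε hε
      have hnear : Set.Iio (x + δ) ∈ 𝓝[>] x :=
        nhdsWithin_le_nhds (isOpen_Iio.mem_nhds (by simpa using hδ))
      filter_upwards [self_mem_nhdsWithin, hnear] with y hy hyδ
      have hxy : x ≤ y := le_of_lt hy
      have hgb : ∀ ξ ∈ Set.Icc x y, |g ξ - g x| < ε := by
        intro ξ hξ
        refine hgδ ?_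
        rw [Real.dist_eq, abs_of_nonneg (sub_nonneg.2 hξ.1)]
        have : y < x + δ := hyδ
        linarith [hξ.2]
      have h1 := ENNReal.toReal_le_of_le_ofReal
        (mul_nonneg (add_nonneg (Real.sqrt_nonneg _) hε.le) (sub_nonneg.2 hxy))
        (hle (M := g x + ε) hxy fun ξ hξ => by linarith [(abs_lt.1 (hgb ξ hξ)).2])
      have h2 := (ENNReal.ofReal_le_iff_le_toReal (hfin _ _)).1
        (hge (m := g x - ε) hxy fun ξ hξ => by linarith [(abs_lt.1 (hgb ξ hξ)).1])
      simp only [F]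
      rw [hadd hx.1.le hxy, add_sub_cancel_left, smul_eq_mul, Real.norm_eq_abs, Real.norm_eq_abs,
        abs_of_nonneg (sub_nonneg.2 hxy), abs_le]
      constructor <;> linarith
    have := intervalIntegral.integral_eq_sub_of_hasDeriv_right_of_le hab hcont hderiv
      (hg.intervalIntegrable _ _)
    rw [this]
    simp [F]
  have : IsLocallyFiniteMeasure ν := by
    refine ⟨fun x => ⟨Set.Ioc (x - 1) (x + 1), Ioc_mem_nhds (by linarith) (by linarith),
      (hfin _ _).lt_top⟩⟩
  refine Measure.ext_of_Ioc ν _ fun a b hab => ?_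
  rw [withDensity_apply _ measurableSet_Ioc, ← ENNReal.ofReal_toReal (hfin a b), hcalc a b hab.le,
    intervalIntegral.integral_of_le hab.le, ofReal_integral_eq_lintegral_ofReal
      (hg.integrableOn_Ioc) (ae_of_all _ fun _ => Real.sqrt_nonneg _)]
  rfl

theorem setIntegral_range_graphCurve (hf : ContDiff ℝ 1 f) (F : Plane → ℂ) :
    ∫ x in Set.range (graphCurve p e f), F x ∂(Measure.hausdorffMeasure 1) =
      ∫ s, √(1 + deriv f s ^ 2) • F (graphCurve p e f s) := by
  have hd : Continuous (deriv f) := hf.continuous_deriv le_rfl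
  rw [hausdorffMeasure_restrict_range_graphCurve hf,
    (measurableEmbedding_graphCurve hf.continuous).integral_map,
    integral_withDensity_eq_integral_smul (by fun_prop)]
  refine integral_congr_ae (ae_of_all _ fun s => ?_)
  simp only [NNReal.smul_def, Real.coe_toNNReal _ (Real.sqrt_nonneg _)]

end Area

/-! ### The divergence theorem on domains with C¹ graph charts -/

/-- The volume preserving parametrisation of the plane by horizontal position and height above the
graph of `f`, in the coordinates `e (· - p)`. -/
def shearMap (p : Plane) (e : Plane ≃ₗᵢ[ℝ] Plane) (f : ℝ → ℝ) (q : ℝ × ℝ) : Plane :=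
  p + (q.1 • e.symm (stdVec 0) + (f q.1 + q.2) • e.symm (stdVec 1))

section Shear

variable {p : Plane} {e : Plane ≃ₗᵢ[ℝ] Plane} {f : ℝ → ℝ}

theorem shearMap_eq (q : ℝ × ℝ) :
    shearMap p e f q = p + e.symm (!₂[q.1, f q.1 + q.2]) := by
  rw [shearMap, ← map_smul, ← map_smul, ← map_add]
  congr 2
  ext i
  fin_cases i <;> simp [stdVec]

theorem coord_shearMap (q : ℝ × ℝ) : e (shearMap p e f q - p) = !₂[q.1, f q.1 + q.2] := by
  rw [shearMap_eq, add_sub_cancel_left, e.apply_symm_apply]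

theorem shearMap_zero (s : ℝ) : shearMap p e f (s, 0) = graphCurve p e f s := by
  rw [shearMap_eq, graphCurve, add_zero]

theorem continuous_shearMap (hf : Continuous f) : Continuous (shearMap p e f) := by
  unfold shearMap
  fun_prop

theorem isClosedEmbedding_shearMap (hf : Continuous f) :
    IsClosedEmbedding (shearMap p e f) := by
  have hS : Continuous fun z : Plane => (e (z - p) 0, e (z - p) 1 - f (e (z - p) 0)) := by
    fun_prop
  refine Function.LeftInverse.isClosedEmbedding (fun q => ?_) hS (continuous_shearMap hf)
  simp only [coord_shearMap]
  simp

theorem measurePreserving_shearMap (hf : Continuous f) :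
    MeasurePreserving (shearMap p e f) volume volume := by
  have h1 : MeasurePreserving (fun q : ℝ × ℝ => (q.1, f q.1 + q.2)) volume volume :=
    (MeasurePreserving.id volume).skew_product (g := fun s t => f s + t) (by fun_prop)
      (ae_of_all _ fun s => map_add_left_eq_self volume (f s))
  have h2 := (volume_preserving_finTwoArrow ℝ).symm
  have h3 := PiLp.volume_preserving_toLp (Fin 2)
  have h4 := e.symm.measurePreserving
  have h5 := measurePreserving_add_left (volume : Measure Plane) p
  have h := h5.comp (h4.comp (h3.comp (h2.comp h1)))
  convert h using 1
  ext1 q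
  rw [shearMap_eq]
  rfl

end Shear

/-- After flattening, the derivative along a is a combination of ∂_s(w∘T) and ∂_t(w∘T) whose
coefficients depend on s alone. The s-derivative integrates to zero along each line t = const, and
the t-derivative integrates over t > 0 to minus the value on the graph. -/
theorem integral_epigraph_fderiv {f : ℝ → ℝ} (hf : ContDiff ℝ 1 f) (p : Plane)
    (e : Plane ≃ₗᵢ[ℝ] Plane) {w : Plane → ℂ} (hw : ContDiff ℝ 1 w) (hwc : HasCompactSupport w)
    (a : Plane) :
    ∫ z in {z : Plane | f (e (z - p) 0) < e (z - p) 1}, fderiv ℝ w z a =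
      ∫ s, (deriv f s * e a 0 - e a 1) • w (graphCurve p e f s) := by
  let T := shearMap p e f
  let b₀ := e.symm (stdVec 0)
  let b₁ := e.symm (stdVec 1)
  have hd : Continuous (deriv f) := hf.continuous_deriv le_rfl
  have hT : Continuous T := continuous_shearMap hf.continuous
  have hTe : IsClosedEmbedding T := isClosedEmbedding_shearMap hf.continuous
  have hTm : MeasurePreserving T volume volume := measurePreserving_shearMap hf.continuous
  have hpre : T ⁻¹' {z : Plane | f (e (z - p) 0) < e (z - p) 1} =
      (Set.univ : Set ℝ) ×ˢ Set.Ioi (0 : ℝ) := by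
    ext q
    simp only [T, Set.mem_preimage, Set.mem_ofPred_eq, coord_shearMap]
    simp
  have hw' : Continuous (fderiv ℝ w) := hw.continuous_fderiv one_ne_zero
  have ha : a = (e a 0) • b₀ + (e a 1) • b₁ := by
    have := eq_sum_stdVec (e a)
    rw [Fin.sum_univ_two] at this
    rw [← map_smul, ← map_smul, ← map_add, ← this, e.symm_apply_apply]
  -- `H₀` and `H₁` are the partial derivatives of w∘T in position s and height t.
  let H₀ : ℝ × ℝ → ℂ := fun q => fderiv ℝ w (T q) (b₀ + deriv f q.1 • b₁)
  let H₁ : ℝ × ℝ → ℂ := fun q => fderiv ℝ w (T q) b₁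
  have hsupp : HasCompactSupport fun q => fderiv ℝ w (T q) :=
    (hwc.fderiv ℝ).comp_isClosedEmbedding hTe
  have hH₀c : HasCompactSupport H₀ := hsupp.mono fun q hq h0 => hq (by simp [H₀, h0])
  have hH₁c : HasCompactSupport H₁ := hsupp.mono fun q hq h0 => hq (by simp [H₁, h0])
  have hH₀ : Continuous H₀ := (hw'.comp hT).clm_apply (by fun_prop)
  have hH₁ : Continuous H₁ := (hw'.comp hT).clm_apply continuous_const
  have hH : ∀ q, fderiv ℝ w (T q) a =
      (e a 0) • H₀ q + (e a 1 - e a 0 * deriv f q.1) • H₁ q := by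
    intro q
    conv_lhs => rw [ha]
    simp only [H₀, H₁, map_add, map_smul, sub_smul, smul_add, mul_smul]
    abel
  have hc : Continuous fun s => e a 1 - e a 0 * deriv f s := by fun_prop
  have hcH₁ : Continuous fun q : ℝ × ℝ => (e a 1 - e a 0 * deriv f q.1) • H₁ q :=
    (hc.comp continuous_fst).smul hH₁
  have hI₀ : Integrable H₀ := hH₀.integrable_of_hasCompactSupport hH₀c
  have hI₁ : Integrable fun q : ℝ × ℝ => (e a 1 - e a 0 * deriv f q.1) • H₁ q :=
    
    hcH₁.integrable_of_hasCompactSupport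
      (hH₁c.mono fun q hq h0 => hq (show _ • H₁ q = 0 by rw [h0, smul_zero]))
  have hTs : ∀ s t, HasDerivAt (fun s => T (s, t)) (b₀ + deriv f s • b₁) s := by
    intro s t
    have h1 : HasDerivAt f (deriv f s) s := (hf.differentiable one_ne_zero s).hasDerivAt
    have h2 := ((hasDerivAt_id s).smul_const b₀).add ((h1.add_const t).smul_const b₁)
    simpa [T, shearMap, b₀, b₁, one_smul] using h2.const_add p
  have hTt : ∀ s t, HasDerivAt (fun t => T (s, t)) b₁ t := by
    intro s t
    have h2 := (((hasDerivAt_id t).const_add (f s)).smul_const b₁).const_add (s • b₀)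
    simpa [T, shearMap, b₀, b₁, one_smul] using h2.const_add p
  have hwd : ∀ z, HasFDerivAt w (fderiv ℝ w z) z :=
    fun z => (hw.differentiable one_ne_zero z).hasFDerivAt
  have hs : ∀ t, ∫ s, H₀ (s, t) = 0 := by
    intro t
    have hemb : IsClosedEmbedding fun s : ℝ => (s, t) :=
      Function.LeftInverse.isClosedEmbedding (f := Prod.fst) (fun _ => rfl) continuous_fst
        (by fun_prop)
    refine integral_eq_zero_of_hasDerivAt_of_integrable (f := fun s => w (T (s, t)))
      (fun s => (hwd _).comp_hasDerivAt s (hTs s t)) ?_ ?_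
    · exact (hH₀.comp hemb.continuous).integrable_of_hasCompactSupport
        (hH₀c.comp_isClosedEmbedding hemb)
    · exact (hw.continuous.comp (hT.comp hemb.continuous)).integrable_of_hasCompactSupport
        (hwc.comp_isClosedEmbedding (hTe.comp hemb))
  have ht : ∀ s, ∫ t in Set.Ioi (0 : ℝ), H₁ (s, t) = -w (graphCurve p e f s) := by
    intro s
    have hemb : IsClosedEmbedding fun t : ℝ => (s, t) :=
      Function.LeftInverse.isClosedEmbedding (f := Prod.snd) (fun _ => rfl) continuous_snd
        (by fun_prop)
    have h1 : deriv (fun t => w (T (s, t))) = fun t => H₁ (s, t) :=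
      funext fun t => ((hwd _).comp_hasDerivAt t (hTt s t)).deriv
    have hsm : ContDiff ℝ 1 fun t => T (s, t) := by
      simp only [T, shearMap]
      fun_prop
    have h2 := HasCompactSupport.integral_Ioi_deriv_eq (hw.comp hsm)
      (hwc.comp_isClosedEmbedding (hTe.comp hemb)) 0
    simp only [Function.comp_def] at h2
    rw [h1] at h2
    rw [h2, ← shearMap_zero]
  rw [← hTm.setIntegral_preimage_emb hTe.measurableEmbedding, hpre]
  simp only [hH]
  have hI₀' : Integrable fun q => (e a 0) • H₀ q := Integrable.smul (e a 0) hI₀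
  rw [integral_add hI₀'.integrableOn hI₁.integrableOn, integral_smul]
  have e₀ : ∫ q in (Set.univ : Set ℝ) ×ˢ Set.Ioi (0 : ℝ), H₀ q = 0 := by
    have hI : Integrable H₀ ((volume.restrict Set.univ).prod (volume.restrict (Set.Ioi 0))) := by
      rw [Measure.prod_restrict]
      exact hI₀.integrableOn
    rw [Measure.volume_eq_prod, ← Measure.prod_restrict, integral_prod_symm _ hI]
    simp only [Measure.restrict_univ, hs, integral_zero]
  rw [e₀, smul_zero, zero_add, Measure.volume_eq_prod, setIntegral_prod _ hI₁.integrableOn]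
  simp only [Measure.restrict_univ, integral_smul, ht]
  refine integral_congr_ae (ae_of_all _ fun s => ?_)
  simp only [smul_neg, ← neg_smul]
  congr 1
  ring

/-- The divergence theorem for functions supported in a ball in which the domain is the epigraph
of a `C¹` function. -/
theorem IsGraphChart.integral_fderiv_eq {E : Set Plane} {p : Plane} {e : Plane ≃ₗᵢ[ℝ] Plane}
    {f : ℝ → ℝ} {r : ℝ} (h : IsGraphChart E p e f r) (hE : MeasurableSet E) {w : Plane → ℂ}
    (hw : ContDiff ℝ 1 w) (hwc : HasCompactSupport w) (hws : tsupport w ⊆ Metric.ball p r)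
    (a : Plane) :
    ∫ z in E, fderiv ℝ w z a = ∫ x, (inner ℝ a (normalField E x) : ℝ) • w x ∂(bdryMeasure E) := by
  have hf := h.contDiff
  have hfc := hf.continuous
  have hzero : ∀ z, z ∉ Metric.ball p r → w z = 0 :=
    fun z hz => image_eq_zero_of_notMem_tsupport fun hz' => hz (hws hz')
  have hzero' : ∀ z, z ∉ Metric.ball p r → fderiv ℝ w z = 0 := fun z hz =>
    image_eq_zero_of_notMem_tsupport fun hz' => hz (hws (tsupport_fderiv_subset ℝ hz'))
  have hU : IsOpen {z : Plane | f (e (z - p) 0) < e (z - p) 1} :=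
    isOpen_lt (by fun_prop) (by fun_prop)
  have hl : ∫ z in E, fderiv ℝ w z a =
      ∫ z in {z : Plane | f (e (z - p) 0) < e (z - p) 1}, fderiv ℝ w z a := by
    rw [← integral_indicator hE, ← integral_indicator hU.measurableSet]
    congr 1
    ext1 z
    by_cases hz : z ∈ Metric.ball p r
    · by_cases hzE : z ∈ E
      · rw [Set.indicator_of_mem hzE, Set.indicator_of_mem]
        exact (h.mem_iff z hz).1 hzE
      · rw [Set.indicator_of_notMem hzE, Set.indicator_of_notMem]
        exact fun h' => hzE ((h.mem_iff z hz).2 h')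
    · simp [Set.indicator_apply, hzero' z hz]
  have hr : ∫ x, (inner ℝ a (normalField E x) : ℝ) • w x ∂(bdryMeasure E) =
      ∫ x in Set.range (graphCurve p e f), (inner ℝ a (graphNormal e f (e (x - p) 0)) : ℝ) • w x
        ∂(Measure.hausdorffMeasure 1) := by
    rw [bdryMeasure, ← integral_indicator isClosed_frontier.measurableSet, ← integral_indicator
      (measurableEmbedding_graphCurve hfc).measurableSet_range]
    congr 1
    ext1 x
    by_cases hx : x ∈ Metric.ball p r
    · have hiff : x ∈ frontier E ↔ x ∈ Set.range (graphCurve p e f) := by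
        constructor
        · intro hxE
          refine ⟨e (x - p) 0, ?_⟩
          have : (!₂[e (x - p) 0, f (e (x - p) 0)] : Plane) = e (x - p) := by
            rw [← h.eq_of_mem_frontier hx hxE]
            ext i; fin_cases i <;> simp
          rw [graphCurve, this, e.symm_apply_apply, add_sub_cancel]
        · rintro ⟨s, rfl⟩
          refine h.mem_frontier hx ?_
          rw [coord_graphCurve]
          simp
      by_cases hxE : x ∈ frontier E
      · rw [Set.indicator_of_mem hxE, Set.indicator_of_mem (hiff.1 hxE), normalField_eq hxE,
          h.outwardNormal_eq hx hxE]
      · rw [Set.indicator_of_notMem hxE, Set.indicator_of_notMem (mt hiff.2 hxE)]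
    · rw [Set.indicator_apply_eq_zero.2 fun _ => by rw [hzero x hx, smul_zero],
        Set.indicator_apply_eq_zero.2 fun _ => by rw [hzero x hx, smul_zero]]
  rw [hl, integral_epigraph_fderiv hf p e hw hwc, hr, setIntegral_range_graphCurve hf]
  refine integral_congr_ae (ae_of_all _ fun s => ?_)
  simp only
  rw [coord_graphCurve, inner_graphNormal, smul_smul]
  congr 1
  have := sqrt_one_add_sq_pos (deriv f s)
  simp only [Matrix.cons_val_zero]
  field_simp

/-- A compactness induction in place of a partition of unity. For a piece S of the closure one seeks
χ that vanishes near S and for which the formula holds for every (1 - χ) w. For S = closure A the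
remainder χ w vanishes near closure A, and both of its sides are zero. -/
theorem isGaussGreen_of_locally {A : Set Plane} (hA : Bornology.IsBounded A) {σ : Measure Plane}
    [IsFiniteMeasure σ] (hσ : ∀ᵐ x ∂σ, x ∈ closure A) {n : Plane → Plane} (hnm : Measurable n)
    (hn1 : ∀ x, ‖n x‖ ≤ 1)
    (h : ∀ p ∈ closure A, ∃ U ∈ 𝓝 p, ∀ (w : Plane → ℂ) (a : Plane), ContDiff ℝ 1 w →
      HasCompactSupport w → tsupport w ⊆ U →
      ∫ z in A, fderiv ℝ w z a = ∫ x, (inner ℝ a (n x) : ℝ) • w x ∂σ) :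
    IsGaussGreen A σ n := by
  let P : (Plane → ℂ) → Prop := fun w =>
    ∀ a, ∫ z in A, fderiv ℝ w z a = ∫ x, (inner ℝ a (n x) : ℝ) • w x ∂σ
  have hadd : ∀ {u v : Plane → ℂ}, ContDiff ℝ 1 u → ContDiff ℝ 1 v → HasCompactSupport u →
      HasCompactSupport v → P u → P v → P (u + v) := by
    intro u v hu hv huc hvc hPu hPv a
    have hi : ∀ {w : Plane → ℂ}, ContDiff ℝ 1 w → HasCompactSupport w →
        Integrable fun z => fderiv ℝ w z a := fun hw hwc =>
      ((hw.continuous_fderiv one_ne_zero).clm_apply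
        continuous_const).integrable_of_hasCompactSupport (hwc.fderiv_apply (𝕜 := ℝ) a)
    have hj : ∀ {w : Plane → ℂ}, ContDiff ℝ 1 w → HasCompactSupport w →
        Integrable (fun x => (inner ℝ a (n x) : ℝ) • w x) σ := by
      intro w hw hwc
      have hwi : Integrable w σ := hw.continuous.integrable_of_hasCompactSupport hwc
      refine Integrable.bdd_smul (φ := fun x => (inner ℝ a (n x) : ℝ)) (C := ‖a‖) hwi ?_ (ae_of_all _ fun x => ?_)
      · exact (measurable_const.inner hnm).aestronglyMeasurable
      · refine (abs_real_inner_le_norm _ _).trans ?_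
        exact mul_le_of_le_one_right (norm_nonneg _) (hn1 x)
    have e1 : ∀ z, fderiv ℝ (u + v) z a = fderiv ℝ u z a + fderiv ℝ v z a := by
      intro z
      rw [fderiv_add (hu.differentiable one_ne_zero z) (hv.differentiable one_ne_zero z)]
      rfl
    simp only [e1, Pi.add_apply, smul_add]
    rw [integral_add (hi hu huc).integrableOn (hi hv hvc).integrableOn,
      integral_add (hj hu huc) (hj hv hvc), hPu a, hPv a]
  have key : ∃ χ : Plane → ℝ, ContDiff ℝ 1 χ ∧ (∃ U, IsOpen U ∧ closure A ∩ closure A ⊆ U ∧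
      ∀ x ∈ U, χ x = 0) ∧ ∀ w : Plane → ℂ, ContDiff ℝ 1 w → HasCompactSupport w →
        P fun x => (1 - χ x) • w x := by
    refine hA.isCompact_closure.induction_on (p := fun S => ∃ χ : Plane → ℝ, ContDiff ℝ 1 χ ∧
      (∃ U, IsOpen U ∧ closure A ∩ S ⊆ U ∧ ∀ x ∈ U, χ x = 0) ∧
      ∀ w : Plane → ℂ, ContDiff ℝ 1 w → HasCompactSupport w →
        P fun x => (1 - χ x) • w x) ?_ ?_ ?_ ?_
    · refine ⟨fun _ => 1, contDiff_const, ⟨∅, isOpen_empty, by simp, by simp⟩, fun w _ _ a => ?_⟩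
      simp
    · rintro S T hST ⟨χ, hχ, ⟨U, hU, hTU, h0⟩, hw⟩
      exact ⟨χ, hχ, ⟨U, hU, (Set.inter_subset_inter_right _ hST).trans hTU, h0⟩, hw⟩
    -- For a union the product χχ' works, since 1 - χχ' = (1 - χ) + (1 - χ')χ.
    · rintro S T ⟨χ, hχ, ⟨U, hU, hSU, h0⟩, hP⟩ ⟨χ', hχ', ⟨U', hU', hTU', h0'⟩, hP'⟩
      refine ⟨fun x => χ x * χ' x, hχ.mul hχ', ⟨U ∪ U', hU.union hU', ?_, ?_⟩, fun w hw hwc => ?_⟩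
      · rw [Set.inter_union_distrib_left]
        exact Set.union_subset_union hSU hTU'
      · rintro x (hx | hx)
        · exact mul_eq_zero_of_left (h0 x hx) _
        · exact mul_eq_zero_of_right _ (h0' x hx)
      · have hw' : ContDiff ℝ 1 fun x => χ x • w x := hχ.smul hw
        have hwc' : HasCompactSupport fun x => χ x • w x :=
          hwc.mono fun x hx h0 => hx (show χ x • w x = 0 by rw [h0, smul_zero])
        have hs1 : ContDiff ℝ 1 fun x => (1 - χ x) • w x := (contDiff_const.sub hχ).smul hw
        have hs2 : ContDiff ℝ 1 fun x => (1 - χ' x) • (χ x • w x) :=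
          (contDiff_const.sub hχ').smul hw'
        have := hadd hs1 hs2
          (hwc.mono fun x hx h0 => hx (show (1 - χ x) • w x = 0 by rw [h0, smul_zero]))
          (hwc'.mono fun x hx h0 => hx (show (1 - χ' x) • (χ x • w x) = 0 by
            rw [show χ x • w x = 0 from h0, smul_zero]))
          (hP w hw hwc) (hP' _ hw' hwc')
        convert this using 1
        ext1 x
        simp only [Pi.add_apply, smul_smul, ← add_smul]
        congr 1
        ring
    · intro p hp
      obtain ⟨U, hU, hUw⟩ := h p hp
      obtain ⟨r, hr, hrU⟩ := Metric.mem_nhds_iff.1 hU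
      let b : ContDiffBump p := ⟨r / 4, r / 2, by positivity, by linarith⟩
      refine ⟨Metric.ball p (r / 4), nhdsWithin_le_nhds (Metric.ball_mem_nhds p (by positivity)),
        fun x => 1 - b x, contDiff_const.sub b.contDiff,
        ⟨Metric.ball p (r / 4), Metric.isOpen_ball, Set.inter_subset_right, fun x hx => ?_⟩,
        fun w hw hwc a => ?_⟩
      · exact sub_eq_zero.2 (b.one_of_mem_closedBall (Metric.ball_subset_closedBall hx)).symm
      · simp only [sub_sub_cancel]
        refine hUw _ a (b.contDiff.smul hw) ?_ ?_
        · exact hwc.mono fun x hx h0 => hx (show b x • w x = 0 by rw [h0, smul_zero])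
        · refine (tsupport_smul_subset_left b w).trans ?_
          rw [b.tsupport_eq]
          exact (Metric.closedBall_subset_ball (by simp only [b]; linarith)).trans hrU
  obtain ⟨χ, hχ, ⟨U, hU, hAU, h0⟩, hP⟩ := key
  rw [Set.inter_self] at hAU
  intro w a hw hwc
  have hz : P fun x => χ x • w x := by
    intro a
    have hfd : ∀ z ∈ closure A, fderiv ℝ (fun x => χ x • w x) z = 0 := by
      intro z hz
      have : (fun x => χ x • w x) =ᶠ[𝓝 z] fun _ => 0 := by
        filter_upwards [hU.mem_nhds (hAU hz)] with x hx
        rw [h0 x hx, zero_smul]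
      rw [this.fderiv_eq, fderiv_fun_const]
      rfl
    rw [setIntegral_eq_zero_of_forall_eq_zero fun z hz => by rw [hfd z (subset_closure hz)]; rfl,
      integral_eq_zero_of_ae]
    filter_upwards [hσ] with x hx
    rw [h0 x (hAU hx), zero_smul, smul_zero]
    rfl
  have heq : ((fun x => (1 - χ x) • w x) + fun x => χ x • w x) = w := by
    ext1 x
    rw [Pi.add_apply, ← add_smul, sub_add_cancel, one_smul]
  have := hadd (u := fun x => (1 - χ x) • w x) (v := fun x => χ x • w x)
    ((contDiff_const.sub hχ).smul hw) (hχ.smul hw)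
    (hwc.mono fun x hx h0 => hx (show (1 - χ x) • w x = 0 by rw [h0, smul_zero]))
    (hwc.mono fun x hx h0 => hx (show χ x • w x = 0 by rw [h0, smul_zero])) (hP w hw hwc) hz a
  rwa [heq] at this

/-- Near an interior point the test function does not meet the boundary and the formula is that of
the whole plane; near a boundary point a graph chart applies. -/
theorem isGaussGreen_bdryMeasure {E : Set Plane} {α : ℝ≥0} (h : IsOfClassC1Holder α E)
    (hE : IsOpen E) (hb : Bornology.IsBounded E) :
    IsGaussGreen E (bdryMeasure E) (normalField E) := by
  have := h.isFiniteMeasure hb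
  refine isGaussGreen_of_locally hb ((ae_mem_frontier E).mono fun _ => (frontier_subset_closure ·))
    h.measurable_normalField h.norm_normalField_le fun p hp => ?_
  by_cases hpE : p ∈ E
  · refine ⟨E, hE.mem_nhds hpE, fun w a hw hwc hws => ?_⟩
    have h0 : ∫ x, (inner ℝ a (normalField E x) : ℝ) • w x ∂(bdryMeasure E) = 0 := by
      refine integral_eq_zero_of_ae ?_
      filter_upwards [ae_mem_frontier E] with x hx
      have : w x = 0 := image_eq_zero_of_notMem_tsupport fun hx' =>
        hx.2 (hE.interior_eq.symm ▸ hws hx')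
      rw [this, smul_zero]
      rfl
    rw [h0, setIntegral_eq_integral_of_forall_compl_eq_zero]
    · simpa using isGaussGreen_univ w a hw hwc
    · intro z hz
      rw [image_eq_zero_of_notMem_tsupport (f := fderiv ℝ w) fun hz' =>
        hz (hws (tsupport_fderiv_subset ℝ hz'))]
      rfl
  · have hpf : p ∈ frontier E := ⟨hp, fun hi => hpE (interior_subset hi)⟩
    obtain ⟨e, f, C, r, -, hch⟩ := h.exists_chart hpf
    exact ⟨Metric.ball p r, Metric.ball_mem_nhds p hch.pos, fun w a hw hwc hws =>
      hch.integral_fderiv_eq hE.measurableSet hw hwc hws a⟩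

/-! ### The annular region between the two boundaries -/

theorem IsUpperRegular.add {μ ν : Measure Plane} (hμ : IsUpperRegular μ) (hν : IsUpperRegular ν) :
    IsUpperRegular (μ + ν) := by
  obtain ⟨C, hC, h⟩ := hμ
  obtain ⟨C', hC', h'⟩ := hν
  refine ⟨C + C', by positivity, fun x r hr => ?_⟩
  rw [Measure.add_apply, add_mul, ENNReal.ofReal_add (by positivity) (by positivity)]
  exact add_le_add (h x r hr) (h' x r hr)

theorem IsOutwardUnitNormal.congr {E F : Set Plane} {x n : Plane} (h : IsOutwardUnitNormal E x n)
    (hEF : ∀ᶠ y in 𝓝 x, y ∈ F ↔ y ∈ E) : IsOutwardUnitNormal F x n := by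
  refine ⟨h.1, fun ε hε => ?_⟩
  filter_upwards [h.2 ε hε, hEF] with y hy hiff
  rwa [hiff]

theorem IsOutwardUnitNormal.compl {E : Set Plane} {x n : Plane} (h : IsOutwardUnitNormal E x n) :
    IsOutwardUnitNormal Eᶜ x (-n) := by
  refine ⟨by rw [norm_neg, h.1], fun ε hε => ?_⟩
  filter_upwards [h.2 ε hε] with y hy
  rw [inner_neg_right, Set.notMem_compl_iff]
  exact ⟨fun hyE => by linarith [hy.2 hyE], fun hyE => by linarith [hy.1 hyE]⟩

section Annulus

variable {D Ω : Set Plane} {α : ℝ≥0}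

theorem disjoint_frontier_of_closure_subset (hΩ : IsOpen Ω) (hDΩ : closure D ⊆ Ω) :
    Disjoint (frontier D) (frontier Ω) :=
  Set.disjoint_left.2 fun _ hx hx' =>
    hx'.2 (hΩ.interior_eq.symm ▸ hDΩ (frontier_subset_closure hx))

/-- The outward unit normal to `Ω \ D` on its boundary. -/
def annulusNormal (D Ω : Set Plane) (x : Plane) : Plane := normalField Ω x - normalField D x

theorem annulusNormal_inner (h : Disjoint (frontier D) (frontier Ω)) {x : Plane}
    (hx : x ∈ frontier D) : annulusNormal D Ω x = -normalField D x := by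
  rw [annulusNormal, normalField, Set.indicator_of_notMem (Set.disjoint_left.1 h hx), zero_sub]

theorem annulusNormal_outer (h : Disjoint (frontier D) (frontier Ω)) {x : Plane}
    (hx : x ∈ frontier Ω) : annulusNormal D Ω x = normalField Ω x := by
  rw [annulusNormal, normalField, normalField,
    Set.indicator_of_notMem (s := frontier D) (Set.disjoint_right.1 h hx), sub_zero]

theorem norm_annulusNormal_le (h : Disjoint (frontier D) (frontier Ω))
    (hD : IsOfClassC1Holder α D) (hΩ : IsOfClassC1Holder α Ω) (x : Plane) :
    ‖annulusNormal D Ω x‖ ≤ 1 := by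
  by_cases hx : x ∈ frontier D
  · rw [annulusNormal_inner h hx, norm_neg]
    exact hD.norm_normalField_le x
  · rw [annulusNormal, normalField, normalField, Set.indicator_of_notMem (s := frontier D) hx,
      sub_zero]
    exact hΩ.norm_normalField_le x

/-- The two boundary curves are disjoint compact sets, so near a point of one of them the other is
invisible and each local property reduces to D or Ω. Near ∂D the region coincides with the
complement of D, whose outward normal is -ν_i. -/
theorem isNPData_diff (hα : 0 < α) (hα1 : α < 1) (hΩ : IsOpen Ω) (hΩb : Bornology.IsBounded Ω)
    (hD : IsOpen D) (hDΩ : closure D ⊆ Ω) (hΩα : IsOfClassC1Holder α Ω)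
    (hDα : IsOfClassC1Holder α D) :
    IsNPData (Ω \ D) (frontier D ∪ frontier Ω) (bdryMeasure D + bdryMeasure Ω)
      (annulusNormal D Ω) := by
  have hDb : Bornology.IsBounded D := hΩb.subset (subset_closure.trans hDΩ)
  have hdis := disjoint_frontier_of_closure_subset hΩ hDΩ
  have hfD := hDα.isFiniteMeasure hDb
  have hfΩ := hΩα.isFiniteMeasure hΩb
  have hn1 := norm_annulusNormal_le hdis hDα hΩα
  have hnm : Measurable (annulusNormal D Ω) :=
    hΩα.measurable_normalField.sub hDα.measurable_normalField
  have hcΓ : IsCompact (frontier D ∪ frontier Ω) :=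
    (isCompact_frontier_of_isBounded hDb).union (isCompact_frontier_of_isBounded hΩb)
  have hnearD : ∀ y ∈ frontier D, Ω ∈ 𝓝 y := fun y hy =>
    hΩ.mem_nhds (hDΩ (frontier_subset_closure hy))
  have hnearΩ : ∀ y ∈ frontier Ω, (closure D)ᶜ ∈ 𝓝 y := fun y hy =>
    isClosed_closure.isOpen_compl.mem_nhds fun hy' => hy.2 (hΩ.interior_eq.symm ▸ hDΩ hy')
  refine ⟨hΩ.measurableSet.diff hD.measurableSet, hΩb.subset Set.sdiff_subset, hcΓ, ?_,
    (hDα.isUpperRegular hDb).add (hΩα.isUpperRegular hΩb), hnm, hn1, ?_, ?_, ?_⟩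
  · rw [ae_add_measure_iff]
    exact ⟨(ae_mem_frontier D).mono fun _ => Or.inl, (ae_mem_frontier Ω).mono fun _ => Or.inr⟩
  · refine isWeaklySingular_of_locally hn1 hcΓ hcΓ hα hα1 ?_
    rintro p (hp | hp) -
    · obtain ⟨U, hU, C, hC⟩ := hDα.exists_abs_inner_le hp
      have hmem : ∀ x ∈ (frontier D ∪ frontier Ω) ∩ (U ∩ Ω), x ∈ frontier D ∩ U := by
        rintro x ⟨hx | hx, hxU, hxΩ⟩
        · exact ⟨hx, hxU⟩
        · exact absurd (hΩ.interior_eq.symm ▸ hxΩ) hx.2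
      refine ⟨U ∩ Ω, inter_mem hU (hnearD p hp), C, fun x hx y hy => ?_⟩
      rw [annulusNormal_inner hdis (hmem x hx).1, inner_neg_right, abs_neg]
      exact hC x (hmem x hx) y (hmem y hy)
    · obtain ⟨U, hU, C, hC⟩ := hΩα.exists_abs_inner_le hp
      have hmem : ∀ x ∈ (frontier D ∪ frontier Ω) ∩ (U ∩ (closure D)ᶜ), x ∈ frontier Ω ∩ U := by
        rintro x ⟨hx | hx, hxU, hxD⟩
        · exact absurd (frontier_subset_closure hx) hxD
        · exact ⟨hx, hxU⟩
      refine ⟨U ∩ (closure D)ᶜ, inter_mem hU (hnearΩ p hp), C, fun x hx y hy => ?_⟩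
      rw [annulusNormal_outer hdis (hmem x hx).1]
      exact hC x (hmem x hx) y (hmem y hy)
  · intro w a hw hwc
    have hi : Integrable fun z => fderiv ℝ w z a := ((hw.continuous_fderiv one_ne_zero).clm_apply
        continuous_const).integrable_of_hasCompactSupport (hwc.fderiv_apply (𝕜 := ℝ) a)
    have hj : ∀ {σ : Measure Plane} [IsFiniteMeasure σ],
        Integrable (fun x => (inner ℝ a (annulusNormal D Ω x) : ℝ) • w x) σ := by
      intro σ _
      have hwi : Integrable w σ := hw.continuous.integrable_of_hasCompactSupport hwc
      refine Integrable.bdd_smul (φ := fun x => (inner ℝ a (annulusNormal D Ω x) : ℝ)) (C := ‖a‖)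
        hwi ?_ (ae_of_all _ fun x => ?_)
      · exact (measurable_const.inner hnm).aestronglyMeasurable
      · refine (abs_real_inner_le_norm _ _).trans ?_
        exact mul_le_of_le_one_right (norm_nonneg _) (hn1 x)
    have e1 : ∫ x, (inner ℝ a (annulusNormal D Ω x) : ℝ) • w x ∂(bdryMeasure D) =
        -∫ x, (inner ℝ a (normalField D x) : ℝ) • w x ∂(bdryMeasure D) := by
      rw [← integral_neg]
      refine integral_congr_ae ?_
      filter_upwards [ae_mem_frontier D] with x hx
      rw [annulusNormal_inner hdis hx, inner_neg_right, neg_smul]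
    have e2 : ∫ x, (inner ℝ a (annulusNormal D Ω x) : ℝ) • w x ∂(bdryMeasure Ω) =
        ∫ x, (inner ℝ a (normalField Ω x) : ℝ) • w x ∂(bdryMeasure Ω) := by
      refine integral_congr_ae ?_
      filter_upwards [ae_mem_frontier Ω] with x hx
      rw [annulusNormal_outer hdis hx]
    -- The formula for Ω minus the formula for D; the reversed normal on ∂D absorbs the sign.
    rw [setIntegral_sdiff hD.measurableSet hi.integrableOn (subset_closure.trans hDΩ),
      integral_add_measure hj hj, e1, e2, isGaussGreen_bdryMeasure hΩα hΩ hΩb w a hw hwc,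
      isGaussGreen_bdryMeasure hDα hD hDb w a hw hwc]
    ring
  · rintro y (hy | hy)
    · refine ((hDα.isOutwardUnitNormal hy).compl.congr ?_).hasBlowUpDensity
      filter_upwards [hnearD y hy] with z hz
      simp [hz]
    · refine ((hΩα.isOutwardUnitNormal hy).congr ?_).hasBlowUpDensity
      filter_upwards [hnearΩ y hy] with z hz
      have : z ∉ D := fun hzD => hz (subset_closure hzD)
      simp [this]

end Annulus

/-! ### Single layer potentials off their boundary, and the kernels of the matrix entries -/

theorem hasFDerivAt_fundamentalSolution {z : Plane} (hz : z ≠ 0) :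
    HasFDerivAt fundamentalSolution (innerSL ℝ (gradG 0 z)) z := by
  have hpi := Real.pi_pos
  have hq : ‖z‖ ≠ 0 := norm_ne_zero_iff.2 hz
  have h1 : HasFDerivAt (fun z : Plane => ‖z‖ ^ 2) (2 • (innerSL ℝ z)) z :=
    (hasStrictFDerivAt_norm_sq z).hasFDerivAt
  have h2 := (h1.log (pow_ne_zero 2 hq)).const_mul (4 * Real.pi)⁻¹
  -- Valid at the origin too, where both logarithms are `Real.log 0 = 0`.
  have heq : fundamentalSolution = fun z : Plane => (4 * Real.pi)⁻¹ * Real.log (‖z‖ ^ 2) := by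
    ext1 z
    rw [fundamentalSolution, Real.log_pow]
    push_cast
    field_simp
    ring
  rw [heq]
  refine h2.congr_fderiv ?_
  ext v
  simp [gradG]
  field_simp
  norm_num

/-- On half the ball that avoids the boundary all distances to the boundary are at least d/2, which
bounds the gradient of the kernel and justifies differentiation under the integral. -/
theorem hasFDerivAt_singleLayer {E : Set Plane} (hE : Bornology.IsBounded E)
    [IsFiniteMeasure (bdryMeasure E)] {φ : Plane → ℂ} (hφ : MemLp φ 2 (bdryMeasure E)) {x₀ : Plane}
    (hx₀ : x₀ ∉ frontier E) :
    HasFDerivAt (singleLayer E φ)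
      (∫ y, (innerSL ℝ (gradG 0 (x₀ - y))).smulRight (φ y) ∂(bdryMeasure E)) x₀ ∧
    Integrable (fun y => (innerSL ℝ (gradG 0 (x₀ - y))).smulRight (φ y)) (bdryMeasure E) := by
  obtain ⟨d, hd, hball⟩ := Metric.isOpen_iff.1 isClosed_frontier.isOpen_compl x₀ hx₀
  have hφi : Integrable φ (bdryMeasure E) := hφ.integrable one_le_two
  have hfar : ∀ x ∈ Metric.ball x₀ (d / 2), ∀ y ∈ frontier E, d / 2 ≤ ‖x - y‖ := by
    intro x hx y hy
    by_contra! hlt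
    refine hball ?_ hy
    rw [← dist_eq_norm, dist_comm] at hlt
    rw [Metric.mem_ball] at hx ⊢
    linarith [dist_triangle y x x₀]
  have hGm : Measurable fundamentalSolution := by
    unfold fundamentalSolution
    fun_prop
  have hm : ∀ x, AEStronglyMeasurable (fun y => fundamentalSolution (x - y) • φ y)
      (bdryMeasure E) := fun x =>
    (hGm.comp (measurable_const.sub measurable_id)).aestronglyMeasurable.smul
      hφi.aestronglyMeasurable
  have hm' : AEStronglyMeasurable (fun y => (innerSL ℝ (gradG 0 (x₀ - y))).smulRight (φ y))
      (bdryMeasure E) := by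
    have h1 : Measurable fun y => gradG 0 (x₀ - y) :=
      (measurable_gradG 0).comp (measurable_const.sub measurable_id)
    have h2 : AEStronglyMeasurable (fun y => innerSL ℝ (gradG 0 (x₀ - y))) (bdryMeasure E) :=
      (innerSL ℝ (E := Plane)).continuous.comp_aestronglyMeasurable h1.aestronglyMeasurable
    exact (ContinuousLinearMap.smulRightL ℝ Plane ℂ).aestronglyMeasurable_comp₂ h2
      hφi.aestronglyMeasurable
  have hb : ∀ᵐ y ∂(bdryMeasure E), ∀ x ∈ Metric.ball x₀ (d / 2),
      ‖(innerSL ℝ (gradG 0 (x - y))).smulRight (φ y)‖ ≤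
        (2 * Real.pi)⁻¹ * (d / 2)⁻¹ * ‖φ y‖ := by
    filter_upwards [ae_mem_frontier E] with y hy x hx
    rw [ContinuousLinearMap.norm_smulRight_apply, innerSL_apply_norm, norm_gradG_zero]
    gcongr
    exact hfar x hx y hy
  have hi := hφi.norm.const_mul ((2 * Real.pi)⁻¹ * (d / 2)⁻¹)
  have hx₀b : x₀ ∈ Metric.ball x₀ (d / 2) := Metric.mem_ball_self (by positivity)
  refine ⟨hasFDerivAt_integral_of_dominated_of_fderiv_le (F' := fun x y =>
      (innerSL ℝ (gradG 0 (x - y))).smulRight (φ y)) (Metric.isOpen_ball.mem_nhds hx₀b)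
    (Eventually.of_forall hm) ?_ hm' hb hi ?_, hi.mono' hm' ?_⟩
  · have hc : ContinuousOn (fun y => fundamentalSolution (x₀ - y)) (frontier E) := by
      intro y hy
      have hne : x₀ - y ≠ 0 := sub_ne_zero.2 fun h => hx₀ (h ▸ hy)
      exact ((hasFDerivAt_fundamentalSolution hne).continuousAt.comp
        (f := fun y => x₀ - y) (by fun_prop)).continuousWithinAt
    obtain ⟨C, hC⟩ := (isCompact_frontier_of_isBounded hE).exists_bound_of_continuousOn hc
    refine hφi.bdd_smul (φ := fun y => fundamentalSolution (x₀ - y)) (C := C)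
      (hGm.comp (measurable_const.sub measurable_id)).aestronglyMeasurable ?_
    exact (ae_mem_frontier E).mono hC
  · filter_upwards [ae_mem_frontier E] with y hy x hx
    have hne : x - y ≠ 0 := norm_pos_iff.1 ((half_pos hd).trans_le (hfar x hx y hy))
    exact ((hasFDerivAt_fundamentalSolution hne).comp x
      ((hasFDerivAt_id x).sub_const y)).smul_const (φ y)
  · exact hb.mono fun y hy => hy x₀ hx₀b

theorem normalDeriv_singleLayer {E F : Set Plane} (hE : Bornology.IsBounded E)
    [IsFiniteMeasure (bdryMeasure E)] {φ : Plane → ℂ} (hφ : MemLp φ 2 (bdryMeasure E)) {x : Plane}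
    (hx : x ∉ frontier E) (hxF : x ∈ frontier F) :
    normalDeriv F (singleLayer E φ) x = ∫ y, dnG (normalField F) 0 x y • φ y ∂(bdryMeasure E) := by
  obtain ⟨h, hi⟩ := hasFDerivAt_singleLayer hE hφ hx
  rw [normalDeriv, h.fderiv, ContinuousLinearMap.integral_apply hi, ← normalField_eq hxF]
  rfl

theorem npAdjointKernel_eq {E : Set Plane} {x : Plane} (hx : x ∈ frontier E) (y : Plane) :
    npAdjointKernel E x y = dnG (normalField E) 0 x y := by
  rw [npAdjointKernel, dnG, normalField_eq hx, gradG, real_inner_smul_left]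
  simp
  ring

theorem IsOfClassC1Holder.isWeaklySingular {E : Set Plane} {α : ℝ≥0} (h : IsOfClassC1Holder α E)
    (hα : 0 < α) (hα1 : α < 1) (hE : Bornology.IsBounded E) :
    IsWeaklySingular (normalField E) (frontier E) (frontier E) :=
  isWeaklySingular_of_locally h.norm_normalField_le (isCompact_frontier_of_isBounded hE)
    (isCompact_frontier_of_isBounded hE) hα hα1 fun _ hp _ => h.exists_abs_inner_le hp

theorem IsOfClassC1Holder.isWeaklySingular_of_disjoint {E F : Set Plane} {α : ℝ≥0}
    (h : IsOfClassC1Holder α E) (hα : 0 < α) (hα1 : α < 1) (hE : Bornology.IsBounded E)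
    (hF : Bornology.IsBounded F) (hEF : Disjoint (frontier E) (frontier F)) :
    IsWeaklySingular (normalField E) (frontier E) (frontier F) :=
  isWeaklySingular_of_locally h.norm_normalField_le (isCompact_frontier_of_isBounded hE)
    (isCompact_frontier_of_isBounded hF) hα hα1 fun _ hp hp' =>
    absurd hp' (Set.disjoint_left.1 hEF hp)

/-! ### Gluing densities and block operators -/

/-- The function on `∂D ∪ ∂Ω` with restrictions `f` and `g`. -/
def glue (D Ω : Set Plane) (f g : Plane → ℂ) (x : Plane) : ℂ :=
  (frontier D).indicator f x + (frontier Ω).indicator g x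

theorem glue_inner {D Ω : Set Plane} (h : Disjoint (frontier D) (frontier Ω)) (f g : Plane → ℂ)
    {x : Plane} (hx : x ∈ frontier D) : glue D Ω f g x = f x := by
  rw [glue, Set.indicator_of_mem hx, Set.indicator_of_notMem (Set.disjoint_left.1 h hx), add_zero]

theorem glue_outer {D Ω : Set Plane} (h : Disjoint (frontier D) (frontier Ω)) (f g : Plane → ℂ)
    {x : Plane} (hx : x ∈ frontier Ω) : glue D Ω f g x = g x := by
  rw [glue, Set.indicator_of_mem hx, Set.indicator_of_notMem (Set.disjoint_right.1 h hx), zero_add]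

theorem glue_inner_ae {D Ω : Set Plane} (h : Disjoint (frontier D) (frontier Ω))
    (f g : Plane → ℂ) : glue D Ω f g =ᵐ[bdryMeasure D] f :=
  (ae_mem_frontier D).mono fun _ => glue_inner h f g

theorem glue_outer_ae {D Ω : Set Plane} (h : Disjoint (frontier D) (frontier Ω))
    (f g : Plane → ℂ) : glue D Ω f g =ᵐ[bdryMeasure Ω] g :=
  (ae_mem_frontier Ω).mono fun _ => glue_outer h f g

theorem memLp_two_add_measure {μ ν : Measure Plane} {φ : Plane → ℂ} (hμ : MemLp φ 2 μ)
    (hν : MemLp φ 2 ν) : MemLp φ 2 (μ + ν) := by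
  have hm : AEStronglyMeasurable φ (μ + ν) :=
    aestronglyMeasurable_add_measure_iff.2 ⟨hμ.aestronglyMeasurable, hν.aestronglyMeasurable⟩
  rw [memLp_two_iff_integrable_sq_norm hm]
  exact ((memLp_two_iff_integrable_sq_norm hμ.aestronglyMeasurable).1 hμ).add_measure
    ((memLp_two_iff_integrable_sq_norm hν.aestronglyMeasurable).1 hν)

theorem integral_dnG_glue {D Ω : Set Plane} (h : Disjoint (frontier D) (frontier Ω))
    {f g : Plane → ℂ} {n : Plane → Plane} {x : Plane}
    (hf : Integrable (fun y => dnG n 0 x y • f y) (bdryMeasure D))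
    (hg : Integrable (fun y => dnG n 0 x y • g y) (bdryMeasure Ω)) :
    ∫ y, dnG n 0 x y • glue D Ω f g y ∂(bdryMeasure D + bdryMeasure Ω) =
      ∫ y, dnG n 0 x y • f y ∂(bdryMeasure D) + ∫ y, dnG n 0 x y • g y ∂(bdryMeasure Ω) := by
  have hf' : (fun y => dnG n 0 x y • glue D Ω f g y) =ᵐ[bdryMeasure D]
      fun y => dnG n 0 x y • f y := (glue_inner_ae h f g).mono fun y hy => by simp only [hy]
  have hg' : (fun y => dnG n 0 x y • glue D Ω f g y) =ᵐ[bdryMeasure Ω]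
      fun y => dnG n 0 x y • g y := (glue_outer_ae h f g).mono fun y hy => by simp only [hy]
  rw [integral_add_measure (hf.congr hf'.symm) (hg.congr hg'.symm), integral_congr_ae hf',
    integral_congr_ae hg']

/-- The `2 × 2` operator matrix with entries `A`, `B`, `C`, `F` on a Hilbert sum. -/
def blockOperator {H₁ H₂ : Type*} [NormedAddCommGroup H₁] [NormedSpace ℂ H₁]
    [NormedAddCommGroup H₂] [NormedSpace ℂ H₂] (A : H₁ →L[ℂ] H₁) (B : H₂ →L[ℂ] H₁)
    (C : H₁ →L[ℂ] H₂) (F : H₂ →L[ℂ] H₂) : WithLp 2 (H₁ × H₂) →L[ℂ] WithLp 2 (H₁ × H₂) :=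
  ((WithLp.prodContinuousLinearEquiv 2 ℂ H₁ H₂).symm : H₁ × H₂ →L[ℂ] WithLp 2 (H₁ × H₂)) ∘L
    (ContinuousLinearMap.inl ℂ H₁ H₂ ∘L (A ∘L ContinuousLinearMap.fst ℂ H₁ H₂ +
        B ∘L ContinuousLinearMap.snd ℂ H₁ H₂) +
      ContinuousLinearMap.inr ℂ H₁ H₂ ∘L (C ∘L ContinuousLinearMap.fst ℂ H₁ H₂ +
        F ∘L ContinuousLinearMap.snd ℂ H₁ H₂)) ∘L
    (WithLp.prodContinuousLinearEquiv 2 ℂ H₁ H₂ : WithLp 2 (H₁ × H₂) →L[ℂ] H₁ × H₂)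

section Block

variable {H₁ H₂ : Type*} [NormedAddCommGroup H₁] [NormedSpace ℂ H₁] [NormedAddCommGroup H₂]
  [NormedSpace ℂ H₂] {A : H₁ →L[ℂ] H₁} {B : H₂ →L[ℂ] H₁} {C : H₁ →L[ℂ] H₂} {F : H₂ →L[ℂ] H₂}

theorem blockOperator_fst (x : WithLp 2 (H₁ × H₂)) :
    (blockOperator A B C F x).fst = A x.fst + B x.snd := by
  simp [blockOperator]

theorem blockOperator_snd (x : WithLp 2 (H₁ × H₂)) :
    (blockOperator A B C F x).snd = C x.fst + F x.snd := by
  simp [blockOperator]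

theorem isCompactOperator_blockOperator (hA : IsCompactOperator A) (hB : IsCompactOperator B)
    (hC : IsCompactOperator C) (hF : IsCompactOperator F) :
    IsCompactOperator (blockOperator A B C F) := by
  have h1 := ((hA.comp_clm (ContinuousLinearMap.fst ℂ H₁ H₂)).add
    (hB.comp_clm (ContinuousLinearMap.snd ℂ H₁ H₂))).clm_comp (ContinuousLinearMap.inl ℂ H₁ H₂)
  have h2 := ((hC.comp_clm (ContinuousLinearMap.fst ℂ H₁ H₂)).add
    (hF.comp_clm (ContinuousLinearMap.snd ℂ H₁ H₂))).clm_comp (ContinuousLinearMap.inr ℂ H₁ H₂)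
  exact ((h1.add h2).comp_clm
    (WithLp.prodContinuousLinearEquiv 2 ℂ H₁ H₂ : WithLp 2 (H₁ × H₂) →L[ℂ] H₁ × H₂)).clm_comp
    ((WithLp.prodContinuousLinearEquiv 2 ℂ H₁ H₂).symm : H₁ × H₂ →L[ℂ] WithLp 2 (H₁ × H₂))

end Block

end NeumannPoincare

end

/-! ### The operator matrix and its spectrum -/

open NeumannPoincare in
theorem lemma3p1 (α : NNReal) (hα₀ : 0 < α) (hα₁ : α < 1)
    (D Ω : Set Plane)
    (hΩ : IsDomainSet Ω) (hΩb : Bornology.IsBounded Ω) (hD : IsDomainSet D)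
    (hDΩ : closure D ⊆ Ω)
    (hΩα : IsOfClassC1Holder α Ω) (hDα : IsOfClassC1Holder α D) :
    ∃ K : BdryPair D Ω →L[ℂ] BdryPair D Ω, IsNPTypeOperator D Ω K ∧
      spectrum ℂ K ⊆ (fun t : ℝ => (t : ℂ)) '' Set.Icc (-1 / 2) (1 / 2) := by
  have hDb : Bornology.IsBounded D := hΩb.subset (subset_closure.trans hDΩ)
  have hdis := disjoint_frontier_of_closure_subset hΩ.1 hDΩ
  have hfD := hDα.isFiniteMeasure hDb
  have hfΩ := hΩα.isFiniteMeasure hΩb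
  have hcD := isCompact_frontier_of_isBounded hDb
  have hcΩ := isCompact_frontier_of_isBounded hΩb
  obtain ⟨T₁₁, hc₁₁, hi₁₁, h₁₁⟩ := exists_compact_clm_of_isWeaklySingular
    (hDα.isUpperRegular hDb) (hDα.isUpperRegular hDb) hcD hcD (ae_mem_frontier D)
    (ae_mem_frontier D) hDα.measurable_normalField hDα.continuousOn_normalField
    (hDα.isWeaklySingular hα₀ hα₁ hDb)
  obtain ⟨T₁₂, hc₁₂, hi₁₂, h₁₂⟩ := exists_compact_clm_of_isWeaklySingular
    (hΩα.isUpperRegular hΩb) (hDα.isUpperRegular hDb) hcD hcΩ (ae_mem_frontier D)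
    (ae_mem_frontier Ω) hDα.measurable_normalField hDα.continuousOn_normalField
    (hDα.isWeaklySingular_of_disjoint hα₀ hα₁ hDb hΩb hdis)
  obtain ⟨T₂₁, hc₂₁, hi₂₁, h₂₁⟩ := exists_compact_clm_of_isWeaklySingular
    (hDα.isUpperRegular hDb) (hΩα.isUpperRegular hΩb) hcΩ hcD (ae_mem_frontier Ω)
    (ae_mem_frontier D) hΩα.measurable_normalField hΩα.continuousOn_normalField
    (hΩα.isWeaklySingular_of_disjoint hα₀ hα₁ hΩb hDb hdis.symm)
  obtain ⟨T₂₂, hc₂₂, hi₂₂, h₂₂⟩ := exists_compact_clm_of_isWeaklySingular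
    (hΩα.isUpperRegular hΩb) (hΩα.isUpperRegular hΩb) hcΩ hcΩ (ae_mem_frontier Ω)
    (ae_mem_frontier Ω) hΩα.measurable_normalField hΩα.continuousOn_normalField
    (hΩα.isWeaklySingular hα₀ hα₁ hΩb)
  let K : BdryPair D Ω →L[ℂ] BdryPair D Ω := blockOperator (-T₁₁) (-T₁₂) T₂₁ T₂₂
  have hKc : IsCompactOperator K := isCompactOperator_blockOperator hc₁₁.neg hc₁₂.neg hc₂₁ hc₂₂
  have hfst : ∀ Φ : BdryPair D Ω, ∀ᵐ x ∂(bdryMeasure D), (K Φ).fst x =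
      -(∫ y, dnG (normalField D) 0 x y • Φ.fst y ∂(bdryMeasure D)) -
        ∫ y, dnG (normalField D) 0 x y • Φ.snd y ∂(bdryMeasure Ω) := by
    intro Φ
    have e : (K Φ).fst = -T₁₁ Φ.fst - T₁₂ Φ.snd := by
      rw [blockOperator_fst, sub_eq_add_neg]
      rfl
    rw [e]
    filter_upwards [Lp.coeFn_sub (-T₁₁ Φ.fst) (T₁₂ Φ.snd), Lp.coeFn_neg (T₁₁ Φ.fst),
      h₁₁ Φ.fst, h₁₂ Φ.snd] with x e1 e2 e3 e4
    rw [e1, Pi.sub_apply, e2, Pi.neg_apply, e3, e4]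
  have hsnd : ∀ Φ : BdryPair D Ω, ∀ᵐ x ∂(bdryMeasure Ω), (K Φ).snd x =
      (∫ y, dnG (normalField Ω) 0 x y • Φ.fst y ∂(bdryMeasure D)) +
        ∫ y, dnG (normalField Ω) 0 x y • Φ.snd y ∂(bdryMeasure Ω) := by
    intro Φ
    rw [show (K Φ).snd = T₂₁ Φ.fst + T₂₂ Φ.snd from blockOperator_snd Φ]
    filter_upwards [Lp.coeFn_add (T₂₁ Φ.fst) (T₂₂ Φ.snd), h₂₁ Φ.fst, h₂₂ Φ.snd] with x e1 e2 e3
    rw [e1, Pi.add_apply, e2, e3]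
  refine ⟨K, ⟨?_, ?_, ?_, ?_, ?_, ?_⟩, ?_⟩
  · intro φ
    filter_upwards [hi₁₁ φ, ae_mem_frontier D] with x hx hxD
    simpa only [npAdjointKernel_eq hxD] using hx
  · intro φ
    filter_upwards [hi₂₂ φ, ae_mem_frontier Ω] with x hx hxΩ
    simpa only [npAdjointKernel_eq hxΩ] using hx
  · exact fun φ x hx => (hasFDerivAt_singleLayer hΩb (Lp.memLp φ)
      (Set.disjoint_left.1 hdis hx)).1.differentiableAt
  · exact fun φ x hx => (hasFDerivAt_singleLayer hDb (Lp.memLp φ)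
      (Set.disjoint_right.1 hdis hx)).1.differentiableAt
  · intro Φ
    filter_upwards [hfst Φ, ae_mem_frontier D] with x hx hxD
    rw [hx, normalDeriv_singleLayer hΩb (Lp.memLp _) (Set.disjoint_left.1 hdis hxD) hxD,
      npAdjoint]
    simp only [npAdjointKernel_eq hxD]
  · intro Φ
    filter_upwards [hsnd Φ, ae_mem_frontier Ω] with x hx hxΩ
    rw [hx, normalDeriv_singleLayer hDb (Lp.memLp _) (Set.disjoint_right.1 hdis hxΩ) hxΩ,
      npAdjoint]
    simp only [npAdjointKernel_eq hxΩ]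
  · intro l hl
    rcases eq_or_ne l 0 with rfl | hl0
    · exact ⟨0, by norm_num, by simp⟩
    -- Compactness of K: a nonzero spectral point is an eigenvalue, and 0 lies in the interval
    -- anyway.
    have hev := (hKc.hasEigenvalue_or_mem_resolventSet hl0).resolve_right hl
    obtain ⟨v, hv⟩ := hev.exists_hasEigenvector
    have hKv : K v = l • v := hv.apply_eq_smul
    have hKf : (K v).fst = l • v.fst := by rw [hKv]; rfl
    have hKs : (K v).snd = l • v.snd := by rw [hKv]; rfl
    have hgD := glue_inner_ae hdis v.fst v.snd
    have hgΩ := glue_outer_ae hdis v.fst v.snd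
    -- The two components of the eigenvector become one density on ∂D ∪ ∂Ω, to be recognised as an
    -- eigenfunction of the annular region.
    have hmem : MemLp (glue D Ω v.fst v.snd) 2 (bdryMeasure D + bdryMeasure Ω) :=
      memLp_two_add_measure ((memLp_congr_ae hgD).2 (Lp.memLp _))
        ((memLp_congr_ae hgΩ).2 (Lp.memLp _))
    refine (isNPData_diff hα₀ hα₁ hΩ.1 hΩb hD.1 hDΩ hΩα hDα).eigenvalue_mem hmem ?_ ?_
    · rw [ae_add_measure_iff]
      constructor
      · have h1 := hfst v
        rw [hKf] at h1
        filter_upwards [h1, Lp.coeFn_smul l v.fst, hgD, ae_mem_frontier D, hi₁₁ v.fst,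
          hi₁₂ v.snd] with x e1 e2 e3 hx i1 i2
        -- On ∂D the outward normal of Ω \ D is -ν_i, which accounts for both minus signs in the
        -- first row.
        have hn : ∀ y, dnG (annulusNormal D Ω) 0 x y = -dnG (normalField D) 0 x y := fun y => by
          rw [dnG, annulusNormal_inner hdis hx, inner_neg_right, dnG]
        have j1 : Integrable (fun y => dnG (annulusNormal D Ω) 0 x y • v.fst y)
            (bdryMeasure D) := by
          simp only [hn, neg_smul]
          exact i1.neg
        have j2 : Integrable (fun y => dnG (annulusNormal D Ω) 0 x y • v.snd y)
            (bdryMeasure Ω) := by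
          simp only [hn, neg_smul]
          exact i2.neg
        rw [e2, Pi.smul_apply, smul_eq_mul] at e1
        rw [integral_dnG_glue hdis j1 j2, e3, e1]
        simp only [hn, neg_smul, integral_neg]
        ring
      · have h1 := hsnd v
        rw [hKs] at h1
        filter_upwards [h1, Lp.coeFn_smul l v.snd, hgΩ, ae_mem_frontier Ω, hi₂₁ v.fst,
          hi₂₂ v.snd] with x e1 e2 e3 hx i1 i2
        have hn : ∀ y, dnG (annulusNormal D Ω) 0 x y = dnG (normalField Ω) 0 x y := fun y => by
          rw [dnG, annulusNormal_outer hdis hx, dnG]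
        have j1 : Integrable (fun y => dnG (annulusNormal D Ω) 0 x y • v.fst y)
            (bdryMeasure D) := by
          simpa only [hn] using i1
        have j2 : Integrable (fun y => dnG (annulusNormal D Ω) 0 x y • v.snd y)
            (bdryMeasure Ω) := by
          simpa only [hn] using i2
        rw [e2, Pi.smul_apply, smul_eq_mul] at e1
        rw [integral_dnG_glue hdis j1 j2, e3, e1]
        simp only [hn]
    · intro h0
      rw [ae_add_measure_iff] at h0
      have z1 : v.fst = 0 := Lp.eq_zero_iff_ae_eq_zero.2 (by
        filter_upwards [h0.1, hgD] with x hx hx'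
        rw [← hx', hx]; rfl)
      have z2 : v.snd = 0 := Lp.eq_zero_iff_ae_eq_zero.2 (by
        filter_upwards [h0.2, hgΩ] with x hx hx'
        rw [← hx', hx]; rfl)
      exact hv.2 ((WithLp.equiv 2 _).injective (Prod.ext z1 z2))
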